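/- Let $d\ge 1$, $T>0$. For $l=1,\dots,d$ let $\Xi_l$ be an open knot vector on $[0,1]$ of degree $p_s\ge 2$ with $m_l$ basis functions, and let $\Xi_t$ be an open knot vector on $[0,1]$ of degree $p_t\ge 1$ with $m_t$ basis functions (an open knot vector of degree $p$ with $m$ basis functions is a non-decreasing sequence of $m+p+1$ points whose first $p+1$ entries are $0$ and whose last $p+1$ entries are $1$). Let $\widehat b_{l,i}$ and $\widehat b_{t,i}$ be the associated B-splines given by the Cox–de Boor recursion (with $0/0=0$ and the last non-empty knot span closed at $1$). Let $\widehat{\mathcal S}_s$ be the span of the products $\widehat b_{1,i_1}(\eta_1)\cdots\widehat b_{d,i_d}(\eta_d)$, $\widehat{\mathcal S}_t$ the span of the $\widehat b_{t,i}$, and $\widehat{\mathcal S}$ the span of the products $\widehat b_{1,i_1}(\eta_1)\cdots\widehat b_{d,i_d}(\eta_d)\,\widehat b_{t,i_t}(\tau)$. Assume $\widehat{\mathcal S}_s\subset C^1([0,1]^d)$ and $\widehat{\mathcal S}_t\subset C^0([0,1])$. Let $\mathbf F:[0,1]^d\to\mathbb R^d$ be an injective map with components in $\widehat{\mathcal S}_s$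 whose inverse has piecewise bounded derivatives of any order (that is, on the image under $\mathbf F$ of each open mesh element, $\mathbf F^{-1}$ is $C^\infty$ with each derivative bounded). Set $\Omega:=\mathbf F((0,1)^d)$, $\mathbf G(\eta,\tau):=(\mathbf F(\eta),T\tau)$, $$\widehat{\mathcal V}_{h,0}:=\{\widehat v\in\widehat{\mathcal S} \mid \widehat v=0 \text{ on } \partial[0,1]^d\times[0,1] \text{ and on } [0,1]^d\times\{0\}\},\qquad \mathcal V_{h,0}:=\{\widehat v\circ\mathbf G^{-1}\mid \widehat v\in\widehat{\mathcal V}_{h,0}\}.$$ Let $H_\Delta(\Omega):=\{w\in H^1_0(\Omega)\mid \Delta w\in L^2(\Omega)\}$ and $$\mathcal V_0:=\{v\in L^2(0,T;H_\Delta(\Omega))\cap H^1(0,T;L^2(\Omega)) \mid v=0 \text{ on } \Omega\times\{0\}\},\qquad \|v\|_{\mathcal V_0}^2:=\|\Delta v\|_{L^2(\Omega\times(0,T))}^2+\|\partial_t v\|_{L^2(\Omega\times(0,T))}^2,$$ where $\Delta$ is the Laplacian in the space variables. Let $f\in L^2(\Omega\times(0,T))$ and put $$\mathcal A(v,w):=\int_0^T\!\!\int_\Omega\big(\partial_tv\,\partial_tw+\Delta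 v\,\Delta w-\partial_tv\,\Delta w-\Delta v\,\partial_tw\big)\,d\Omega\,dt,\qquad \mathcal F(w):=\int_0^T\!\!\int_\Omega f\,(\partial_tw-\Delta w)\,d\Omega\,dt.$$ Then $\mathcal V_{h,0}\subset\mathcal V_0$, and the following hold. (i) A function $u_h\in\mathcal V_{h,0}$ minimizes $\tfrac12\|\partial_tv_h-\Delta v_h-f\|^2_{L^2(\Omega\times(0,T))}$ over $v_h\in\mathcal V_{h,0}$ if and only if $\mathcal A(u_h,v_h)=\mathcal F(v_h)$ for all $v_h\in\mathcal V_{h,0}$. (ii) These two equivalent problems have a unique solution $u_h\in\mathcal V_{h,0}$. (iii) If $u\in\mathcal V_0$ is the minimizer of $\tfrac12\|\partial_tv-\Delta v-f\|^2_{L^2(\Omega\times(0,T))}$ over $v\in\mathcal V_0$, then $$\|u-u_h\|_{\mathcal V_0}\le\sqrt2\,\inf_{v_h\in\mathcal V_{h,0}}\|u-v_h\|_{\mathcal V_0}.$$ -/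

import Mathlib

open MeasureTheory Set Filter Topology
open scoped ContDiff ENNReal

noncomputable section

namespace SpaceTimeLS

/-! ### Univariate and tensor-product B-splines -/

/-- An open knot vector on `[0,1]` of degree `p` with `m` basis functions: a non-decreasing
sequence of `m + p + 1` points (numbered from `0` to `m + p`; the values of `knot` at larger
indices are irrelevant) whose first `p + 1` entries are `0` and whose last `p + 1` entries
are `1`. Interior repetitions are allowed. -/
structure OpenKnotVector (p m : ℕ) where
  knot : ℕ → ℝ
  mono : ∀ i j : ℕ, i ≤ j → j ≤ m + p → knot i ≤ knot j
  first : ∀ i : ℕ, i ≤ p → knot i = 0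
  last : ∀ i : ℕ, m ≤ i → i ≤ m + p → knot i = 1

/-- Cox-de Boor recursion; `bspline ξ p i` is the `i`-th B-spline of degree `p`, with `0/0 = 0`.
As usual, the last non-empty knot span is closed at `1`, so that the functions are continuous
from the left at `1`. -/
def bspline (ξ : ℕ → ℝ) : ℕ → ℕ → ℝ → ℝ
  | 0, i, η =>
      open Classical in
      if (ξ i ≤ η ∧ η < ξ (i + 1)) ∨ (η = 1 ∧ ξ i < 1 ∧ ξ (i + 1) = 1) then 1 else 0
  | p + 1, i, η =>
      (η - ξ i) / (ξ (i + p + 1) - ξ i) * bspline ξ p i η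
        + (ξ (i + p + 2) - η) / (ξ (i + p + 2) - ξ (i + 1)) * bspline ξ p (i + 1) η

/-- The univariate spline space, the span of the B-splines of degree `p` of a knot vector. -/
def splineSpace {p m : ℕ} (K : OpenKnotVector p m) : Submodule ℝ (ℝ → ℝ) :=
  Submodule.span ℝ (range fun i : Fin m => bspline K.knot p i)

/-- Physical and parametric space `ℝ^d`. -/
abbrev Space (d : ℕ) := EuclideanSpace ℝ (Fin d)

/-- The closed parametric domain `[0,1]^d`. -/
def cube (d : ℕ) : Set (Space d) := {η | ∀ l, η l ∈ Icc (0 : ℝ) 1}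

variable {d ps pt mt : ℕ} {m : Fin d → ℕ}

/-- The tensor-product spline space in the `d` spatial variables. -/
def spaceSplines (K : ∀ l, OpenKnotVector ps (m l)) : Submodule ℝ (Space d → ℝ) :=
  Submodule.span ℝ (range fun (i : ∀ l, Fin (m l)) (η : Space d) =>
    ∏ l, bspline (K l).knot ps (i l) (η l))

/-- The tensor-product spline space in the `d` spatial variables and time. -/
def spaceTimeSplines (K : ∀ l, OpenKnotVector ps (m l)) (Kt : OpenKnotVector pt mt) :
    Submodule ℝ (Space d × ℝ → ℝ) :=
  Submodule.span ℝ (range fun (i : (∀ l, Fin (m l)) × Fin mt) (q : Space d × ℝ) =>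
    (∏ l, bspline (K l).knot ps (i.1 l) (q.1 l)) * bspline Kt.knot pt i.2 q.2)

/-- The splines that vanish on `∂[0,1]^d × [0,1]` and on `[0,1]^d × {0}`. -/
def paramSpace (K : ∀ l, OpenKnotVector ps (m l)) (Kt : OpenKnotVector pt mt) :
    Set (Space d × ℝ → ℝ) :=
  {v | v ∈ spaceTimeSplines K Kt ∧
    (∀ η ∈ frontier (cube d), ∀ τ ∈ Icc (0 : ℝ) 1, v (η, τ) = 0) ∧
    (∀ η ∈ cube d, v (η, 0) = 0)}

/-- The open mesh element with multi-index `j` (empty if one of its knot spans is empty). -/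
def element (K : ∀ l, OpenKnotVector ps (m l)) (j : Fin d → ℕ) : Set (Space d) :=
  {η | ∀ l, η l ∈ Ioo ((K l).knot (j l)) ((K l).knot (j l + 1))}

/-! ### The single-patch geometry -/

/-- The physical domain: the image of the open unit cube. -/
def domain (F : Space d → Space d) : Set (Space d) := F '' interior (cube d)

/-- The inverse of the parametrization `F` of the closed cube. -/
def invParam (F : Space d → Space d) : Space d → Space d := Function.invFunOn F (cube d)

/-- `F` is a spline non-singular single-patch parametrization: its components are splines, it is
injective on the closed cube, and its inverse has piecewise (that is, on the image of each mesh
element) bounded derivatives of any order. -/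
structure IsSplinePatch (K : ∀ l, OpenKnotVector ps (m l)) (F : Space d → Space d) : Prop where
  spline : ∀ k, (fun η => F η k) ∈ spaceSplines K
  injOn : InjOn F (cube d)
  smooth_inv : ∀ j : Fin d → ℕ, (∀ l, j l < m l + ps) →
    ContDiffOn ℝ ∞ (invParam F) (F '' element K j)
  bounded_inv : ∀ j : Fin d → ℕ, (∀ l, j l < m l + ps) → ∀ k : ℕ, ∃ C : ℝ,
    ∀ x ∈ F '' element K j,
      ‖iteratedFDerivWithin ℝ k (invParam F) (F '' element K j) x‖ ≤ C

/-! ### Weak derivatives and the energy space -/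

/-- `φ ∈ C_c^∞(U)`. -/
def IsTest {X : Type*} [NormedAddCommGroup X] [NormedSpace ℝ X] (U : Set X) (φ : X → ℝ) : Prop :=
  ContDiff ℝ ∞ φ ∧ HasCompactSupport φ ∧ tsupport φ ⊆ U

/-- `w ∈ H_0^1(Ω)`, the closure of `C_c^∞(Ω)` in the `H^1(Ω)` norm. -/
def MemH01 (Ω : Set (Space d)) (w : Space d → ℝ) : Prop :=
  MemLp w 2 (volume.restrict Ω) ∧
  ∃ (g : Space d → Space d) (φ : ℕ → Space d → ℝ),
    MemLp g 2 (volume.restrict Ω) ∧ (∀ n, IsTest Ω (φ n)) ∧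
    Tendsto (fun n => eLpNorm (w - φ n) 2 (volume.restrict Ω)) atTop (𝓝 0) ∧
    Tendsto (fun n => eLpNorm (g - gradient (φ n)) 2 (volume.restrict Ω)) atTop (𝓝 0)

/-- `z` is the distributional Laplacian of `w` on `Ω`. -/
def HasWeakLaplacian (Ω : Set (Space d)) (w z : Space d → ℝ) : Prop :=
  ∀ φ : Space d → ℝ, IsTest Ω φ →
    ∫ x in Ω, w x * Laplacian.laplacian φ x = ∫ x in Ω, z x * φ x

/-- `g` is the weak derivative of `w` on `(0,T)`. -/
def HasWeakDeriv (T : ℝ) (w g : ℝ → ℝ) : Prop :=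
  ∀ φ : ℝ → ℝ, IsTest (Ioo 0 T) φ →
    ∫ t in Ioo 0 T, w t * deriv φ t = - ∫ t in Ioo 0 T, g t * φ t

/-- Lebesgue measure on the space-time cylinder `Ω × (0,T)`. -/
abbrev cylMeasure (Ω : Set (Space d)) (T : ℝ) : Measure (Space d × ℝ) :=
  volume.restrict (Ω ×ˢ Ioo 0 T)

/-- The Hilbert space `L²(Ω × (0,T))`. -/
abbrev L2Cyl (Ω : Set (Space d)) (T : ℝ) := Lp ℝ 2 (cylMeasure Ω T)

variable {Ω : Set (Space d)} {T : ℝ}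

/-- `v ∈ L²(Ω) ⊗ H^1(0,T) = L²(Ω; H^1(0,T))` with time derivative `g ∈ L²(Ω × (0,T))`. -/
def HasTimeDeriv (v g : L2Cyl Ω T) : Prop :=
  ∀ᵐ x ∂(volume.restrict Ω), HasWeakDeriv T (fun t => v (x, t)) (fun t => g (x, t))

/-- `v ∈ H_Δ(Ω) ⊗ L²(0,T) = L²(0,T; H_Δ(Ω))`, where
`H_Δ(Ω) = {w ∈ H_0^1(Ω) | Δ w ∈ L²(Ω)}`, with spatial Laplacian `z ∈ L²(Ω × (0,T))`. -/
def HasLaplacian (v z : L2Cyl Ω T) : Prop :=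
  ∀ᵐ t ∂(volume.restrict (Ioo 0 T)),
    MemH01 Ω (fun x => v (x, t)) ∧ HasWeakLaplacian Ω (fun x => v (x, t)) (fun x => z (x, t))

/-- `v = 0` on `Ω × {0}` in the sense of traces: for almost every `x` the continuous
representative of `v(x, ·)` vanishes at `0`. -/
def ZeroInitialTrace (v : L2Cyl Ω T) : Prop :=
  ∀ᵐ x ∂(volume.restrict Ω), ∃ c : ℝ → ℝ, ContinuousOn c (Icc 0 T) ∧ c 0 = 0 ∧
    (fun t => v (x, t)) =ᵐ[volume.restrict (Ioo 0 T)] c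

/-- The energy space `V_0`. -/
def V0 (Ω : Set (Space d)) (T : ℝ) : Set (L2Cyl Ω T) :=
  {v | (∃ z, HasLaplacian v z) ∧ (∃ g, HasTimeDeriv v g) ∧ ZeroInitialTrace v}

/-- The time derivative `∂_t v` (and `0` if `v` has none in `L²`). -/
def dt (v : L2Cyl Ω T) : L2Cyl Ω T :=
  open Classical in if h : ∃ g, HasTimeDeriv v g then h.choose else 0

/-- The spatial Laplacian `Δ v` (and `0` if `v` is not in `L²(0,T; H_Δ(Ω))`). -/
def lap (v : L2Cyl Ω T) : L2Cyl Ω T :=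
  open Classical in if h : ∃ z, HasLaplacian v z then h.choose else 0

/-- The norm of `V_0`. -/
def V0norm (v : L2Cyl Ω T) : ℝ := Real.sqrt (‖lap v‖ ^ 2 + ‖dt v‖ ^ 2)

/-! ### The least-squares problem and its Euler-Lagrange equation -/

/-- The least-squares functional `½ ‖∂_t v - Δ v - f‖²`. -/
def leastSquares (f v : L2Cyl Ω T) : ℝ := 1 / 2 * ‖dt v - lap v - f‖ ^ 2

/-- The bilinear form `𝒜`. -/
def formA (v w : L2Cyl Ω T) : ℝ :=
  ∫ q, (dt v q * dt w q + lap v q * lap w q - dt v q * lap w q - lap v q * dt w q)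
    ∂(cylMeasure Ω T)

/-- The linear form `ℱ`. -/
def formF (f w : L2Cyl Ω T) : ℝ := ∫ q, f q * (dt w q - lap w q) ∂(cylMeasure Ω T)

/-- `u` minimizes the least-squares functional over `V`. -/
def IsMinimizer (V : Set (L2Cyl Ω T)) (f u : L2Cyl Ω T) : Prop :=
  u ∈ V ∧ ∀ v ∈ V, leastSquares f u ≤ leastSquares f v

/-- `u` solves the variational problem `𝒜(u,v) = ℱ(v)` on `V`. -/
def IsVariationalSolution (V : Set (L2Cyl Ω T)) (f u : L2Cyl Ω T) : Prop :=
  u ∈ V ∧ ∀ v ∈ V, formA u v = formF f v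

/-- The push-forward `v̂ ∘ G⁻¹`, where `G(η, τ) = (F(η), T τ)`. -/
def pushForward (F : Space d → Space d) (T : ℝ) (v : Space d × ℝ → ℝ) : Space d × ℝ → ℝ :=
  fun q => v (invParam F q.1, q.2 / T)

/-- The isogeometric space `V_{h,0}`, the push-forward of `paramSpace`. -/
def Vh0 (K : ∀ l, OpenKnotVector ps (m l)) (Kt : OpenKnotVector pt mt)
    (F : Space d → Space d) (T : ℝ) : Set (L2Cyl (domain F) T) :=
  {v | ∃ w ∈ paramSpace K Kt, v =ᵐ[cylMeasure (domain F) T] pushForward F T w}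

end SpaceTimeLS

end

open SpaceTimeLS

open MeasureTheory Set Filter Topology
open scoped ContDiff ENNReal NNReal

noncomputable section

namespace SpaceTimeLS


/-! ### Slices of square integrable functions -/

section Slices

variable {α β : Type*} [MeasurableSpace α] [MeasurableSpace β] {μ : Measure α} {ν : Measure β}
  [SFinite μ] [SFinite ν]

/-! Write `L = ∂_t - Δ` on the energy space. Then `𝒜(v,w) = ⟨Lv, Lw⟩` and `ℱ(w) = ⟨f, Lw⟩`, so
minimizing `½‖Lv - f‖²` over a subspace means that the residual is orthogonal to the image of that
subspace under `L` (`isMinimizer_iff_inner`). Everything else follows from the norm equivalence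
`‖v‖_{V_0} ≤ ‖Lv‖ ≤ √2 ‖v‖_{V_0}`. The upper bound is elementary. The lower bound says `⟨∂_t v, Δv⟩
≤ 0`; it makes `L` injective, since a function with zero initial trace and `∂_t v = 0` vanishes.
Hence projecting `f` onto the finite-dimensional image of the discrete space gives a unique
minimizer. The residuals of `u` and `u_h` are both orthogonal to the discrete image, so Pythagoras
gives `‖L(u - u_h)‖ ≤ ‖L(u - v_h)‖`, and the norm equivalence turns this into quasi-optimality with
constant `√2`.

The inequality `⟨∂_t v, Δv⟩ ≤ 0` (`integral_dt_mul_lap_nonpos`) would be immediate from Green's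
formula if `∂_t v` had slices in `H_0^1`, but it is only square integrable. It is therefore replaced
by its averages over backward time translates, which are difference quotients of `v` up to the
factor `1/s`. Green's formula applies to these, and with `E = ‖∇v‖²` convexity gives `⟨Δv(t), v(t) -
v(t-s)⟩ ≤ (E(t-s) - E(t))/2`. The time integral of the right-hand side is nonpositive, because `v`
may be extended by zero to negative times. Continuity of translations in `L²` lets the averaging
length tend to zero.

The remaining work is conformity. A `C¹` piecewise polynomial has a Lipschitz derivative, so splines
and the components of `F` extend to functions on all of space with locally Lipschitz derivative. The
bound on the derivative of `F⁻¹` on each element passes, by continuity of the derivative of the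
extension, to the closed cube. Hence `Ω` is open, `F⁻¹` is Lipschitz, and push-forwards have
Lipschitz first derivatives, so their weak Laplacian is bounded. Membership in `H_0^1` uses no
regularity of the boundary: the superlevel sets `{|V| ≥ ε}` are compact in `Ω`, so truncation and
mollification produce test functions (`memH01_of_isCompact_superlevel`). In time the splines are
Lipschitz, and finite sums of tensor products give the result (`exists_mem_V0_of_paramSpace`). -/

lemma ae_memLp_two_slice {f : α × β → ℝ} (hf : MemLp f 2 (μ.prod ν)) :
    ∀ᵐ x ∂μ, MemLp (fun y => f (x, y)) 2 ν := by
  filter_upwards [hf.1.prodMk_left, hf.integrable_sq.prod_right_ae] with x h1 h2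
  exact (memLp_two_iff_integrable_sq h1).2 h2

lemma ae_memLp_two_slice' {f : α × β → ℝ} (hf : MemLp f 2 (μ.prod ν)) :
    ∀ᵐ y ∂ν, MemLp (fun x => f (x, y)) 2 μ :=
  ae_memLp_two_slice (f := f ∘ Prod.swap)
    (hf.comp_measurePreserving Measure.measurePreserving_swap)

lemma ae_ae_of_ae_prod' {p : α × β → Prop} (h : ∀ᵐ q ∂(μ.prod ν), p q) :
    ∀ᵐ y ∂ν, ∀ᵐ x ∂μ, p (x, y) := by
  have : ∀ᵐ q ∂(ν.prod μ), p q.swap :=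
    Measure.measurePreserving_swap.quasiMeasurePreserving.ae h
  exact Measure.ae_ae_of_ae_prod this

/-- A set with null slices is null in the product only if it is measurable, so both functions are
first replaced by measurable representatives. -/
lemma ae_prod_eq_of_ae_ae_eq {f g : α × β → ℝ} (hf : AEStronglyMeasurable f (μ.prod ν))
    (hg : AEStronglyMeasurable g (μ.prod ν))
    (h : ∀ᵐ x ∂μ, ∀ᵐ y ∂ν, f (x, y) = g (x, y)) : f =ᵐ[μ.prod ν] g := by
  have e1 := hf.ae_eq_mk
  have e2 := hg.ae_eq_mk
  have hm : MeasurableSet {q | hf.mk f q = hg.mk g q} :=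
    measurableSet_eq_fun hf.stronglyMeasurable_mk.measurable hg.stronglyMeasurable_mk.measurable
  have key : ∀ᵐ q ∂(μ.prod ν), hf.mk f q = hg.mk g q := by
    rw [Measure.ae_prod_iff_ae_ae hm]
    filter_upwards [h, Measure.ae_ae_of_ae_prod e1, Measure.ae_ae_of_ae_prod e2] with x h h1 h2
    filter_upwards [h, h1, h2] with y h h1 h2
    rw [← h1, ← h2, h]
  filter_upwards [e1, e2, key] with q h1 h2 h3
  rw [h1, h2, h3]

lemma ae_prod_eq_of_ae_ae_eq' {f g : α × β → ℝ} (hf : AEStronglyMeasurable f (μ.prod ν))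
    (hg : AEStronglyMeasurable g (μ.prod ν))
    (h : ∀ᵐ y ∂ν, ∀ᵐ x ∂μ, f (x, y) = g (x, y)) : f =ᵐ[μ.prod ν] g := by
  have := ae_prod_eq_of_ae_ae_eq (f := f ∘ Prod.swap) (g := g ∘ Prod.swap)
    (hf.comp_measurePreserving Measure.measurePreserving_swap)
    (hg.comp_measurePreserving Measure.measurePreserving_swap) h
  exact (Measure.measurePreserving_swap (μ := μ) (ν := ν)).quasiMeasurePreserving.ae_eq this

omit [SFinite μ] in
lemma integrable_mul_of_memLp_two {f g : α → ℝ} (hf : MemLp f 2 μ) (hg : MemLp g 2 μ) :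
    Integrable (fun x => f x * g x) μ :=
  hf.integrable_mul hg

end Slices

/-! ### Test functions -/

section Test

variable {X : Type*} [NormedAddCommGroup X] [NormedSpace ℝ X] {U : Set X} {φ : X → ℝ}

lemma IsTest.fderiv_apply (h : IsTest U φ) (e : X) : IsTest U (fun x => fderiv ℝ φ x e) := by
  refine ⟨?_, h.2.1.fderiv_apply ℝ e, (tsupport_fderiv_apply_subset ℝ e).trans h.2.2⟩
  exact (h.1.fderiv_right (m := ∞) le_rfl).clm_apply contDiff_const

lemma IsTest.continuous (h : IsTest U φ) : Continuous φ := h.1.continuous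

lemma IsTest.memLp [MeasurableSpace X] [OpensMeasurableSpace X] [SecondCountableTopology X]
    {μ : Measure X} [IsFiniteMeasureOnCompacts μ] (h : IsTest U φ) (p : ℝ≥0∞) : MemLp φ p μ :=
  h.continuous.memLp_of_hasCompactSupport h.2.1

lemma IsTest.zero : IsTest U (0 : X → ℝ) :=
  ⟨contDiff_const, HasCompactSupport.zero, by simp [tsupport]⟩

lemma IsTest.add {ψ : X → ℝ} (h : IsTest U φ) (h' : IsTest U ψ) : IsTest U (φ + ψ) :=
  ⟨h.1.add h'.1, h.2.1.add h'.2.1,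
    (tsupport_add φ ψ).trans (union_subset h.2.2 h'.2.2)⟩

lemma IsTest.smul (c : ℝ) (h : IsTest U φ) : IsTest U (c • φ) :=
  ⟨contDiff_const.smul h.1, h.2.1.smul_left (f := fun _ => c),
    (tsupport_smul_subset_right (fun _ => c) φ).trans h.2.2⟩

lemma IsTest.deriv {U : Set ℝ} {φ : ℝ → ℝ} (h : IsTest U φ) : IsTest U (deriv φ) := by
  have := h.fderiv_apply 1
  simpa using this

end Test

/-! ### The Laplacian of test functions -/

section Laplacian

variable {d : ℕ}

/-- The form in which integration by parts can be applied one direction at a time. -/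
lemma laplacian_eq_sum_fderiv {φ : Space d → ℝ} (h : ContDiff ℝ 2 φ) (x : Space d) :
    Laplacian.laplacian φ x = ∑ i, fderiv ℝ (fun y => fderiv ℝ φ y (EuclideanSpace.basisFun (Fin d) ℝ i)) x
      (EuclideanSpace.basisFun (Fin d) ℝ i) := by
  rw [InnerProductSpace.laplacian_eq_iteratedFDeriv_orthonormalBasis φ (EuclideanSpace.basisFun (Fin d) ℝ)]
  refine Finset.sum_congr rfl fun i _ => ?_
  rw [iteratedFDeriv_two_apply, fderiv_clm_apply]
  · simp
  · exact ((h.fderiv_right (m := 1) (by norm_num)).differentiable (by norm_num)).differentiableAt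
  · exact differentiableAt_const _

lemma IsTest.laplacian {U : Set (Space d)} {φ : Space d → ℝ} (h : IsTest U φ) :
    IsTest U (Laplacian.laplacian φ) := by
  have : Laplacian.laplacian φ = ∑ i, fun x => fderiv ℝ (fun y => fderiv ℝ φ y (EuclideanSpace.basisFun (Fin d) ℝ i)) x
      (EuclideanSpace.basisFun (Fin d) ℝ i) := by
    funext x
    rw [laplacian_eq_sum_fderiv (contDiff_infty.1 h.1 2), Finset.sum_apply]
  rw [this]
  refine Finset.sum_induction _ (IsTest U) (fun _ _ => IsTest.add) IsTest.zero fun i _ => ?_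
  exact (h.fderiv_apply _).fderiv_apply _

end Laplacian

/-! ### Weak derivatives: linearity and uniqueness -/

section WeakDeriv

variable {T : ℝ} {w w' g g' : ℝ → ℝ}

lemma HasWeakDeriv.congr (h : HasWeakDeriv T w g) (hw : w =ᵐ[volume.restrict (Ioo 0 T)] w')
    (hg : g =ᵐ[volume.restrict (Ioo 0 T)] g') : HasWeakDeriv T w' g' := by
  intro φ hφ
  rw [integral_congr_ae (g := fun t => w t * deriv φ t), h φ hφ,
    integral_congr_ae (g := fun t => g' t * φ t)]
  · filter_upwards [hg] with t ht using by rw [ht]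
  · filter_upwards [hw] with t ht using by rw [ht]

lemma HasWeakDeriv.add (h : HasWeakDeriv T w g) (h' : HasWeakDeriv T w' g')
    (hw : MemLp w 2 (volume.restrict (Ioo 0 T))) (hw' : MemLp w' 2 (volume.restrict (Ioo 0 T)))
    (hg : MemLp g 2 (volume.restrict (Ioo 0 T))) (hg' : MemLp g' 2 (volume.restrict (Ioo 0 T))) :
    HasWeakDeriv T (fun t => w t + w' t) (fun t => g t + g' t) := by
  intro φ hφ
  simp only [add_mul]
  rw [integral_add (integrable_mul_of_memLp_two hw (hφ.deriv.memLp 2)) (integrable_mul_of_memLp_two hw' (hφ.deriv.memLp 2)),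
    integral_add (integrable_mul_of_memLp_two hg (hφ.memLp 2)) (integrable_mul_of_memLp_two hg' (hφ.memLp 2)),
    h φ hφ, h' φ hφ]
  ring

lemma HasWeakDeriv.const_mul (c : ℝ) (h : HasWeakDeriv T w g) :
    HasWeakDeriv T (fun t => c * w t) (fun t => c * g t) := by
  intro φ hφ
  simp only [mul_assoc]
  rw [integral_const_mul, integral_const_mul, h φ hφ]
  ring

/-- The fundamental lemma on an open set, for functions that are square integrable there. -/
lemma ae_eq_of_forall_isTest {X : Type*} [NormedAddCommGroup X] [NormedSpace ℝ X]
    [FiniteDimensional ℝ X] [MeasurableSpace X] [BorelSpace X] {μ : Measure X}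
    [IsFiniteMeasureOnCompacts μ] {U : Set X} (hU : IsOpen U) {f f' : X → ℝ}
    (hf : LocallyIntegrableOn f U μ) (hf' : LocallyIntegrableOn f' U μ)
    (h : ∀ φ, IsTest U φ → ∫ x in U, f x * φ x ∂μ = ∫ x in U, f' x * φ x ∂μ) :
    f =ᵐ[μ.restrict U] f' := by
  have key := hU.ae_eq_zero_of_integral_contDiff_smul_eq_zero (hf.sub hf') ?_
  · filter_upwards [ae_restrict_of_ae key, ae_restrict_mem hU.measurableSet] with x hx hxU
    simpa [sub_eq_zero] using hx hxU
  intro φ h1 h2 h3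
  have hφ : IsTest U φ := ⟨h1, h2, h3⟩
  have hz : ∀ x ∉ U, φ x • (f - f') x = 0 := fun x hx => by
    rw [image_eq_zero_of_notMem_tsupport (fun hx' => hx (h3 hx')), zero_smul]
  rw [← setIntegral_eq_integral_of_forall_compl_eq_zero hz]
  have i1 : ∀ {u : X → ℝ}, LocallyIntegrableOn u U μ → IntegrableOn (fun x => u x * φ x) U μ := by
    intro u hu
    have : IntegrableOn (fun x => u x * φ x) (tsupport φ) μ :=
      (hu.integrableOn_compact_subset h3 h2).mul_continuousOn hφ.continuous.continuousOn h2
    exact (this.integrable_of_forall_notMem_eq_zero fun x hx => by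
      rw [image_eq_zero_of_notMem_tsupport hx, mul_zero]).integrableOn
  have : ∀ x, φ x • (f - f') x = f x * φ x - f' x * φ x := fun x => by
    simp only [Pi.sub_apply, smul_eq_mul]; ring
  simp only [this]
  rw [integral_sub (i1 hf) (i1 hf'), h φ hφ, sub_self]

lemma locallyIntegrableOn_of_memLp_two {X : Type*} [TopologicalSpace X] [MeasurableSpace X]
    [LocallyCompactSpace X] [OpensMeasurableSpace X] {μ : Measure X}
    [IsFiniteMeasureOnCompacts μ] {U : Set X} {f : X → ℝ} (hf : MemLp f 2 (μ.restrict U)) :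
    LocallyIntegrableOn f U μ := by
  exact locallyIntegrableOn_of_locallyIntegrable_restrict (hf.locallyIntegrable (by norm_num))

lemma HasWeakDeriv.unique (h : HasWeakDeriv T w g) (h' : HasWeakDeriv T w g')
    (hg : MemLp g 2 (volume.restrict (Ioo 0 T))) (hg' : MemLp g' 2 (volume.restrict (Ioo 0 T))) :
    g =ᵐ[volume.restrict (Ioo 0 T)] g' := by
  refine ae_eq_of_forall_isTest isOpen_Ioo (locallyIntegrableOn_of_memLp_two hg)
    (locallyIntegrableOn_of_memLp_two hg') fun φ hφ => ?_
  linarith [h φ hφ, h' φ hφ]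

variable {d : ℕ} {Ω : Set (Space d)} {u u' z z' : Space d → ℝ}

lemma HasWeakLaplacian.congr (h : HasWeakLaplacian Ω u z) (hu : u =ᵐ[volume.restrict Ω] u')
    (hz : z =ᵐ[volume.restrict Ω] z') : HasWeakLaplacian Ω u' z' := by
  intro φ hφ
  rw [integral_congr_ae (g := fun t => u t * Laplacian.laplacian φ t), h φ hφ,
    integral_congr_ae (g := fun t => z' t * φ t)]
  · filter_upwards [hz] with t ht using by rw [ht]
  · filter_upwards [hu] with t ht using by rw [ht]

lemma HasWeakLaplacian.add (h : HasWeakLaplacian Ω u z) (h' : HasWeakLaplacian Ω u' z')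
    (hu : MemLp u 2 (volume.restrict Ω)) (hu' : MemLp u' 2 (volume.restrict Ω))
    (hz : MemLp z 2 (volume.restrict Ω)) (hz' : MemLp z' 2 (volume.restrict Ω)) :
    HasWeakLaplacian Ω (fun x => u x + u' x) (fun x => z x + z' x) := by
  intro φ hφ
  simp only [add_mul]
  rw [integral_add (integrable_mul_of_memLp_two hu (hφ.laplacian.memLp 2))
      (integrable_mul_of_memLp_two hu' (hφ.laplacian.memLp 2)),
    integral_add (integrable_mul_of_memLp_two hz (hφ.memLp 2)) (integrable_mul_of_memLp_two hz' (hφ.memLp 2)),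
    h φ hφ, h' φ hφ]

lemma HasWeakLaplacian.const_mul (c : ℝ) (h : HasWeakLaplacian Ω u z) :
    HasWeakLaplacian Ω (fun x => c * u x) (fun x => c * z x) := by
  intro φ hφ
  simp only [mul_assoc]
  rw [integral_const_mul, integral_const_mul, h φ hφ]

lemma HasWeakLaplacian.unique (hΩ : IsOpen Ω) (h : HasWeakLaplacian Ω u z)
    (h' : HasWeakLaplacian Ω u z') (hz : MemLp z 2 (volume.restrict Ω))
    (hz' : MemLp z' 2 (volume.restrict Ω)) : z =ᵐ[volume.restrict Ω] z' := by
  refine ae_eq_of_forall_isTest hΩ (locallyIntegrableOn_of_memLp_two hz)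
    (locallyIntegrableOn_of_memLp_two hz') fun φ hφ => ?_
  linarith [h φ hφ, h' φ hφ]

/-! ### The space `H_0^1` -/

lemma MemH01.congr (h : MemH01 Ω u) (hu : u =ᵐ[volume.restrict Ω] u') : MemH01 Ω u' := by
  obtain ⟨h1, g, φ, h2, h3, h4, h5⟩ := h
  refine ⟨h1.ae_eq hu, g, φ, h2, h3, ?_, h5⟩
  refine h4.congr fun n => eLpNorm_congr_ae ?_
  filter_upwards [hu] with x hx
  simp [hx]

lemma gradient_add' {φ ψ : Space d → ℝ} (hφ : Differentiable ℝ φ) (hψ : Differentiable ℝ ψ) :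
    gradient (φ + ψ) = gradient φ + gradient ψ := by
  funext x
  simp [gradient, fderiv_add (hφ x) (hψ x)]

lemma gradient_smul' {φ : Space d → ℝ} (c : ℝ) (hφ : Differentiable ℝ φ) :
    gradient (c • φ) = c • gradient φ := by
  funext x
  simp [gradient, fderiv_const_smul (hφ x)]

lemma IsTest.differentiable {X : Type*} [NormedAddCommGroup X] [NormedSpace ℝ X] {U : Set X}
    {φ : X → ℝ} (h : IsTest U φ) : Differentiable ℝ φ :=
  h.1.differentiable (by simp)

lemma IsTest.continuous_gradient {φ : Space d → ℝ} (h : IsTest Ω φ) :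
    Continuous (gradient φ) :=
  (InnerProductSpace.toDual ℝ (Space d)).symm.continuous.comp
    (h.1.continuous_fderiv (by simp))

lemma IsTest.hasCompactSupport_gradient {φ : Space d → ℝ} (h : IsTest Ω φ) :
    HasCompactSupport (gradient φ) :=
  (h.2.1.fderiv ℝ).comp_left (map_zero (InnerProductSpace.toDual ℝ (Space d)).symm)

lemma IsTest.memLp_gradient {φ : Space d → ℝ} (h : IsTest Ω φ) {μ : Measure (Space d)}
    [IsFiniteMeasureOnCompacts μ] (p : ℝ≥0∞) : MemLp (gradient φ) p μ :=
  h.continuous_gradient.memLp_of_hasCompactSupport h.hasCompactSupport_gradient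

lemma MemH01.add (h : MemH01 Ω u) (h' : MemH01 Ω u') : MemH01 Ω (fun x => u x + u' x) := by
  obtain ⟨h1, g, φ, h2, h3, h4, h5⟩ := h
  obtain ⟨k1, k, ψ, k2, k3, k4, k5⟩ := h'
  refine ⟨h1.add k1, g + k, fun n => φ n + ψ n, h2.add k2, fun n => (h3 n).add (k3 n), ?_, ?_⟩
  · refine tendsto_of_tendsto_of_tendsto_of_le_of_le tendsto_const_nhds
      (by simpa using h4.add k4) (fun _ => zero_le) fun n => ?_
    have : (fun x => u x + u' x) - (φ n + ψ n) = (u - φ n) + (u' - ψ n) := by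
      funext x; simp; ring
    rw [this]
    exact eLpNorm_add_le (h1.1.sub ((h3 n).memLp 2).1) (k1.1.sub ((k3 n).memLp 2).1) (by norm_num)
  · refine tendsto_of_tendsto_of_tendsto_of_le_of_le tendsto_const_nhds
      (by simpa using h5.add k5) (fun _ => zero_le) fun n => ?_
    have : g + k - gradient (φ n + ψ n) = (g - gradient (φ n)) + (k - gradient (ψ n)) := by
      rw [gradient_add' (h3 n).differentiable (k3 n).differentiable]; abel
    simp only [this]
    exact eLpNorm_add_le (h2.1.sub ((h3 n).memLp_gradient 2).1)
      (k2.1.sub ((k3 n).memLp_gradient 2).1) (by norm_num)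

lemma MemH01.const_mul (c : ℝ) (h : MemH01 Ω u) : MemH01 Ω (fun x => c * u x) := by
  obtain ⟨h1, g, φ, h2, h3, h4, h5⟩ := h
  refine ⟨h1.const_mul c, c • g, fun n => c • φ n, h2.const_smul c, fun n => (h3 n).smul c, ?_, ?_⟩
  · have : ∀ n, (fun x => c * u x) - c • φ n = c • (u - φ n) := fun n => by
      funext x; simp; ring
    simp only [this, eLpNorm_const_smul]
    simpa using ENNReal.Tendsto.const_mul h4 (Or.inr enorm_ne_top)
  · have : ∀ n, c • g - gradient (c • φ n) = c • (g - gradient (φ n)) := fun n => by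
      rw [gradient_smul' c (h3 n).differentiable, smul_sub]
    simp only [this, eLpNorm_const_smul]
    simpa using ENNReal.Tendsto.const_mul h5 (Or.inr enorm_ne_top)

end WeakDeriv


/-! ### Linear structure of the energy space -/

section Energy

variable {d : ℕ} {Ω : Set (Space d)} {T : ℝ}

lemma cylMeasure_eq_prod (Ω : Set (Space d)) (T : ℝ) :
    cylMeasure Ω T = (volume.restrict Ω).prod (volume.restrict (Ioo 0 T)) := by
  rw [Measure.prod_restrict, ← Measure.volume_eq_prod]

lemma ae_cyl_of_prod {p : Space d × ℝ → Prop}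
    (h : ∀ᵐ q ∂((volume.restrict Ω).prod (volume.restrict (Ioo 0 T))), p q) :
    ∀ᵐ q ∂(cylMeasure Ω T), p q := by
  rwa [cylMeasure_eq_prod]

lemma memLp_prod (v : L2Cyl Ω T) :
    MemLp v 2 ((volume.restrict Ω).prod (volume.restrict (Ioo 0 T))) := by
  rw [← cylMeasure_eq_prod]; exact Lp.memLp v

lemma ae_ae_of_ae_cyl {p : Space d × ℝ → Prop} (h : ∀ᵐ q ∂(cylMeasure Ω T), p q) :
    ∀ᵐ x ∂(volume.restrict Ω), ∀ᵐ t ∂(volume.restrict (Ioo 0 T)), p (x, t) := by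
  rw [cylMeasure_eq_prod] at h; exact Measure.ae_ae_of_ae_prod h

lemma ae_ae_of_ae_cyl' {p : Space d × ℝ → Prop} (h : ∀ᵐ q ∂(cylMeasure Ω T), p q) :
    ∀ᵐ t ∂(volume.restrict (Ioo 0 T)), ∀ᵐ x ∂(volume.restrict Ω), p (x, t) := by
  rw [cylMeasure_eq_prod] at h; exact ae_ae_of_ae_prod' h

lemma ae_memLp_space (v : L2Cyl Ω T) :
    ∀ᵐ t ∂(volume.restrict (Ioo 0 T)), MemLp (fun x => v (x, t)) 2 (volume.restrict Ω) :=
  ae_memLp_two_slice' (memLp_prod v)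

lemma ae_memLp_time (v : L2Cyl Ω T) :
    ∀ᵐ x ∂(volume.restrict Ω), MemLp (fun t => v (x, t)) 2 (volume.restrict (Ioo 0 T)) :=
  ae_memLp_two_slice (memLp_prod v)

lemma HasTimeDeriv.add {v v' g g' : L2Cyl Ω T} (h : HasTimeDeriv v g) (h' : HasTimeDeriv v' g') :
    HasTimeDeriv (v + v') (g + g') := by
  filter_upwards [h, h', (ae_memLp_time v), (ae_memLp_time v'), (ae_memLp_time g), (ae_memLp_time g'),
    ae_ae_of_ae_cyl (Lp.coeFn_add v v'), ae_ae_of_ae_cyl (Lp.coeFn_add g g')]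
    with x h h' a b c e hv hg
  exact (h.add h' a b c e).congr (hv.mono fun t ht => ht.symm) (hg.mono fun t ht => ht.symm)

lemma HasTimeDeriv.smul {v g : L2Cyl Ω T} (c : ℝ) (h : HasTimeDeriv v g) :
    HasTimeDeriv (c • v) (c • g) := by
  filter_upwards [h, ae_ae_of_ae_cyl (Lp.coeFn_smul c v), ae_ae_of_ae_cyl (Lp.coeFn_smul c g)]
    with x h hv hg
  exact (h.const_mul c).congr (hv.mono fun t ht => ht.symm) (hg.mono fun t ht => ht.symm)

lemma HasTimeDeriv.unique {v g g' : L2Cyl Ω T} (h : HasTimeDeriv v g) (h' : HasTimeDeriv v g') :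
    g = g' := by
  refine Lp.ext ?_
  refine ae_cyl_of_prod ?_
  refine ae_prod_eq_of_ae_ae_eq (memLp_prod g).1 (memLp_prod g').1 ?_
  filter_upwards [h, h', (ae_memLp_time g), (ae_memLp_time g')] with x h h' a b
  exact h.unique h' a b

/-- `dt` is an arbitrary choice among weak derivatives; uniqueness makes it computable from any one
of them, and hence linear. -/
lemma HasTimeDeriv.dt_eq {v g : L2Cyl Ω T} (h : HasTimeDeriv v g) : dt v = g := by
  have hex : ∃ g, HasTimeDeriv v g := ⟨g, h⟩
  rw [dt, dif_pos hex]
  exact hex.choose_spec.unique h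

lemma HasLaplacian.add {v v' z z' : L2Cyl Ω T} (h : HasLaplacian v z) (h' : HasLaplacian v' z') :
    HasLaplacian (v + v') (z + z') := by
  filter_upwards [h, h', (ae_memLp_space v), (ae_memLp_space v'), (ae_memLp_space z), (ae_memLp_space z'),
    ae_ae_of_ae_cyl' (Lp.coeFn_add v v'), ae_ae_of_ae_cyl' (Lp.coeFn_add z z')]
    with x h h' a b c e hv hz
  exact ⟨(h.1.add h'.1).congr (hv.mono fun t ht => ht.symm),
    (h.2.add h'.2 a b c e).congr (hv.mono fun t ht => ht.symm) (hz.mono fun t ht => ht.symm)⟩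

lemma HasLaplacian.smul {v z : L2Cyl Ω T} (c : ℝ) (h : HasLaplacian v z) :
    HasLaplacian (c • v) (c • z) := by
  filter_upwards [h, ae_ae_of_ae_cyl' (Lp.coeFn_smul c v), ae_ae_of_ae_cyl' (Lp.coeFn_smul c z)]
    with x h hv hz
  exact ⟨(h.1.const_mul c).congr (hv.mono fun t ht => ht.symm),
    (h.2.const_mul c).congr (hv.mono fun t ht => ht.symm) (hz.mono fun t ht => ht.symm)⟩

lemma HasLaplacian.unique (hΩ : IsOpen Ω) {v z z' : L2Cyl Ω T} (h : HasLaplacian v z)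
    (h' : HasLaplacian v z') : z = z' := by
  refine Lp.ext ?_
  refine ae_cyl_of_prod ?_
  refine ae_prod_eq_of_ae_ae_eq' (memLp_prod z).1 (memLp_prod z').1 ?_
  filter_upwards [h, h', (ae_memLp_space z), (ae_memLp_space z')] with x h h' a b
  exact h.2.unique hΩ h'.2 a b

/-- As for `dt`; openness of `Ω` enters through the fundamental lemma, which gives uniqueness of the
weak Laplacian. -/
lemma HasLaplacian.lap_eq (hΩ : IsOpen Ω) {v z : L2Cyl Ω T} (h : HasLaplacian v z) :
    lap v = z := by
  have hex : ∃ z, HasLaplacian v z := ⟨z, h⟩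
  rw [lap, dif_pos hex]
  exact hex.choose_spec.unique hΩ h

lemma ZeroInitialTrace.add {v v' : L2Cyl Ω T} (h : ZeroInitialTrace v)
    (h' : ZeroInitialTrace v') : ZeroInitialTrace (v + v') := by
  filter_upwards [h, h', ae_ae_of_ae_cyl (Lp.coeFn_add v v')] with x h h' hv
  obtain ⟨c, hc, hc0, hcv⟩ := h
  obtain ⟨c', hc', hc0', hcv'⟩ := h'
  refine ⟨c + c', hc.add hc', by simp [hc0, hc0'], ?_⟩
  filter_upwards [hv, hcv, hcv'] with t h1 h2 h3
  rw [h1, Pi.add_apply, Pi.add_apply, h2, h3]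

lemma ZeroInitialTrace.smul {v : L2Cyl Ω T} (a : ℝ) (h : ZeroInitialTrace v) :
    ZeroInitialTrace (a • v) := by
  filter_upwards [h, ae_ae_of_ae_cyl (Lp.coeFn_smul a v)] with x h hv
  obtain ⟨c, hc, hc0, hcv⟩ := h
  refine ⟨a • c, hc.const_smul a, by simp [hc0], ?_⟩
  filter_upwards [hv, hcv] with t h1 h2
  rw [h1, Pi.smul_apply, Pi.smul_apply, h2]

lemma memH01_zero : MemH01 Ω (fun _ => (0 : ℝ)) := by
  refine ⟨MemLp.zero, 0, fun _ => 0, MemLp.zero, fun _ => IsTest.zero, ?_, ?_⟩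
  · have : ((fun _ => (0 : ℝ)) : Space d → ℝ) - 0 = 0 := by ext; simp
    simp [this]
  · have : gradient (0 : Space d → ℝ) = 0 := by
      funext x; simp [gradient]
    simp [this]

lemma hasTimeDeriv_zero : HasTimeDeriv (0 : L2Cyl Ω T) 0 := by
  filter_upwards [ae_ae_of_ae_cyl (Lp.coeFn_zero ℝ 2 (cylMeasure Ω T))] with x hx
  have : HasWeakDeriv T (fun _ => 0) (fun _ => 0) := fun φ _ => by simp
  exact this.congr (hx.mono fun t ht => ht.symm) (hx.mono fun t ht => ht.symm)

lemma hasLaplacian_zero : HasLaplacian (0 : L2Cyl Ω T) 0 := by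
  filter_upwards [ae_ae_of_ae_cyl' (Lp.coeFn_zero ℝ 2 (cylMeasure Ω T))] with x hx
  have : HasWeakLaplacian Ω (fun _ => 0) (fun _ => 0) := fun φ _ => by simp
  exact ⟨memH01_zero.congr (hx.mono fun t ht => ht.symm),
    this.congr (hx.mono fun t ht => ht.symm) (hx.mono fun t ht => ht.symm)⟩

lemma zeroInitialTrace_zero : ZeroInitialTrace (0 : L2Cyl Ω T) := by
  filter_upwards [ae_ae_of_ae_cyl (Lp.coeFn_zero ℝ 2 (cylMeasure Ω T))] with x hx
  exact ⟨fun _ => 0, continuousOn_const, rfl, hx⟩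

variable (Ω T) in
/-- The energy space as a subspace of `L²(Ω × (0,T))`. -/
def energySpace : Submodule ℝ (L2Cyl Ω T) where
  carrier := V0 Ω T
  add_mem' := by
    rintro v v' ⟨⟨z, hz⟩, ⟨g, hg⟩, h⟩ ⟨⟨z', hz'⟩, ⟨g', hg'⟩, h'⟩
    exact ⟨⟨_, hz.add hz'⟩, ⟨_, hg.add hg'⟩, h.add h'⟩
  zero_mem' := ⟨⟨0, hasLaplacian_zero⟩, ⟨0, hasTimeDeriv_zero⟩, zeroInitialTrace_zero⟩
  smul_mem' := by
    rintro c v ⟨⟨z, hz⟩, ⟨g, hg⟩, h⟩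
    exact ⟨⟨_, hz.smul c⟩, ⟨_, hg.smul c⟩, h.smul c⟩

lemma hasTimeDeriv_dt {v : L2Cyl Ω T} (hv : v ∈ energySpace Ω T) : HasTimeDeriv v (dt v) := by
  obtain ⟨-, ⟨g, hg⟩, -⟩ := hv
  rwa [hg.dt_eq]

lemma hasLaplacian_lap (hΩ : IsOpen Ω) {v : L2Cyl Ω T} (hv : v ∈ energySpace Ω T) :
    HasLaplacian v (lap v) := by
  obtain ⟨⟨z, hz⟩, -, -⟩ := hv
  rwa [hz.lap_eq hΩ]

variable (T) in
/-- The time derivative on the energy space. -/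
def dtLinear (Ω : Set (Space d)) : energySpace Ω T →ₗ[ℝ] L2Cyl Ω T where
  toFun v := dt (v : L2Cyl Ω T)
  map_add' v w := ((hasTimeDeriv_dt v.2).add (hasTimeDeriv_dt w.2)).dt_eq
  map_smul' c v := ((hasTimeDeriv_dt v.2).smul c).dt_eq

variable (T) in
/-- The spatial Laplacian on the energy space. -/
def lapLinear (hΩ : IsOpen Ω) : energySpace Ω T →ₗ[ℝ] L2Cyl Ω T where
  toFun v := lap (v : L2Cyl Ω T)
  map_add' v w := ((hasLaplacian_lap hΩ v.2).add (hasLaplacian_lap hΩ w.2)).lap_eq hΩ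
  map_smul' c v := ((hasLaplacian_lap hΩ v.2).smul c).lap_eq hΩ

/-! ### Green's formula in `H_Δ` -/

lemma sum_fderiv_mul_eq_inner_gradient {φ ψ : Space d → ℝ} (x : Space d) :
    ∑ i, fderiv ℝ φ x (EuclideanSpace.basisFun (Fin d) ℝ i) *
      fderiv ℝ ψ x (EuclideanSpace.basisFun (Fin d) ℝ i)
      = inner ℝ (gradient φ x) (gradient ψ x) := by
  have h : ∀ (χ : Space d → ℝ) (e : Space d), fderiv ℝ χ x e = inner ℝ (gradient χ x) e :=
    fun χ e => by simp [gradient]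
  simp only [h]
  rw [← (EuclideanSpace.basisFun (Fin d) ℝ).sum_inner_mul_inner]
  exact Finset.sum_congr rfl fun i _ => by rw [real_inner_comm (gradient ψ x)]

/-- The support of `φ` lies in `Ω`, so both integrals extend to the whole space, where integration
by parts leaves no boundary term. -/
lemma integral_mul_laplacian_of_isTest {φ ψ : Space d → ℝ} (hφ : IsTest Ω φ) (hψ : IsTest Ω ψ) :
    ∫ x in Ω, φ x * Laplacian.laplacian ψ x
      = - ∫ x in Ω, inner ℝ (gradient φ x) (gradient ψ x) := by
  rw [setIntegral_eq_integral_of_forall_compl_eq_zero fun x hx => by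
      rw [image_eq_zero_of_notMem_tsupport fun h => hx (hφ.2.2 h), zero_mul],
    setIntegral_eq_integral_of_forall_compl_eq_zero fun x hx => by
      have : fderiv ℝ φ x = 0 :=
        image_eq_zero_of_notMem_tsupport fun h => hx (hφ.2.2 (tsupport_fderiv_subset ℝ h))
      simp [gradient, this]]
  have hD : ∀ {χ : Space d → ℝ}, IsTest Ω χ → ∀ e, IsTest Ω fun x => fderiv ℝ χ x e :=
    fun h e => h.fderiv_apply e
  simp only [laplacian_eq_sum_fderiv (contDiff_infty.1 hψ.1 2), Finset.mul_sum,
    ← sum_fderiv_mul_eq_inner_gradient]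
  rw [integral_finsetSum _ fun i _ => integrable_mul_of_memLp_two (hφ.memLp 2)
      ((hD (hD hψ _) _).memLp 2),
    integral_finsetSum _ fun i _ => integrable_mul_of_memLp_two ((hD hφ _).memLp 2)
      ((hD hψ _).memLp 2), ← Finset.sum_neg_distrib]
  refine Finset.sum_congr rfl fun i _ => ?_
  exact integral_mul_fderiv_eq_neg_fderiv_mul_of_integrable
    (integrable_mul_of_memLp_two ((hD hφ _).memLp 2) ((hD hψ _).memLp 2))
    (integrable_mul_of_memLp_two (hφ.memLp 2) ((hD (hD hψ _) _).memLp 2))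
    (integrable_mul_of_memLp_two (hφ.memLp 2) ((hD hψ _).memLp 2))
    (fun x _ => hφ.differentiable x) (fun x _ => (hD hψ _).differentiable x)

/-- Pairings of `L²` functions pass to the limit under `L²` convergence. -/
lemma tendsto_integral_inner_of_tendsto_eLpNorm {α E : Type*} [MeasurableSpace α] {μ : Measure α}
    [NormedAddCommGroup E] [InnerProductSpace ℝ E] {f : α → E} {F : ℕ → α → E} {k : α → E}
    (hf : MemLp f 2 μ) (hF : ∀ n, MemLp (F n) 2 μ) (hk : MemLp k 2 μ)
    (h : Tendsto (fun n => eLpNorm (f - F n) 2 μ) atTop (𝓝 0)) :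
    Tendsto (fun n => ∫ x, inner ℝ (k x) (F n x) ∂μ) atTop (𝓝 (∫ x, inner ℝ (k x) (f x) ∂μ)) := by
  have hconv : Tendsto (fun n => (hF n).toLp (F n)) atTop (𝓝 (hf.toLp f)) := by
    rw [Lp.tendsto_Lp_iff_tendsto_eLpNorm'' _ hF _ hf]
    refine h.congr fun n => ?_
    rw [← eLpNorm_neg, neg_sub]
  have e : ∀ {g : α → E} (hg : MemLp g 2 μ),
      inner ℝ (hk.toLp k) (hg.toLp g) = ∫ x, inner ℝ (k x) (g x) ∂μ := by
    intro g hg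
    rw [L2.inner_def]
    refine integral_congr_ae ?_
    filter_upwards [hk.coeFn_toLp, hg.coeFn_toLp] with x h1 h2
    rw [h1, h2]
  simp only [← e hf, ← e (hF _)]
  exact (continuous_const.inner continuous_id).continuousAt.tendsto.comp hconv

/-- The weak Laplacian on `H_Δ(Ω)` is, up to sign, the Gram form of the weak gradients. -/
lemma exists_gradient_green {ι : Type*} {w z : ι → Space d → ℝ} (hw : ∀ i, MemH01 Ω (w i))
    (hz : ∀ i, MemLp (z i) 2 (volume.restrict Ω)) (h : ∀ i, HasWeakLaplacian Ω (w i) (z i)) :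
    ∃ g : ι → Lp (Space d) 2 (volume.restrict Ω),
      ∀ i j, ∫ x in Ω, z i x * w j x = - inner ℝ (g i) (g j) := by
  -- One gradient per index is fixed before any pair is considered, so that the identities for
  -- different pairs can later be combined into a square.
  choose hw2 g φ hg hφ hφw hφg using hw
  refine ⟨fun i => (hg i).toLp (g i), fun i j => ?_⟩
  have hin : inner ℝ ((hg i).toLp (g i)) ((hg j).toLp (g j))
      = ∫ x in Ω, inner ℝ (g i x) (g j x) := by
    rw [L2.inner_def]
    refine integral_congr_ae ?_
    filter_upwards [(hg i).coeFn_toLp, (hg j).coeFn_toLp] with x h1 h2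
    rw [h1, h2]
  rw [hin]
  have hgφ : ∀ i n, MemLp (gradient (φ i n)) 2 (volume.restrict Ω) :=
    fun i n => (hφ i n).memLp_gradient 2
  -- Green's formula is extended in two limits: first in the approximants of `w i` against a fixed
  -- test function, then in those of `w j`.
  have step : ∀ n, ∫ x in Ω, z i x * φ j n x = - ∫ x in Ω, inner ℝ (g i x) (gradient (φ j n) x) := by
    intro n
    rw [← h i _ (hφ j n)]
    have l1 := tendsto_integral_inner_of_tendsto_eLpNorm (hw2 i)
      (fun m => (hφ i m).memLp 2) ((hφ j n).laplacian.memLp 2) (hφw i)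
    have l2 := tendsto_integral_inner_of_tendsto_eLpNorm (hg i) (hgφ i) (hgφ j n) (hφg i)
    have e : ∀ m, ∫ x in Ω, inner ℝ (Laplacian.laplacian (φ j n) x) (φ i m x)
        = - ∫ x in Ω, inner ℝ (gradient (φ j n) x) (gradient (φ i m) x) := fun m => by
      have := integral_mul_laplacian_of_isTest (hφ i m) (hφ j n)
      simp only [real_inner_comm (gradient (φ i m) _)] at this ⊢
      simpa using this
    simp only [e] at l1
    have := tendsto_nhds_unique l1 l2.neg
    simp only [real_inner_comm (gradient (φ j n) _)]
    simpa using this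
  have l1 := tendsto_integral_inner_of_tendsto_eLpNorm (hw2 j)
    (fun m => (hφ j m).memLp 2) (hz i) (hφw j)
  have l2 := tendsto_integral_inner_of_tendsto_eLpNorm (hg j) (hgφ j) (hg i) (hφg j)
  have e : ∀ m, ∫ x in Ω, inner ℝ (z i x) (φ j m x)
        = - ∫ x in Ω, inner ℝ (g i x) (gradient (φ j m) x) := fun m => by
    rw [← step m]; simp [mul_comm]
  simp only [e] at l1
  have := tendsto_nhds_unique l1 l2.neg
  rw [← this]
  simp [mul_comm]

end Energy


/-! ### Weak derivatives of functions of one variable -/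

section Primitive

variable {T : ℝ}

lemma IsTest.absolutelyContinuousOnInterval {U : Set ℝ} {φ : ℝ → ℝ} (h : IsTest U φ) (a b : ℝ) :
    AbsolutelyContinuousOnInterval φ a b :=
  (contDiff_infty.1 h.1 1).contDiffOn.absolutelyContinuousOnInterval

lemma IsTest.apply_eq_zero {X : Type*} [NormedAddCommGroup X] [NormedSpace ℝ X] {U : Set X}
    {φ : X → ℝ} (h : IsTest U φ) {x : X} (hx : x ∉ U) : φ x = 0 :=
  image_eq_zero_of_notMem_tsupport fun h' => hx (h.2.2 h')

/-- Integration by parts for absolutely continuous functions; the boundary terms vanish because a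
test function is zero at `0` and `T`. -/
lemma hasWeakDeriv_of_absolutelyContinuous (hT : 0 < T) {w g : ℝ → ℝ}
    (hw : AbsolutelyContinuousOnInterval w 0 T)
    (hg : deriv w =ᵐ[volume.restrict (Ioo 0 T)] g) : HasWeakDeriv T w g := by
  intro φ hφ
  have := hw.integral_mul_deriv_eq_deriv_mul (hφ.absolutelyContinuousOnInterval 0 T)
  rw [hφ.apply_eq_zero (x := T) (by simp), hφ.apply_eq_zero (x := 0) (by simp),
    intervalIntegral.integral_of_le hT.le, intervalIntegral.integral_of_le hT.le,
    integral_Ioc_eq_integral_Ioo, integral_Ioc_eq_integral_Ioo] at this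
  rw [this]
  simp only [mul_zero, sub_zero, zero_sub, neg_inj]
  refine integral_congr_ae ?_
  filter_upwards [hg] with t ht
  rw [ht]

/-- The primitive from `-∞` vanishes to the left of the support of `χ`, and to the right of it
because the total integral is zero. -/
lemma exists_isTest_primitive (hT : 0 < T) {χ : ℝ → ℝ} (hχ : IsTest (Ioo 0 T) χ)
    (h0 : ∫ t, χ t = 0) : ∃ φ, IsTest (Ioo 0 T) φ ∧ deriv φ = χ := by
  obtain ⟨a, b, ha, hb, hab⟩ : ∃ a b, 0 < a ∧ b < T ∧ tsupport χ ⊆ Icc a b := by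
    rcases (tsupport χ).eq_empty_or_nonempty with h | h
    -- For empty support any admissible pair works; here `Icc T 0` is itself empty.
    · exact ⟨T, 0, hT, hT, by simp [h]⟩
    · obtain ⟨a, ha, ha'⟩ := hχ.2.1.isCompact.exists_isLeast h
      obtain ⟨b, hb, hb'⟩ := hχ.2.1.isCompact.exists_isGreatest h
      exact ⟨a, b, (hχ.2.2 ha).1, (hχ.2.2 hb).2, fun x hx => ⟨ha' hx, hb' hx⟩⟩
  have hz : ∀ t, t ∉ Icc a b → χ t = 0 := fun t ht =>
    image_eq_zero_of_notMem_tsupport fun h => ht (hab h)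
  have hint : Integrable χ := hχ.continuous.integrable_of_hasCompactSupport hχ.2.1
  set φ : ℝ → ℝ := fun t => ∫ s in Iic t, χ s with hφ
  have hder : ∀ t, HasDerivAt φ (χ t) t := by
    intro t
    have e : φ = fun t => (∫ s in Iic (0 : ℝ), χ s) + ∫ s in (0 : ℝ)..t, χ s := by
      funext t
      rw [← intervalIntegral.integral_Iic_sub_Iic hint.integrableOn hint.integrableOn]
      simp [hφ]
    rw [e]
    exact (intervalIntegral.integral_hasDerivAt_right (hint.intervalIntegrable)
      hχ.continuous.aestronglyMeasurable.stronglyMeasurableAtFilter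
      hχ.continuous.continuousAt).const_add _
  have hd : deriv φ = χ := funext fun t => (hder t).deriv
  have hsupp : ∀ t, t ∉ Icc a b → φ t = 0 := by
    intro t ht
    by_cases hta : t < a
    · exact setIntegral_eq_zero_of_forall_eq_zero fun s hs =>
        hz s fun h => absurd (h.1.trans hs) (not_le.2 hta)
    · have htb : b < t := by
        by_contra hc; exact ht ⟨not_lt.1 hta, not_lt.1 hc⟩
      rw [hφ, ← h0]
      exact setIntegral_eq_integral_of_forall_compl_eq_zero fun s hs =>
        hz s fun h => hs (h.2.trans htb.le)
  have hts : tsupport φ ⊆ Icc a b :=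
    closure_minimal (fun t ht => by_contra fun h => ht (hsupp t h)) isClosed_Icc
  refine ⟨φ, ⟨?_, ?_, hts.trans fun t ht => ⟨ha.trans_le ht.1, ht.2.trans_lt hb⟩⟩, hd⟩
  · rw [contDiff_infty_iff_deriv, hd]
    exact ⟨fun t => (hder t).differentiableAt, hχ.1⟩
  · exact isCompact_Icc.of_isClosed_subset (isClosed_tsupport φ) hts

/-- A continuous function on `[0,T]` with vanishing weak derivative is constant. -/
lemma eqOn_const_of_hasWeakDeriv_zero (hT : 0 < T) {e : ℝ → ℝ} (he : ContinuousOn e (Icc 0 T))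
    (h : HasWeakDeriv T e 0) : ∃ k, EqOn e (fun _ => k) (Icc 0 T) := by
  -- A test function of mass one, supported in the ball of radius `T/4` about the midpoint. The
  -- constant will be the pairing of `e` with `ρ`.
  obtain ⟨ρ, hρ, hρ1⟩ : ∃ ρ, IsTest (Ioo 0 T) ρ ∧ ∫ t, ρ t = 1 := by
    let B : ContDiffBump (T / 2) := ⟨T / 8, T / 4, by positivity, by linarith⟩
    refine ⟨B.normed volume, ⟨B.contDiff_normed, B.hasCompactSupport_normed, ?_⟩, B.integral_normed⟩
    rw [B.tsupport_normed_eq]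
    intro t ht
    rw [Metric.mem_closedBall, Real.dist_eq, abs_le] at ht
    simp only [B] at ht
    constructor <;> linarith [ht.1, ht.2]
  set k := ∫ t in Ioo 0 T, e t * ρ t with hk
  have hei : IntegrableOn e (Ioo 0 T) :=
    (he.integrableOn_Icc (μ := volume)).mono_set Ioo_subset_Icc_self
  have hmul : ∀ {ψ}, IsTest (Ioo 0 T) ψ → IntegrableOn (fun t => e t * ψ t) (Ioo 0 T) :=
    fun hψ => ((he.mul hψ.continuous.continuousOn).integrableOn_Icc (μ := volume)).mono_set
      Ioo_subset_Icc_self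
  have hint : ∀ {ψ}, IsTest (Ioo 0 T) ψ → Integrable ψ := fun hψ =>
    hψ.continuous.integrable_of_hasCompactSupport hψ.2.1
  have key : e =ᵐ[volume.restrict (Ioo 0 T)] fun _ => k := by
    refine ae_eq_of_forall_isTest isOpen_Ioo (hei.locallyIntegrableOn)
      (integrableOn_const (by simp)).locallyIntegrableOn fun ψ hψ => ?_
    set c := ∫ t, ψ t with hc
    -- Subtracting `c ρ` removes the mean of `ψ`, so the difference is the derivative of a test
    -- function and pairs to zero with `e`.
    have hχ : IsTest (Ioo 0 T) (ψ + (-c) • ρ) := hψ.add (hρ.smul _)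
    obtain ⟨φ, hφ, hd⟩ := exists_isTest_primitive hT hχ (by
      simp only [Pi.add_apply, Pi.smul_apply, smul_eq_mul]
      rw [integral_add (hint hψ) ((hint hρ).const_mul _), integral_const_mul, hρ1]; ring)
    have h2 := h φ hφ
    rw [hd] at h2
    have e1 : ∀ t, e t * (ψ + (-c) • ρ) t = e t * ψ t + (-c) * (e t * ρ t) := fun t => by
      simp; ring
    simp only [e1] at h2
    rw [integral_add (hmul hψ) ((hmul hρ).const_mul _), integral_const_mul, ← hk] at h2
    rw [integral_const_mul, setIntegral_eq_integral_of_forall_compl_eq_zero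
      (fun t ht => hψ.apply_eq_zero ht), ← hc]
    simp at h2
    linarith
  exact ⟨k, Measure.eqOn_Icc_of_ae_eq volume hT.ne
    (by rwa [← Measure.restrict_congr_set Ioo_ae_eq_Icc]) he continuousOn_const⟩

/-- The difference between `c` and the primitive of `g` is continuous with zero weak derivative,
hence constant, and both vanish at `0`. -/
lemma HasWeakDeriv.eq_primitive (hT : 0 < T) {c g : ℝ → ℝ} (h : HasWeakDeriv T c g)
    (hc : ContinuousOn c (Icc 0 T)) (h0 : c 0 = 0) (hg : IntegrableOn g (Ioo 0 T)) :
    ∀ t ∈ Icc 0 T, c t = ∫ s in (0 : ℝ)..t, g s := by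
  have hgi : IntervalIntegrable g volume 0 T := by
    rwa [intervalIntegrable_iff_integrableOn_Ioo_of_le hT.le]
  have hac := hgi.absolutelyContinuousOnInterval_intervalIntegral (c := 0) left_mem_uIcc
  have hW : HasWeakDeriv T (fun t => ∫ s in (0 : ℝ)..t, g s) g := by
    refine hasWeakDeriv_of_absolutelyContinuous hT hac ?_
    filter_upwards [ae_restrict_of_ae hgi.ae_hasDerivAt_integral,
      ae_restrict_mem measurableSet_Ioo] with t ht htm
    refine (ht ?_ 0 left_mem_uIcc).deriv
    rw [uIcc_of_le hT.le]; exact Ioo_subset_Icc_self htm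
  have hWc : ContinuousOn (fun t => ∫ s in (0 : ℝ)..t, g s) (Icc 0 T) := by
    have := hac.continuousOn
    rwa [uIcc_of_le hT.le] at this
  obtain ⟨k, hk⟩ := eqOn_const_of_hasWeakDeriv_zero hT (hc.sub hWc) (by
    intro φ hφ
    have hi : ∀ {w : ℝ → ℝ}, ContinuousOn w (Icc 0 T) →
        IntegrableOn (fun t => w t * deriv φ t) (Ioo 0 T) := fun hw =>
      ((hw.mul hφ.deriv.continuous.continuousOn).integrableOn_Icc (μ := volume)).mono_set
        Ioo_subset_Icc_self
    simp only [Pi.sub_apply, sub_mul]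
    rw [integral_sub (hi hc) (hi hWc), h φ hφ, hW φ hφ]
    simp)
  have hk0 : k = 0 := by
    have := hk (left_mem_Icc.2 hT.le)
    simpa [h0] using this.symm
  intro t ht
  have := hk ht
  simp only [Pi.sub_apply, hk0] at this
  linarith

end Primitive


/-! ### The energy inequality -/

section EnergyInequality

variable {d : ℕ} {Ω : Set (Space d)} {T : ℝ}

/-- Translations act continuously on `L²` pairings. -/
lemma continuous_integral_translate {E : Type*} [NormedAddCommGroup E] [MeasurableSpace E]
    [BorelSpace E] [SecondCountableTopology E] [LocallyCompactSpace E] {μ : Measure E}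
    [μ.IsAddHaarMeasure] {G Z : E → ℝ} (hG : MemLp G 2 μ) (hZ : MemLp Z 2 μ) (e : E)
    [NormedSpace ℝ E] :
    Continuous fun σ : ℝ => ∫ p, G (p - σ • e) * Z p ∂μ := by
  have hmp : ∀ σ : ℝ, MeasurePreserving (fun p : E => p - σ • e) μ μ :=
    fun σ => measurePreserving_sub_right μ _
  let S : C(ℝ, C(E, E)) :=
    ContinuousMap.curry ⟨fun a : ℝ × E => a.2 - a.1 • e, by fun_prop⟩
  have hS : Continuous fun σ : ℝ => Lp.compMeasurePreserving (S σ) (hmp σ) (hG.toLp G) :=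
    Continuous.compMeasurePreservingLp (f := fun _ : ℝ => hG.toLp G) continuous_const S.continuous
      hmp (by norm_num)
  have e1 : ∀ σ : ℝ, ∫ p, G (p - σ • e) * Z p ∂μ
      = inner ℝ (hZ.toLp Z) (Lp.compMeasurePreserving (S σ) (hmp σ) (hG.toLp G)) := by
    intro σ
    rw [L2.inner_def]
    refine integral_congr_ae ?_
    filter_upwards [hZ.coeFn_toLp, Lp.coeFn_compMeasurePreserving (hG.toLp G) (hmp σ),
      (hmp σ).quasiMeasurePreserving.ae hG.coeFn_toLp] with p h1 h2 h3
    rw [h1]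
    change _ = inner ℝ (Z p) ((Lp.compMeasurePreserving (fun p => p - σ • e) (hmp σ) (hG.toLp G)) p)
    rw [h2, Function.comp_apply, h3]
    simp
  simp only [e1]
  exact continuous_const.inner hS

/-- A negative value at `0` would persist on a short interval and make the integral there negative.
This replaces the limit of the averages as `s` tends to zero. -/
lemma nonneg_of_forall_intervalIntegral_nonneg {q : ℝ → ℝ} (hq : Continuous q)
    (h : ∀ s, 0 < s → 0 ≤ ∫ σ in (0 : ℝ)..s, q σ) : 0 ≤ q 0 := by
  by_contra hneg
  rw [not_le] at hneg
  obtain ⟨δ, hδ, hball⟩ := Metric.eventually_nhds_iff_ball.1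
    (hq.continuousAt.eventually (gt_mem_nhds hneg))
  have hpos : 0 < ∫ σ in (0 : ℝ)..(δ / 2), -q σ :=
    intervalIntegral.intervalIntegral_pos_of_pos_on (hq.neg.intervalIntegrable _ _)
      (fun x hx => neg_pos.2 (hball x (by
        rw [Metric.mem_ball, Real.dist_eq, sub_zero, abs_of_pos hx.1]; linarith [hx.2])))
      (by linarith)
  rw [intervalIntegral.integral_neg] at hpos
  linarith [h (δ / 2) (by linarith)]

/-- Fubini for the average of the translates of an `L²` function against an `L²` function. -/
lemma integral_translate_swap {E : Type*} [NormedAddCommGroup E] [MeasurableSpace E]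
    [BorelSpace E] [SecondCountableTopology E] [LocallyCompactSpace E] {μ : Measure E}
    [μ.IsAddHaarMeasure] {G Z : E → ℝ} (hG : MemLp G 2 μ) (hZ : MemLp Z 2 μ)
    (hGm : Measurable G) (hZm : Measurable Z) (e : E) [NormedSpace ℝ E] {s : ℝ} (hs : 0 < s) :
    Integrable (fun p => (∫ σ in (0 : ℝ)..s, G (p - σ • e)) * Z p) μ ∧
    ∫ σ in (0 : ℝ)..s, ∫ p, G (p - σ • e) * Z p ∂μ
      = ∫ p, (∫ σ in (0 : ℝ)..s, G (p - σ • e)) * Z p ∂μ := by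
  have hmp : ∀ σ : ℝ, MeasurePreserving (fun p : E => p - σ • e) μ μ :=
    fun σ => measurePreserving_sub_right μ _
  have hint : Integrable (Function.uncurry fun (σ : ℝ) (p : E) => G (p - σ • e) * Z p)
      ((volume.restrict (Ioc 0 s)).prod μ) := by
    have hm : Measurable (Function.uncurry fun (σ : ℝ) (p : E) => G (p - σ • e) * Z p) := by
      have h1 : Continuous fun a : ℝ × E => a.2 - a.1 • e := by fun_prop
      exact (hGm.comp h1.measurable).mul (hZm.comp measurable_snd)
    rw [integrable_prod_iff hm.aestronglyMeasurable]
    refine ⟨Eventually.of_forall fun σ =>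
      integrable_mul_of_memLp_two (hG.comp_measurePreserving (hmp σ)) hZ, ?_⟩
    have hc := continuous_integral_translate (μ := μ) hG.norm hZ.norm e
    have : (fun σ : ℝ => ∫ p, ‖Function.uncurry (fun (σ : ℝ) (p : E) => G (p - σ • e) * Z p) (σ, p)‖ ∂μ)
        = fun σ : ℝ => ∫ p, ‖G (p - σ • e)‖ * ‖Z p‖ ∂μ := by
      funext σ; simp [Function.uncurry]
    rw [this]
    exact (hc.integrableOn_Icc).mono_set Ioc_subset_Icc_self
  have e2 : ∀ p, (∫ σ in (0 : ℝ)..s, G (p - σ • e)) * Z p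
      = ∫ σ in Ioc 0 s, G (p - σ • e) * Z p := fun p => by
    rw [intervalIntegral.integral_of_le hs.le, integral_mul_const]
  simp only [e2]
  refine ⟨hint.integral_prod_right, ?_⟩
  rw [intervalIntegral.integral_of_le hs.le]
  exact integral_integral_swap hint

/-- The substitution `r = t - σ` runs over the window from `t - s` to `t`; the part before time `0`
is cut off by the indicator, whence the maximum. -/
lemma integral_indicator_translate {g : ℝ → ℝ} (hg : IntegrableOn g (Ioo 0 T))
    {s t : ℝ} (hs : 0 < s) (ht : t ∈ Ioo 0 T) :
    ∫ σ in (0 : ℝ)..s, (Ioo 0 T).indicator g (t - σ)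
      = (∫ r in (0 : ℝ)..t, g r) - ∫ r in (0 : ℝ)..(max (t - s) 0), g r := by
  rw [intervalIntegral.integral_comp_sub_left (fun r => (Ioo 0 T).indicator g r) t, sub_zero]
  have hi : Integrable ((Ioo 0 T).indicator g) := hg.integrable_indicator measurableSet_Ioo
  have e1 : ∀ r ∈ Icc 0 t, ∫ u in (0 : ℝ)..r, (Ioo 0 T).indicator g u = ∫ u in (0 : ℝ)..r, g u := by
    intro r hr
    rw [intervalIntegral.integral_of_le hr.1, intervalIntegral.integral_of_le hr.1]
    refine setIntegral_congr_fun measurableSet_Ioc fun u hu => ?_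
    exact indicator_of_mem (show u ∈ Ioo 0 T from ⟨hu.1, (hu.2.trans hr.2).trans_lt ht.2⟩) _
  rw [← intervalIntegral.integral_add_adjacent_intervals (b := 0)
    hi.intervalIntegrable hi.intervalIntegrable, e1 t ⟨ht.1.le, le_rfl⟩]
  rcases le_total (t - s) 0 with h | h
  · rw [max_eq_right h, intervalIntegral.integral_same, intervalIntegral.integral_of_le h,
      setIntegral_eq_zero_of_forall_eq_zero]
    · ring
    · intro u hu
      exact indicator_of_notMem (fun h' => absurd h'.1 (not_lt.2 hu.2)) _
  · rw [max_eq_left h, intervalIntegral.integral_symm, e1 (t - s) ⟨h, by linarith⟩]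
    ring

/-- The time derivative of a function of the energy space is controlled: `v` is the primitive of
`∂_t v` in time. -/
lemma ae_eq_primitive_dt (hT : 0 < T) {v : L2Cyl Ω T} (hv : v ∈ energySpace Ω T) :
    ∀ᵐ x ∂(volume.restrict Ω), ∀ᵐ t ∂(volume.restrict (Ioo 0 T)),
      v (x, t) = ∫ r in (0 : ℝ)..t, dt v (x, r) := by
  filter_upwards [hasTimeDeriv_dt hv, hv.2.2, ae_memLp_time (dt v)] with x h1 ⟨c, hc, hc0, hvc⟩ h3
  have hp := (h1.congr hvc ae_eq_rfl).eq_primitive hT hc hc0 (h3.integrable (by norm_num))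
  filter_upwards [hvc, ae_restrict_mem measurableSet_Ioo] with t ht htm
  rw [ht, hp t (Ioo_subset_Icc_self htm)]

/-- The truncation by zero of a function on the cylinder. -/
def extendZero (v : L2Cyl Ω T) : Space d × ℝ → ℝ := (Ω ×ˢ Ioo 0 T).indicator v

lemma measurable_extendZero (hΩ : IsOpen Ω) (v : L2Cyl Ω T) : Measurable (extendZero v) :=
  (Lp.stronglyMeasurable v).measurable.indicator (hΩ.measurableSet.prod measurableSet_Ioo)

lemma memLp_extendZero (hΩ : IsOpen Ω) (v : L2Cyl Ω T) : MemLp (extendZero v) 2 volume :=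
  (memLp_indicator_iff_restrict (hΩ.measurableSet.prod measurableSet_Ioo)).2 (Lp.memLp v)

lemma extendZero_apply (v : L2Cyl Ω T) {x : Space d} (hx : x ∈ Ω) (t : ℝ) :
    extendZero v (x, t) = (Ioo 0 T).indicator (fun t => v (x, t)) t := by
  simp [extendZero, indicator, hx]

/-- Since `v` is the time primitive of `∂_t v` from `0`, integrating translates of `∂_t v` gives a
backward difference of `v`, extended by zero to negative times. The primitive is known for almost
every `x` and then almost every `t`; the passage through the product measure exchanges this order.
-/
lemma ae_average_dt_eq (hΩ : IsOpen Ω) (hT : 0 < T) {v : L2Cyl Ω T} (hv : v ∈ energySpace Ω T)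
    {s : ℝ} (hs : 0 < s) :
    ∀ᵐ t ∂(volume.restrict (Ioo 0 T)), ∀ᵐ x ∂(volume.restrict Ω),
      ∫ σ in (0 : ℝ)..s, extendZero (dt v) ((x, t) - σ • ((0 : Space d), (1 : ℝ)))
        = v (x, t) - (Ioo 0 T).indicator (fun t => v (x, t)) (t - s) := by
  have hshift : Measurable fun p : Space d × ℝ => (p.1, p.2 - s) := by fun_prop
  have hcongr : ∀ᵐ q ∂((volume.restrict Ω).prod (volume.restrict (Ioo 0 T))),
      ∫ σ in (0 : ℝ)..s, extendZero (dt v) (q - σ • ((0 : Space d), (1 : ℝ)))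
        = extendZero v q - extendZero v (q.1, q.2 - s) := by
    refine ae_prod_eq_of_ae_ae_eq
      (f := fun q => ∫ σ in (0 : ℝ)..s, extendZero (dt v) (q - σ • ((0 : Space d), (1 : ℝ))))
      (g := fun q => extendZero v q - extendZero v (q.1, q.2 - s)) ?_ ?_ ?_
    · have hm : StronglyMeasurable fun a : (Space d × ℝ) × ℝ =>
          extendZero (dt v) (a.1 - a.2 • ((0 : Space d), (1 : ℝ))) := by
        have hc : Continuous fun a : (Space d × ℝ) × ℝ =>
          a.1 - a.2 • ((0 : Space d), (1 : ℝ)) := by fun_prop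
        exact ((measurable_extendZero hΩ _).comp hc.measurable).stronglyMeasurable
      simp only [intervalIntegral.integral_of_le hs.le]
      exact hm.integral_prod_right.aestronglyMeasurable
    · exact ((measurable_extendZero hΩ v).sub
        ((measurable_extendZero hΩ v).comp hshift)).aestronglyMeasurable
    · filter_upwards [ae_eq_primitive_dt hT hv, ae_memLp_time (dt v),
        ae_restrict_mem hΩ.measurableSet] with x hx h2 hxΩ
      have hx' := (ae_restrict_iff' measurableSet_Ioo).1 hx
      have hx'' : ∀ᵐ t : ℝ, t - s ∈ Ioo 0 T →
          v (x, t - s) = ∫ r in (0 : ℝ)..(t - s), dt v (x, r) :=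
        (measurePreserving_sub_right volume s).quasiMeasurePreserving.ae hx'
      filter_upwards [hx, ae_restrict_of_ae hx'', ae_restrict_mem measurableSet_Ioo]
        with t ht hts htm
      have e1 : ∀ σ : ℝ, extendZero (dt v) ((x, t) - σ • ((0 : Space d), (1 : ℝ)))
          = (Ioo 0 T).indicator (fun r => dt v (x, r)) (t - σ) := fun σ => by
        rw [← extendZero_apply _ hxΩ]; simp
      simp only [e1, extendZero_apply _ hxΩ]
      rw [integral_indicator_translate (h2.integrable (by norm_num)) hs htm,
        indicator_of_mem htm, ht]
      congr 1
      rcases le_or_gt (t - s) 0 with h | h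
      · rw [max_eq_right h, indicator_of_notMem (fun h' => absurd h'.1 (not_lt.2 h)),
          intervalIntegral.integral_same]
      · have hmem : t - s ∈ Ioo 0 T := ⟨h, by linarith [htm.2]⟩
        rw [max_eq_left h.le, indicator_of_mem hmem, hts hmem]
  filter_upwards [ae_ae_of_ae_prod' hcongr, ae_restrict_mem measurableSet_Ioo] with t h htm
  filter_upwards [h, ae_restrict_mem hΩ.measurableSet] with x hx hxΩ
  rw [hx, extendZero_apply _ hxΩ, extendZero_apply _ hxΩ, indicator_of_mem htm]

/-- The Dirichlet energy `-⟨Δv(t), v(t)⟩` of the slices, extended by zero. -/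
def sliceEnergy (v z : L2Cyl Ω T) : ℝ → ℝ :=
  (Ioo 0 T).indicator fun t => - ∫ x in Ω, z (x, t) * v (x, t)

lemma integrable_sliceEnergy (v z : L2Cyl Ω T) : Integrable (sliceEnergy v z) := by
  have : IntegrableOn (fun t => - ∫ x in Ω, z (x, t) * v (x, t)) (Ioo 0 T) :=
    (integrable_mul_of_memLp_two (memLp_prod z) (memLp_prod v)).integral_prod_right.neg
  exact this.integrable_indicator measurableSet_Ioo

/-- With gradients `a` at time `t` and `b` at time `t - s`, Green's formula makes the left side
`-⟨a, a - b⟩`, and the bound is `‖a - b‖² ≥ 0` expanded. When `t - s` is outside the time interval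
the same holds with `b = 0`. -/
lemma ae_sliceEnergy_le (v z : L2Cyl Ω T) (hz : HasLaplacian v z) (s : ℝ) :
    ∀ᵐ t ∂(volume.restrict (Ioo 0 T)),
      ∫ x in Ω, z (x, t) * (v (x, t) - (Ioo 0 T).indicator (fun t => v (x, t)) (t - s))
        ≤ (sliceEnergy v z (t - s) - sliceEnergy v z t) / 2 := by
  have hP : ∀ᵐ t ∂(volume.restrict (Ioo 0 T)),
      (MemH01 Ω (fun x => v (x, t)) ∧ HasWeakLaplacian Ω (fun x => v (x, t)) (fun x => z (x, t))) ∧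
      MemLp (fun x => z (x, t)) 2 (volume.restrict Ω) :=
    hz.and (ae_memLp_space z)
  have hP' := (ae_restrict_iff' measurableSet_Ioo).1 hP
  have hPs := (measurePreserving_sub_right volume s).quasiMeasurePreserving.ae hP'
  filter_upwards [hP, ae_restrict_of_ae hPs, ae_restrict_mem measurableSet_Ioo] with t h hs htm
  have e0 : sliceEnergy v z t = - ∫ x in Ω, z (x, t) * v (x, t) := indicator_of_mem htm _
  by_cases hmem : t - s ∈ Ioo 0 T
  · have hs := hs hmem
    have e1 : sliceEnergy v z (t - s) = - ∫ x in Ω, z (x, t - s) * v (x, t - s) :=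
      indicator_of_mem hmem _
    -- The two time slices `t` and `t - s` form a two-member family, so that the mixed pairing uses
    -- the same gradients as the two energies.
    obtain ⟨g, hg⟩ := exists_gradient_green (Ω := Ω) (ι := Bool)
      (w := fun b x => v (x, bif b then t else t - s))
      (z := fun b x => z (x, bif b then t else t - s))
      (by rintro (_ | _); exacts [hs.1.1, h.1.1]) (by rintro (_ | _); exacts [hs.2, h.2])
      (by rintro (_ | _); exacts [hs.1.2, h.1.2])
    have g1 := hg true true
    have g2 := hg false false
    have g3 := hg true false
    simp only [cond_true, cond_false] at g1 g2 g3
    simp only [indicator_of_mem hmem, mul_sub]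
    rw [integral_sub (integrable_mul_of_memLp_two h.2 h.1.1.1)
      (integrable_mul_of_memLp_two h.2 hs.1.1.1), g1, g3, e0, e1, g1, g2]
    have := real_inner_self_nonneg (x := g true - g false)
    rw [inner_sub_sub_self (𝕜 := ℝ)] at this
    simp only [real_inner_comm (g true) (g false)] at this ⊢
    linarith
  · have e1 : sliceEnergy v z (t - s) = 0 := indicator_of_notMem hmem _
    obtain ⟨g, hg⟩ := exists_gradient_green (Ω := Ω) (ι := Unit) (w := fun _ x => v (x, t))
      (z := fun _ x => z (x, t)) (fun _ => h.1.1) (fun _ => h.2) (fun _ => h.1.2)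
    have g1 := hg () ()
    simp only [indicator_of_notMem hmem, sub_zero]
    rw [e1, e0, g1]
    linarith [real_inner_self_nonneg (x := g ())]

lemma ae_sliceEnergy_nonneg (v z : L2Cyl Ω T) (hz : HasLaplacian v z) :
    ∀ᵐ t : ℝ, 0 ≤ sliceEnergy v z t := by
  have hP := (ae_restrict_iff' measurableSet_Ioo).1 (hz.and (ae_memLp_space z))
  filter_upwards [hP] with t ht
  by_cases h : t ∈ Ioo 0 T
  · have h' := ht h
    obtain ⟨g, hg⟩ := exists_gradient_green (Ω := Ω) (ι := Unit) (w := fun _ x => v (x, t))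
      (z := fun _ x => z (x, t)) (fun _ => h'.1.1) (fun _ => h'.2) (fun _ => h'.1.2)
    rw [sliceEnergy, indicator_of_mem h, hg () ()]
    simp
  · rw [sliceEnergy, indicator_of_notMem h]

lemma integral_cyl_symm {F : Space d × ℝ → ℝ} (hF : Integrable F (cylMeasure Ω T)) :
    IntegrableOn (fun t => ∫ x in Ω, F (x, t)) (Ioo 0 T) ∧
      ∫ q, F q ∂(cylMeasure Ω T) = ∫ t in Ioo 0 T, ∫ x in Ω, F (x, t) := by
  rw [cylMeasure_eq_prod] at hF ⊢
  exact ⟨hF.integral_prod_right, integral_prod_symm _ hF⟩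

instance : (volume : Measure (Space d × ℝ)).IsAddHaarMeasure := by
  rw [Measure.volume_eq_prod]; infer_instance

/-- The energy inequality `∫∫ ∂_t v Δv ≤ 0` on the energy space. -/
theorem integral_dt_mul_lap_nonpos (hΩ : IsOpen Ω) (hT : 0 < T) {v : L2Cyl Ω T}
    (hv : v ∈ energySpace Ω T) : ∫ q, dt v q * lap v q ∂(cylMeasure Ω T) ≤ 0 := by
  set e : Space d × ℝ := (0, 1)
  have hS : MeasurableSet (Ω ×ˢ Ioo (0 : ℝ) T) := hΩ.measurableSet.prod measurableSet_Ioo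
  -- The pairing of `∂_t v` delayed by `σ` with `Δv`. Its value at `0` is the integral sought, and
  -- its integrals over `(0,s)` involve only differences of `v`, to which Green's formula applies.
  set q : ℝ → ℝ := fun σ => ∫ p, extendZero (dt v) (p - σ • e) * extendZero (lap v) p with hq
  have hqc : Continuous q :=
    continuous_integral_translate (memLp_extendZero hΩ _) (memLp_extendZero hΩ _) e
  have hq0 : q 0 = ∫ p, dt v p * lap v p ∂(cylMeasure Ω T) := by
    simp only [hq, zero_smul, sub_zero]
    rw [← integral_indicator hS]
    congr 1
    funext p
    by_cases hp : p ∈ Ω ×ˢ Ioo (0 : ℝ) T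
    · simp only [extendZero, indicator_of_mem hp]
    · simp only [extendZero, indicator_of_notMem hp, mul_zero]
  rw [← hq0, ← neg_nonneg]
  refine nonneg_of_forall_intervalIntegral_nonneg (q := fun σ => - q σ) hqc.neg fun s hs => ?_
  rw [intervalIntegral.integral_neg, neg_nonneg]
  obtain ⟨hint, hswap⟩ := integral_translate_swap (μ := volume) (memLp_extendZero hΩ (dt v))
    (memLp_extendZero hΩ (lap v)) (measurable_extendZero hΩ _) (measurable_extendZero hΩ _) e hs
  rw [hq, hswap]
  have hlap := hasLaplacian_lap hΩ hv
  have e1 : (fun p => (∫ σ in (0 : ℝ)..s, extendZero (dt v) (p - σ • e)) * extendZero (lap v) p)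
      = (Ω ×ˢ Ioo (0 : ℝ) T).indicator
        fun p => (∫ σ in (0 : ℝ)..s, extendZero (dt v) (p - σ • e)) * lap v p := by
    funext p
    by_cases hp : p ∈ Ω ×ˢ Ioo (0 : ℝ) T
    · simp only [extendZero, indicator_of_mem hp]
    · simp only [extendZero, indicator_of_notMem hp, mul_zero]
  rw [e1] at hint ⊢
  rw [integral_indicator hS]
  rw [integrable_indicator_iff hS] at hint
  obtain ⟨hint', hsymm⟩ := integral_cyl_symm hint
  rw [hsymm]
  have hle : ∀ᵐ t ∂(volume.restrict (Ioo 0 T)),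
      ∫ x in Ω, (∫ σ in (0 : ℝ)..s, extendZero (dt v) ((x, t) - σ • e)) * lap v (x, t)
        ≤ (sliceEnergy v (lap v) (t - s) - sliceEnergy v (lap v) t) / 2 := by
    filter_upwards [ae_average_dt_eq hΩ hT hv hs, ae_sliceEnergy_le v _ hlap s] with t h1 h2
    refine le_trans (le_of_eq (integral_congr_ae ?_)) h2
    filter_upwards [h1] with x hx
    rw [← hx, mul_comm]
  have hi := integrable_sliceEnergy v (lap v)
  have hi' : Integrable fun t => sliceEnergy v (lap v) (t - s) := hi.comp_sub_right s
  refine (integral_mono_ae hint'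
    ((hi'.sub hi).div_const 2).integrableOn hle).trans ?_
  simp only [Pi.sub_apply]
  rw [integral_div, integral_sub hi'.integrableOn hi.integrableOn]
  -- The energy is nonnegative and vanishes outside `(0,T)`: the shifted integral over `(0,T)` is at
  -- most the integral over the line, which by translation invariance equals the unshifted integral
  -- over `(0,T)`.
  have l1 : ∫ t in Ioo 0 T, sliceEnergy v (lap v) (t - s) ≤ ∫ t, sliceEnergy v (lap v) (t - s) :=
    setIntegral_le_integral hi' ((measurePreserving_sub_right volume s).quasiMeasurePreserving.ae
      (ae_sliceEnergy_nonneg v _ hlap))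
  have l2 : ∫ t in Ioo 0 T, sliceEnergy v (lap v) t = ∫ t, sliceEnergy v (lap v) t :=
    setIntegral_eq_integral_of_forall_compl_eq_zero fun t ht => indicator_of_notMem ht _
  have l3 := integral_sub_right_eq_self (μ := volume) (fun t => sliceEnergy v (lap v) t) s
  linarith

end EnergyInequality


/-! ### The least-squares problem on a subspace of the energy space -/

section LeastSquares

lemma inner_eq_zero_of_forall_norm_le {H : Type*} [NormedAddCommGroup H] [InnerProductSpace ℝ H]
    {r w : H} (h : ∀ c : ℝ, ‖r‖ ≤ ‖r + c • w‖) : inner ℝ r w = 0 := by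
  by_cases hw : w = 0
  · simp [hw]
  have hw' : 0 < ‖w‖ ^ 2 := by positivity
  -- This `c` minimizes the quadratic `‖r + c w‖²`, whose minimum is `‖r‖² - ⟨r,w⟩²/‖w‖²`.
  have h1 := h (-(inner ℝ r w) / ‖w‖ ^ 2)
  have h2 := pow_le_pow_left₀ (norm_nonneg _) h1 2
  rw [norm_add_sq_real, norm_smul, inner_smul_right, mul_pow, Real.norm_eq_abs, sq_abs] at h2
  have h3 : -(inner ℝ r w) / ‖w‖ ^ 2 * inner ℝ r w = -((inner ℝ r w) ^ 2 / ‖w‖ ^ 2) := by ring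
  have h4 : (-(inner ℝ r w) / ‖w‖ ^ 2) ^ 2 * ‖w‖ ^ 2 = (inner ℝ r w) ^ 2 / ‖w‖ ^ 2 := by
    field_simp
  rw [h3, h4] at h2
  have h5 : (inner ℝ r w) ^ 2 / ‖w‖ ^ 2 ≤ 0 := by linarith
  have h6 : (inner ℝ r w) ^ 2 ≤ 0 := by
    rwa [div_le_iff₀ hw', zero_mul] at h5
  exact pow_eq_zero_iff (two_ne_zero) |>.1 (le_antisymm h6 (sq_nonneg _))

variable {d : ℕ} {Ω : Set (Space d)} {T : ℝ}

variable (T) in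
/-- The heat operator `∂_t - Δ` on the energy space. -/
def heatLinear (hΩ : IsOpen Ω) : energySpace Ω T →ₗ[ℝ] L2Cyl Ω T := dtLinear T Ω - lapLinear T hΩ

lemma heatLinear_apply (hΩ : IsOpen Ω) (v : energySpace Ω T) :
    heatLinear T hΩ v = dt (v : L2Cyl Ω T) - lap (v : L2Cyl Ω T) := rfl

lemma L2Cyl_inner_eq (v w : L2Cyl Ω T) : inner ℝ v w = ∫ q, v q * w q ∂(cylMeasure Ω T) := by
  rw [L2.inner_def]
  exact integral_congr_ae (Eventually.of_forall fun q => by simp [mul_comm])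

/-- The integrand factors, which exhibits `𝒜` as the Gram form of the heat operator. -/
lemma formA_eq (v w : L2Cyl Ω T) : formA v w = inner ℝ (dt v - lap v) (dt w - lap w) := by
  rw [L2Cyl_inner_eq, formA]
  refine integral_congr_ae ?_
  filter_upwards [Lp.coeFn_sub (dt v) (lap v), Lp.coeFn_sub (dt w) (lap w)] with q h1 h2
  rw [h1, h2, Pi.sub_apply, Pi.sub_apply]
  ring

lemma formF_eq (f w : L2Cyl Ω T) : formF f w = inner ℝ f (dt w - lap w) := by
  rw [L2Cyl_inner_eq, formF]
  refine integral_congr_ae ?_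
  filter_upwards [Lp.coeFn_sub (dt w) (lap w)] with q h2
  rw [h2, Pi.sub_apply]

lemma inner_dt_lap_nonpos (hΩ : IsOpen Ω) (hT : 0 < T) {v : L2Cyl Ω T}
    (hv : v ∈ energySpace Ω T) : inner ℝ (dt v) (lap v) ≤ 0 := by
  rw [L2Cyl_inner_eq]; exact integral_dt_mul_lap_nonpos hΩ hT hv

/-- In the expansion of `‖∂_t v - Δv‖²` the cross term `-2⟨∂_t v, Δv⟩` is nonnegative and can be
dropped, so the constant is one. -/
lemma V0norm_le_norm_heatLinear (hΩ : IsOpen Ω) (hT : 0 < T) (v : energySpace Ω T) :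
    V0norm (v : L2Cyl Ω T) ≤ ‖heatLinear T hΩ v‖ := by
  rw [V0norm, heatLinear_apply]
  refine Real.sqrt_le_iff.2 ⟨norm_nonneg _, ?_⟩
  rw [norm_sub_sq_real]
  linarith [inner_dt_lap_nonpos hΩ hT v.2]

/-- This is `(a + b)² ≤ 2(a² + b²)`, and the only source of the factor `√2` in the error estimate.
-/
lemma norm_heatLinear_le (hΩ : IsOpen Ω) (v : energySpace Ω T) :
    ‖heatLinear T hΩ v‖ ≤ √2 * V0norm (v : L2Cyl Ω T) := by
  rw [V0norm, heatLinear_apply, ← Real.sqrt_mul (by norm_num)]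
  refine Real.le_sqrt_of_sq_le ?_
  have h1 := norm_sub_le (dt (v : L2Cyl Ω T)) (lap (v : L2Cyl Ω T))
  have h2 := pow_le_pow_left₀ (norm_nonneg _) h1 2
  nlinarith [sq_nonneg (‖dt (v : L2Cyl Ω T)‖ - ‖lap (v : L2Cyl Ω T)‖)]

lemma eq_zero_of_dt_eq_zero (hT : 0 < T) {v : L2Cyl Ω T} (hv : v ∈ energySpace Ω T)
    (h : dt v = 0) : v = 0 := by
  refine Lp.ext (ae_cyl_of_prod ?_)
  refine ae_prod_eq_of_ae_ae_eq (memLp_prod v).1 (memLp_prod (0 : L2Cyl Ω T)).1 ?_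
  filter_upwards [ae_eq_primitive_dt hT hv,
    ae_ae_of_ae_cyl (Lp.coeFn_zero ℝ 2 (cylMeasure Ω T))] with x hx h0
  have h0' := (ae_restrict_iff' measurableSet_Ioo).1 h0
  filter_upwards [hx, h0, ae_restrict_mem measurableSet_Ioo] with t ht h0t htm
  rw [ht, h0t, h, Pi.zero_apply]
  refine intervalIntegral.integral_zero_ae ?_
  filter_upwards [h0'] with r hr hrm
  rw [uIoc_of_le htm.1.le] at hrm
  exact hr ⟨hrm.1, hrm.2.trans_lt htm.2⟩

lemma heatLinear_injective (hΩ : IsOpen Ω) (hT : 0 < T) :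
    Function.Injective (heatLinear T hΩ) := by
  rw [injective_iff_map_eq_zero]
  intro v hv
  have h := V0norm_le_norm_heatLinear hΩ hT v
  rw [hv, norm_zero, V0norm] at h
  have h2 := Real.sqrt_eq_zero'.1 (le_antisymm h (Real.sqrt_nonneg _))
  have h3 : ‖dt (v : L2Cyl Ω T)‖ = 0 := by
    nlinarith [sq_nonneg ‖dt (v : L2Cyl Ω T)‖, sq_nonneg ‖lap (v : L2Cyl Ω T)‖]
  exact Subtype.ext (eq_zero_of_dt_eq_zero hT v.2 (norm_eq_zero.1 h3))

/-- The normal equations. -/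
lemma isMinimizer_iff_inner (hΩ : IsOpen Ω) {V : Submodule ℝ (L2Cyl Ω T)}
    (hV : V ≤ energySpace Ω T) (f u : L2Cyl Ω T) :
    IsMinimizer (V : Set (L2Cyl Ω T)) f u ↔
      u ∈ V ∧ ∀ v ∈ V, inner ℝ (dt u - lap u - f) (dt v - lap v) = 0 := by
  have hL : ∀ {u v : L2Cyl Ω T} (hu : u ∈ V) (hv : v ∈ V) (c : ℝ),
      dt (u + c • v) - lap (u + c • v) = dt u - lap u + c • (dt v - lap v) := by
    intro u v hu hv c
    have := (heatLinear T hΩ).map_add ⟨u, hV hu⟩ (c • ⟨v, hV hv⟩)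
    rwa [map_smul] at this
  constructor
  · rintro ⟨hu, hmin⟩
    refine ⟨hu, fun v hv => inner_eq_zero_of_forall_norm_le fun c => ?_⟩
    have := hmin (u + c • v) (V.add_mem hu (V.smul_mem c hv))
    rw [leastSquares, leastSquares, hL hu hv] at this
    have h2 : ‖dt u - lap u - f‖ ^ 2 ≤ ‖dt u - lap u - f + c • (dt v - lap v)‖ ^ 2 := by
      rw [show dt u - lap u - f + c • (dt v - lap v) = dt u - lap u + c • (dt v - lap v) - f by abel]
      linarith
    exact le_of_sq_le_sq h2 (norm_nonneg _)
  · rintro ⟨hu, h⟩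
    refine ⟨hu, fun v hv => ?_⟩
    have h1 := h (v - u) (V.sub_mem hv hu)
    have h2 := hL hu (V.sub_mem hv hu) 1
    rw [one_smul, one_smul, add_sub_cancel] at h2
    rw [leastSquares, leastSquares, h2, show dt u - lap u + (dt (v - u) - lap (v - u)) - f
      = (dt u - lap u - f) + (dt (v - u) - lap (v - u)) by abel, norm_add_sq_real, h1]
    nlinarith [sq_nonneg ‖dt (v - u) - lap (v - u)‖]

lemma isMinimizer_iff_isVariationalSolution (hΩ : IsOpen Ω) {V : Submodule ℝ (L2Cyl Ω T)}
    (hV : V ≤ energySpace Ω T) (f u : L2Cyl Ω T) :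
    IsMinimizer (V : Set (L2Cyl Ω T)) f u ↔ IsVariationalSolution (V : Set (L2Cyl Ω T)) f u := by
  rw [isMinimizer_iff_inner hΩ hV, IsVariationalSolution]
  refine and_congr Iff.rfl (forall₂_congr fun v _ => ?_)
  rw [formA_eq, formF_eq, inner_sub_left, sub_eq_zero]

/-- The image of `V` under the heat operator is finite-dimensional, so `f` has an orthogonal
projection onto it; the minimizers are the preimages of that projection, and injectivity leaves
exactly one. -/
lemma existsUnique_isMinimizer (hΩ : IsOpen Ω) (hT : 0 < T) {V : Submodule ℝ (L2Cyl Ω T)}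
    (hV : V ≤ energySpace Ω T) [FiniteDimensional ℝ V] (f : L2Cyl Ω T) :
    ∃! u, IsMinimizer (V : Set (L2Cyl Ω T)) f u := by
  set L : V →ₗ[ℝ] L2Cyl Ω T := heatLinear T hΩ ∘ₗ Submodule.inclusion hV with hLdef
  have hL : ∀ v : V, L v = dt (v : L2Cyl Ω T) - lap (v : L2Cyl Ω T) := fun v => rfl
  obtain ⟨u, hu⟩ : (LinearMap.range L).starProjection f ∈ LinearMap.range L :=
    Submodule.starProjection_apply_mem _ _
  refine ⟨u, ?_, fun w hw => ?_⟩
  · refine (isMinimizer_iff_inner hΩ hV f u).2 ⟨u.2, fun v hv => ?_⟩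
    have := Submodule.starProjection_inner_eq_zero (K := LinearMap.range L) f (L ⟨v, hv⟩)
      (LinearMap.mem_range_self _ _)
    rw [← hu, ← neg_sub, inner_neg_left, neg_eq_zero] at this
    exact this
  · obtain ⟨hwV, hw⟩ := (isMinimizer_iff_inner hΩ hV f w).1 hw
    have h1 : (LinearMap.range L).starProjection f = L ⟨w, hwV⟩ := by
      refine Submodule.eq_starProjection_of_mem_of_inner_eq_zero (LinearMap.mem_range_self _ _) ?_
      rintro _ ⟨v, rfl⟩
      rw [← neg_sub, inner_neg_left, neg_eq_zero]
      exact hw v v.2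
    rw [← hu] at h1
    have h2 := heatLinear_injective hΩ hT h1
    exact (congrArg (fun v : energySpace Ω T => (v : L2Cyl Ω T)) h2).symm

/-- Quasi-optimality of the discrete minimizer. -/
lemma V0norm_sub_le (hΩ : IsOpen Ω) (hT : 0 < T) {V : Submodule ℝ (L2Cyl Ω T)}
    (hV : V ≤ energySpace Ω T) {f u uh : L2Cyl Ω T} (hu : IsMinimizer (V0 Ω T) f u)
    (huh : IsMinimizer (V : Set (L2Cyl Ω T)) f uh) {vh : L2Cyl Ω T} (hvh : vh ∈ V) :
    V0norm (u - uh) ≤ √2 * V0norm (u - vh) := by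
  obtain ⟨huV, hu⟩ := (isMinimizer_iff_inner hΩ le_rfl f u).1 hu
  obtain ⟨huhV, huh⟩ := (isMinimizer_iff_inner hΩ hV f uh).1 huh
  set a : energySpace Ω T := ⟨u, huV⟩
  set b : energySpace Ω T := ⟨uh, hV huhV⟩
  set c : energySpace Ω T := ⟨vh, hV hvh⟩
  -- The discrete direction `uh - vh` is admissible for both minimization problems; subtracting the
  -- two orthogonality relations cancels `f`.
  have horth : inner ℝ (heatLinear T hΩ (a - b)) (heatLinear T hΩ (b - c)) = 0 := by
    have h1 := hu (uh - vh) (hV (V.sub_mem huhV hvh))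
    have h2 := huh (uh - vh) (V.sub_mem huhV hvh)
    have h3 : inner ℝ ((dt u - lap u - f) - (dt uh - lap uh - f))
        (dt (uh - vh) - lap (uh - vh)) = 0 := by
      rw [inner_sub_left, h1, h2, sub_zero]
    rw [sub_sub_sub_cancel_right] at h3
    rw [map_sub]
    exact h3
  have hpyth : ‖heatLinear T hΩ (a - b)‖ ≤ ‖heatLinear T hΩ (a - c)‖ := by
    refine le_of_sq_le_sq ?_ (norm_nonneg _)
    rw [show a - c = (a - b) + (b - c) by abel, map_add, norm_add_sq_real, horth]
    nlinarith [sq_nonneg ‖heatLinear T hΩ (b - c)‖]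
  exact (V0norm_le_norm_heatLinear hΩ hT (a - b)).trans
    (hpyth.trans (norm_heatLinear_le hΩ (a - c)))

lemma V0norm_sub_le_iInf (hΩ : IsOpen Ω) (hT : 0 < T) {V : Submodule ℝ (L2Cyl Ω T)}
    (hV : V ≤ energySpace Ω T) {f u uh : L2Cyl Ω T} (hu : IsMinimizer (V0 Ω T) f u)
    (huh : IsMinimizer (V : Set (L2Cyl Ω T)) f uh) :
    V0norm (u - uh) ≤
      √2 * ⨅ vh : (V : Set (L2Cyl Ω T)), V0norm (u - (vh : L2Cyl Ω T)) := by
  have : Nonempty (V : Set (L2Cyl Ω T)) := ⟨⟨0, V.zero_mem⟩⟩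
  rw [Real.mul_iInf_of_nonneg (Real.sqrt_nonneg _)]
  exact le_ciInf fun vh => V0norm_sub_le hΩ hT hV hu huh vh.2

end LeastSquares


/-! ### Regularity of univariate splines -/

section Univariate

/-- On an open knot span every B-spline is a polynomial. -/
lemma bspline_eqOn_polynomial {p m : ℕ} (K : OpenKnotVector p m) {j : ℕ} (hj : j < m + p) (q : ℕ) :
    ∀ i, i + q < m + p → ∃ P : Polynomial ℝ,
      EqOn (bspline K.knot q i) (fun x => P.eval x) (Ioo (K.knot j) (K.knot (j + 1))) := by
  induction q with
  | zero =>
    intro i hi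
    -- Points of an open span are below `1`, so the clause that closes the last span plays no role.
    have hlt : ∀ x ∈ Ioo (K.knot j) (K.knot (j + 1)), x ≠ 1 := fun x hx h => by
      have h1 := K.mono (j + 1) (m + p) hj le_rfl
      rw [K.last (m + p) (by omega) le_rfl] at h1
      linarith [hx.2]
    rcases lt_trichotomy i j with h | h | h
    · refine ⟨0, fun x hx => ?_⟩
      have h1 := K.mono (i + 1) j h (by omega)
      simp only [bspline, Polynomial.eval_zero]
      rw [if_neg]
      rintro (h2 | h2)
      · linarith [h2.2, hx.1]
      · exact hlt x hx h2.1
    · subst h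
      exact ⟨1, fun x hx => by
        simp only [bspline, Polynomial.eval_one]
        rw [if_pos (Or.inl ⟨hx.1.le, hx.2⟩)]⟩
    · refine ⟨0, fun x hx => ?_⟩
      have h1 := K.mono (j + 1) i h (by omega)
      simp only [bspline, Polynomial.eval_zero]
      rw [if_neg]
      rintro (h2 | h2)
      · linarith [h2.1, hx.2]
      · exact hlt x hx h2.1
  | succ q ih =>
    intro i hi
    obtain ⟨P, hP⟩ := ih i (by omega)
    obtain ⟨Q, hQ⟩ := ih (i + 1) (by omega)
    set a := K.knot i
    set b := K.knot (i + q + 1) - K.knot i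
    set a' := K.knot (i + q + 2)
    set b' := K.knot (i + q + 2) - K.knot (i + 1)
    -- For repeated knots `b` or `b'` is zero; the inverse of zero is zero, in agreement with the
    -- convention `0/0 = 0`.
    refine ⟨Polynomial.C b⁻¹ * (Polynomial.X - Polynomial.C a) * P
      + Polynomial.C b'⁻¹ * (Polynomial.C a' - Polynomial.X) * Q, fun x hx => ?_⟩
    simp only [bspline, hP hx, hQ hx, Polynomial.eval_add, Polynomial.eval_mul,
      Polynomial.eval_C, Polynomial.eval_sub, Polynomial.eval_X]
    simp only [a, b, a', b']
    ring

/-- For points on opposite sides of `b`, compare both with `b`: on the line the two distances add up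
exactly, so the constants are not summed. -/
lemma lipschitzOnWith_Icc_glue {f : ℝ → ℝ} {a b c : ℝ} {C C' : ℝ≥0}
    (h : LipschitzOnWith C f (Icc a b)) (h' : LipschitzOnWith C' f (Icc b c)) :
    LipschitzOnWith (max C C') f (Icc a c) := by
  have h1 := h.weaken (le_max_left C C')
  have h2 := h'.weaken (le_max_right C C')
  have key : ∀ x ∈ Icc a c, ∀ y ∈ Icc a c, x ≤ y →
      dist (f x) (f y) ≤ (max C C' : ℝ≥0) * dist x y := by
    intro x hx y hy hxy
    rcases le_total y b with hyb | hyb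
    · exact h1.dist_le_mul x ⟨hx.1, hxy.trans hyb⟩ y ⟨hy.1, hyb⟩
    rcases le_total b x with hxb | hxb
    · exact h2.dist_le_mul x ⟨hxb, hx.2⟩ y ⟨hyb, hy.2⟩
    have e1 := h1.dist_le_mul x ⟨hx.1, hxb⟩ b ⟨hx.1.trans hxb, le_rfl⟩
    have e2 := h2.dist_le_mul b ⟨le_rfl, hyb.trans hy.2⟩ y ⟨hyb, hy.2⟩
    have e3 : dist x y = dist x b + dist b y := by
      rw [dist_comm, dist_comm x b, dist_comm b y, Real.dist_eq, Real.dist_eq, Real.dist_eq,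
        abs_of_nonneg (by linarith), abs_of_nonneg (by linarith), abs_of_nonneg (by linarith)]
      ring
    rw [e3, mul_add]
    exact (dist_triangle _ _ _).trans (add_le_add e1 e2)
  refine LipschitzOnWith.of_dist_le_mul fun x hx y hy => ?_
  rcases le_total x y with hxy | hxy
  · exact key x hx y hy hxy
  · rw [dist_comm, dist_comm x]; exact key y hy x hx hxy

/-- A continuous piecewise polynomial is Lipschitz. -/
lemma exists_lipschitzOnWith_of_piecewise_polynomial {p m : ℕ} (K : OpenKnotVector p m)
    {f : ℝ → ℝ} (hf : ContinuousOn f (Icc 0 1))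
    (h : ∀ j < m + p, ∃ P : Polynomial ℝ,
      EqOn f (fun x => P.eval x) (Ioo (K.knot j) (K.knot (j + 1)))) :
    ∃ C : ℝ≥0, LipschitzOnWith C f (Icc 0 1) := by
  have h0 : K.knot 0 = 0 := K.first 0 (by omega)
  have h1 : K.knot (m + p) = 1 := K.last (m + p) (by omega) le_rfl
  have key : ∀ j ≤ m + p, ∃ C : ℝ≥0, LipschitzOnWith C f (Icc 0 (K.knot j)) := by
    intro j
    induction j with
    | zero =>
      intro _
      refine ⟨0, ?_⟩
      rw [h0, Icc_self]
      exact fun x hx y hy => by rw [mem_singleton_iff.1 hx, mem_singleton_iff.1 hy]; simp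
    | succ j ih =>
      intro hj
      obtain ⟨C, hC⟩ := ih (by omega)
      rcases (K.mono j (j + 1) (by omega) hj).eq_or_lt with he | hlt
      · exact ⟨C, he ▸ hC⟩
      obtain ⟨P, hP⟩ := h j (by omega)
      have hsub : Icc (K.knot j) (K.knot (j + 1)) ⊆ Icc 0 1 :=
        Icc_subset_Icc (h0 ▸ K.mono 0 j (by omega) (by omega)) (h1 ▸ K.mono _ _ hj le_rfl)
      -- Continuity carries the polynomial identity from the open span to its closure.
      have hE : EqOn f (fun x => P.eval x) (Icc (K.knot j) (K.knot (j + 1))) :=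
        hP.of_subset_closure (hf.mono hsub) P.continuous.continuousOn Ioo_subset_Icc_self
          (by rw [closure_Ioo hlt.ne])
      have hPd : ContDiff ℝ 1 (fun x => P.eval x) :=
        contDiff_one_iff_deriv.2 ⟨P.differentiable, by
          rw [show deriv (fun x => P.eval x) = fun x => P.derivative.eval x from
            funext fun x => P.deriv]
          exact P.derivative.continuous⟩
      obtain ⟨C', hC'⟩ := hPd.contDiffOn.exists_lipschitzOnWith (by decide)
        (convex_Icc (K.knot j) (K.knot (j + 1))) isCompact_Icc
      refine ⟨max C C', lipschitzOnWith_Icc_glue hC fun x hx y hy => ?_⟩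
      rw [hE hx, hE hy]
      exact hC' hx hy
  have := key (m + p) le_rfl
  rwa [h1] at this

/-- A `C^1` spline extends to a differentiable function on the line with Lipschitz derivative. -/
lemma exists_extension_of_piecewise_polynomial {p m : ℕ} (K : OpenKnotVector p m)
    {f : ℝ → ℝ} (hf : ContDiffOn ℝ 1 f (Icc 0 1))
    (h : ∀ j < m + p, ∃ P : Polynomial ℝ,
      EqOn f (fun x => P.eval x) (Ioo (K.knot j) (K.knot (j + 1)))) :
    ∃ (B g : ℝ → ℝ) (C : ℝ≥0), LipschitzWith C g ∧ (∀ x, HasDerivAt B (g x) x) ∧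
      EqOn B f (Icc 0 1) := by
  have h0 : K.knot 0 = 0 := K.first 0 (by omega)
  have h1 : K.knot (m + p) = 1 := K.last (m + p) (by omega) le_rfl
  have hder : ∀ x ∈ Ioo (0 : ℝ) 1, HasDerivAt f (derivWithin f (Icc 0 1) x) x := fun x hx =>
    ((hf.differentiableOn (by norm_num)) x (Ioo_subset_Icc_self hx)).hasDerivWithinAt.hasDerivAt
      (Icc_mem_nhds hx.1 hx.2)
  obtain ⟨C, hC⟩ := exists_lipschitzOnWith_of_piecewise_polynomial K
    (f := derivWithin f (Icc 0 1))
    (hf.continuousOn_derivWithin (uniqueDiffOn_Icc one_pos) (by norm_num)) (by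
      intro j hj
      obtain ⟨P, hP⟩ := h j hj
      refine ⟨Polynomial.derivative P, fun x hx => ?_⟩
      have hsub : Ioo (K.knot j) (K.knot (j + 1)) ⊆ Ioo 0 1 :=
        Ioo_subset_Ioo (h0 ▸ K.mono 0 j (by omega) (by omega)) (h1 ▸ K.mono _ _ hj le_rfl)
      have e1 : f =ᶠ[𝓝 x] fun x => P.eval x :=
        hP.eventuallyEq_of_mem (isOpen_Ioo.mem_nhds hx)
      exact (hder x (hsub hx)).unique ((P.hasDerivAt x).congr_of_eventuallyEq e1))
  -- The derivative is extended and then integrated; extending `f` itself would not ensure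
  -- differentiability at `0` and `1`.
  obtain ⟨g, hg, hgf⟩ := hC.extend_real
  have hgi : ∀ a b, IntervalIntegrable g volume a b := fun a b =>
    hg.continuous.intervalIntegrable a b
  refine ⟨fun x => f 0 + ∫ t in (0 : ℝ)..x, g t, g, C, hg, fun x => ?_, fun x hx => ?_⟩
  · exact (intervalIntegral.integral_hasDerivAt_right (hgi 0 x)
      hg.continuous.aestronglyMeasurable.stronglyMeasurableAtFilter
      hg.continuous.continuousAt).const_add _
  · have hsub : Icc 0 x ⊆ Icc 0 1 := Icc_subset_Icc le_rfl hx.2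
    simp only
    rw [intervalIntegral.integral_eq_sub_of_hasDerivAt_of_le hx.1 (hf.continuousOn.mono hsub)
      (fun y hy => ?_) (hgi 0 x)]
    · ring
    · rw [← hgf (hsub (Ioo_subset_Icc_self hy))]
      exact hder y ⟨hy.1, hy.2.trans_le hx.2⟩

end Univariate

/-! ### Functions with locally Lipschitz derivative -/

section IsC11

variable {E G : Type*} [NormedAddCommGroup E] [NormedSpace ℝ E]
  [NormedAddCommGroup G] [NormedSpace ℝ G]

/-- Differentiable functions with locally Lipschitz derivative. -/
def IsC11 (f : E → G) : Prop := Differentiable ℝ f ∧ LocallyLipschitz (fderiv ℝ f)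

lemma IsC11.contDiff {f : E → G} (h : IsC11 f) : ContDiff ℝ 1 f :=
  contDiff_one_iff_fderiv.2 ⟨h.1, h.2.continuous⟩

lemma locallyLipschitz_comp_contDiff {α V W : Type*} [PseudoEMetricSpace α] [NormedAddCommGroup V]
    [NormedSpace ℝ V] [NormedAddCommGroup W] [NormedSpace ℝ W] {f : α → V} {Θ : V → W}
    (hΘ : ContDiff ℝ 1 Θ) (hf : LocallyLipschitz f) : LocallyLipschitz fun x => Θ (f x) :=
  hΘ.locallyLipschitz.comp hf

lemma LocallyLipschitz.add' {α V : Type*} [PseudoEMetricSpace α] [NormedAddCommGroup V]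
    [NormedSpace ℝ V] {f g : α → V} (hf : LocallyLipschitz f) (hg : LocallyLipschitz g) :
    LocallyLipschitz fun x => f x + g x :=
  locallyLipschitz_comp_contDiff (Θ := fun q : V × V => q.1 + q.2) (by fun_prop) (hf.prodMk hg)

lemma LocallyLipschitz.smul' {α V : Type*} [PseudoEMetricSpace α] [NormedAddCommGroup V]
    [NormedSpace ℝ V] {f : α → ℝ} {g : α → V} (hf : LocallyLipschitz f)
    (hg : LocallyLipschitz g) : LocallyLipschitz fun x => f x • g x :=
  locallyLipschitz_comp_contDiff (Θ := fun q : ℝ × V => q.1 • q.2) (by fun_prop) (hf.prodMk hg)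

lemma IsC11.const (c : G) : IsC11 fun _ : E => c :=
  ⟨differentiable_const c, by
    have : fderiv ℝ (fun _ : E => c) = fun _ => 0 := by funext x; simp
    rw [this]; exact LocallyLipschitz.const 0⟩

lemma IsC11.add {f g : E → G} (hf : IsC11 f) (hg : IsC11 g) : IsC11 fun x => f x + g x :=
  ⟨hf.1.add hg.1, by
    have : fderiv ℝ (fun x => f x + g x) = fun x => fderiv ℝ f x + fderiv ℝ g x := by
      funext x; exact fderiv_fun_add (hf.1 x) (hg.1 x)
    rw [this]; exact LocallyLipschitz.add' hf.2 hg.2⟩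

lemma locallyLipschitz_smulRight {α : Type*} [PseudoEMetricSpace α] {f : α → E →L[ℝ] ℝ}
    {g : α → G} (hf : LocallyLipschitz f) (hg : LocallyLipschitz g) :
    LocallyLipschitz fun x => (f x).smulRight (g x) := by
  have hΘ : ContDiff ℝ 1 fun q : (E →L[ℝ] ℝ) × G => ContinuousLinearMap.smulRightL ℝ E G q.1 q.2 :=
    (ContinuousLinearMap.smulRightL ℝ E G).isBoundedBilinearMap.contDiff
  have h := hΘ.locallyLipschitz.comp (hf.prodMk hg)
  refine (congrArg LocallyLipschitz ?_).mp h
  funext x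
  rfl

lemma IsC11.smul {f : E → ℝ} {g : E → G} (hf : IsC11 f) (hg : IsC11 g) :
    IsC11 fun x => f x • g x := by
  refine ⟨hf.1.smul hg.1, ?_⟩
  have h1 : LocallyLipschitz fun x => f x • fderiv ℝ g x :=
    LocallyLipschitz.smul' hf.contDiff.locallyLipschitz hg.2
  have h2 : LocallyLipschitz fun x => (fderiv ℝ f x).smulRight (g x) :=
    locallyLipschitz_smulRight hf.2 hg.contDiff.locallyLipschitz
  have h3 : fderiv ℝ (fun x => f x • g x)
      = fun x => f x • fderiv ℝ g x + (fderiv ℝ f x).smulRight (g x) :=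
    funext fun x => fderiv_fun_smul (hf.1 x) (hg.1 x)
  rw [h3]
  exact LocallyLipschitz.add' h1 h2

lemma IsC11.sum {ι : Type*} (s : Finset ι) {f : ι → E → G} (hf : ∀ i ∈ s, IsC11 (f i)) :
    IsC11 fun x => ∑ i ∈ s, f i x := by
  classical
  induction s using Finset.induction_on with
  | empty => simpa using IsC11.const (0 : G)
  | insert a s ha ih =>
    simp only [Finset.sum_insert ha]
    exact (hf a (by simp)).add (ih fun i hi => hf i (by simp [hi]))

lemma IsC11.prod {ι : Type*} (s : Finset ι) {f : ι → E → ℝ} (hf : ∀ i ∈ s, IsC11 (f i)) :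
    IsC11 fun x => ∏ i ∈ s, f i x := by
  classical
  induction s using Finset.induction_on with
  | empty => simpa using IsC11.const (1 : ℝ)
  | insert a s ha ih =>
    simp only [Finset.prod_insert ha]
    exact (hf a (by simp)).smul (ih fun i hi => hf i (by simp [hi]))

lemma IsC11.comp_clm {B g : ℝ → ℝ} {C : ℝ≥0} (hg : LipschitzWith C g)
    (hB : ∀ x, HasDerivAt B (g x) x) (ℓ : E →L[ℝ] ℝ) : IsC11 fun x => B (ℓ x) := by
  have hd : ∀ x, HasFDerivAt (fun x => B (ℓ x)) (g (ℓ x) • ℓ) x := fun x =>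
    (hB (ℓ x)).comp_hasFDerivAt x ℓ.hasFDerivAt
  refine ⟨fun x => (hd x).differentiableAt, ?_⟩
  rw [show fderiv ℝ (fun x => B (ℓ x)) = fun x => g (ℓ x) • ℓ from funext fun x => (hd x).fderiv]
  exact LocallyLipschitz.smul' (hg.locallyLipschitz.comp ℓ.lipschitz.locallyLipschitz)
    (LocallyLipschitz.const ℓ)

end IsC11

/-! ### Tensor-product splines -/

section Tensor

variable {d ps : ℕ} {m : Fin d → ℕ}

lemma spaceSplines_eq_zero_on_cube {K : ∀ l, OpenKnotVector ps (m l)} {l : Fin d}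
    (h : ∀ i : Fin (m l), ∀ x ∈ Icc (0 : ℝ) 1, bspline (K l).knot ps i x = 0)
    {s : Space d → ℝ} (hs : s ∈ spaceSplines K) : ∀ η ∈ cube d, s η = 0 := by
  intro η hη
  induction hs using Submodule.span_induction with
  | mem s hs =>
    obtain ⟨i, rfl⟩ := hs
    exact Finset.prod_eq_zero (Finset.mem_univ l) (h (i l) _ (hη l))
  | zero => rfl
  | add s t _ _ h1 h2 => simp [h1, h2]
  | smul c s _ h1 => simp [h1]

/-- If all B-splines in direction `l` vanished on `[0,1]`, every tensor-product spline would vanish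
on the cube, and `F` would be constant there, against injectivity. -/
lemma exists_bspline_ne_zero {K : ∀ l, OpenKnotVector ps (m l)} {F : Space d → Space d}
    (hF : IsSplinePatch K F) (l : Fin d) :
    ∃ i : Fin (m l), ∃ x ∈ Icc (0 : ℝ) 1, bspline (K l).knot ps i x ≠ 0 := by
  by_contra! h
  have h0 : (0 : Space d) ∈ cube d := fun l => by simp
  have h1 : (WithLp.toLp 2 (fun _ => (1 : ℝ)) : Space d) ∈ cube d := fun l => by simp
  have := hF.injOn h0 h1 (by
    ext k
    rw [spaceSplines_eq_zero_on_cube h (hF.spline k) _ h0,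
      spaceSplines_eq_zero_on_cube h (hF.spline k) _ h1])
  have h2 := congrArg (fun v : Space d => v l) this
  simp at h2

/-- Regularity is assumed for tensor products only. Freezing the other coordinates at points where
some B-spline is nonzero leaves a nonzero multiple of the univariate B-spline along a line. -/
lemma contDiffOn_bspline {K : ∀ l, OpenKnotVector ps (m l)}
    (hC1 : ∀ s ∈ spaceSplines K, ContDiffOn ℝ 1 s (cube d)) {F : Space d → Space d}
    (hF : IsSplinePatch K F) (l : Fin d) (i : Fin (m l)) :
    ContDiffOn ℝ 1 (bspline (K l).knot ps i) (Icc 0 1) := by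
  classical
  choose j x hx hne using exists_bspline_ne_zero hF
  set γ : ℝ → Space d := fun t => WithLp.toLp 2 (Function.update x l t) with hγ
  have hγd : ContDiff ℝ 1 γ := by
    rw [contDiff_euclidean]
    intro k
    by_cases hk : k = l
    · subst hk; simpa [hγ] using! contDiff_id
    · simpa [hγ, Function.update_of_ne hk] using contDiff_const
  have hγc : MapsTo γ (Icc 0 1) (cube d) := by
    intro t ht k
    by_cases hk : k = l
    · subst hk; simpa [hγ] using ht
    · simpa [hγ, Function.update_of_ne hk] using hx k
  set s : Space d → ℝ := fun η => ∏ k, bspline (K k).knot ps (Function.update j l i k) (η k)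
  have hs : s ∈ spaceSplines K := Submodule.subset_span ⟨Function.update j l i, rfl⟩
  set c := ∏ k ∈ Finset.univ.erase l, bspline (K k).knot ps (j k) (x k) with hc
  have hc0 : c ≠ 0 := Finset.prod_ne_zero_iff.2 fun k _ => hne k
  have hsγ : ∀ t, s (γ t) = bspline (K l).knot ps i t * c := by
    intro t
    simp only [s]
    rw [← Finset.mul_prod_erase _ _ (Finset.mem_univ l)]
    congr 1
    · simp [hγ]
    · refine Finset.prod_congr rfl fun k hk => ?_
      have hk' := (Finset.mem_erase.1 hk).1
      simp [hγ, Function.update_of_ne hk']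
  have h1 := ((hC1 s hs).comp hγd.contDiffOn hγc).mul (contDiffOn_const (c := c⁻¹))
  refine h1.congr fun t _ => ?_
  simp only [Function.comp_apply, hsγ]
  field_simp

/-- Splines agree on the cube with functions having a locally Lipschitz derivative. -/
lemma exists_isC11_extension {K : ∀ l, OpenKnotVector ps (m l)}
    (hC1 : ∀ s ∈ spaceSplines K, ContDiffOn ℝ 1 s (cube d)) {F : Space d → Space d}
    (hF : IsSplinePatch K F) {s : Space d → ℝ} (hs : s ∈ spaceSplines K) :
    ∃ S : Space d → ℝ, IsC11 S ∧ EqOn S s (cube d) := by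
  induction hs using Submodule.span_induction with
  | mem s hs =>
    obtain ⟨i, rfl⟩ := hs
    have hB := fun l => exists_extension_of_piecewise_polynomial (K l)
      (contDiffOn_bspline hC1 hF l (i l))
      fun j hj => bspline_eqOn_polynomial (K l) hj ps (i l) (by have := (i l).2; omega)
    choose B g C hg hB hE using hB
    refine ⟨fun η => ∏ l, B l (η l), IsC11.prod _ fun l _ => ?_, fun η hη => ?_⟩
    · exact IsC11.comp_clm (hg l) (hB l) (EuclideanSpace.proj l)
    · exact Finset.prod_congr rfl fun l _ => hE l (hη l)
  | zero => exact ⟨fun _ => 0, IsC11.const 0, fun _ _ => rfl⟩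
  | add s t _ _ h1 h2 =>
    obtain ⟨S, hS, hSe⟩ := h1
    obtain ⟨R, hR, hRe⟩ := h2
    exact ⟨_, hS.add hR, fun η hη => by simp [hSe hη, hRe hη]⟩
  | smul c s _ h1 =>
    obtain ⟨S, hS, hSe⟩ := h1
    exact ⟨_, (IsC11.const c).smul hS, fun η hη => by simp [hSe hη]⟩

/-- Nothing is known about `F` outside the cube, so its full derivative at boundary points is not
controlled; the extension supplies a derivative there that is continuous across the boundary. -/
lemma exists_isC11_extension_patch {K : ∀ l, OpenKnotVector ps (m l)}
    (hC1 : ∀ s ∈ spaceSplines K, ContDiffOn ℝ 1 s (cube d)) {F : Space d → Space d}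
    (hF : IsSplinePatch K F) : ∃ P : Space d → Space d, IsC11 P ∧ EqOn P F (cube d) := by
  choose S hS hE using fun k => exists_isC11_extension hC1 hF (hF.spline k)
  refine ⟨fun η => ∑ k, S k η • EuclideanSpace.single k (1 : ℝ),
    IsC11.sum _ fun k _ => (hS k).smul (IsC11.const _), fun η hη => ?_⟩
  ext l
  have : ∀ k, S k η = F η k := fun k => hE k hη
  simp [this, Pi.single_apply]

end Tensor


/-! ### The geometry of a spline patch -/

section Geometry

variable {d ps : ℕ} {m : Fin d → ℕ} {K : ∀ l, OpenKnotVector ps (m l)} {F P : Space d → Space d}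

lemma cube_eq_preimage (d : ℕ) :
    cube d = EuclideanSpace.equiv (Fin d) ℝ ⁻¹' (univ.pi fun _ => Icc 0 1) := by
  ext η
  exact ⟨fun h l _ => h l, fun h l => h l trivial⟩

lemma isCompact_cube (d : ℕ) : IsCompact (cube d) := by
  rw [cube_eq_preimage]
  exact (EuclideanSpace.equiv (Fin d) ℝ).toHomeomorph.isCompact_preimage.2
    (isCompact_univ_pi fun _ => isCompact_Icc)

lemma OpenKnotVector.exists_span {p m : ℕ} (K : OpenKnotVector p m) {x : ℝ}
    (hx : x ∈ Icc (0 : ℝ) 1) :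
    ∃ j < m + p, K.knot j < K.knot (j + 1) ∧ x ∈ Icc (K.knot j) (K.knot (j + 1)) := by
  classical
  have h0 : K.knot 0 = 0 := K.first 0 (by omega)
  have h1 : K.knot (m + p) = 1 := K.last (m + p) (by omega) le_rfl
  -- The least such index ends a nonempty span containing `x`. The positivity clause matters for `x
  -- = 0`, where it skips the repeated initial knots.
  have hex : ∃ j, x ≤ K.knot j ∧ 0 < K.knot j := ⟨m + p, by rw [h1]; exact hx.2, by simp [h1]⟩
  obtain ⟨hj1, hj2⟩ := Nat.find_spec hex
  have hle : Nat.find hex ≤ m + p := Nat.find_min' hex ⟨by rw [h1]; exact hx.2, by simp [h1]⟩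
  have hpos : 0 < Nat.find hex := by
    rw [Nat.find_pos]; rintro ⟨-, h⟩; rw [h0] at h; exact lt_irrefl _ h
  obtain ⟨j, hj⟩ := Nat.exists_eq_succ_of_ne_zero hpos.ne'
  have hmin := Nat.find_min hex (m := j) (by omega)
  rw [hj] at hj1 hj2 hle
  rw [not_and_or, not_le, not_lt] at hmin
  refine ⟨j, hle, ?_, ?_, hj1⟩
  · rcases hmin with h | h
    · exact h.trans_le hj1
    · exact h.trans_lt hj2
  · rcases hmin with h | h
    · exact h.le
    · exact h.trans hx.1

lemma element_eq_preimage (K : ∀ l, OpenKnotVector ps (m l)) (j : Fin d → ℕ) :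
    element K j = EuclideanSpace.equiv (Fin d) ℝ ⁻¹'
      (univ.pi fun l => Ioo ((K l).knot (j l)) ((K l).knot (j l + 1))) := by
  ext η
  exact ⟨fun h l _ => h l, fun h l => h l trivial⟩

lemma isOpen_element (K : ∀ l, OpenKnotVector ps (m l)) (j : Fin d → ℕ) :
    IsOpen (element K j) := by
  rw [element_eq_preimage]
  exact (isOpen_set_pi finite_univ fun _ _ => isOpen_Ioo).preimage
    (EuclideanSpace.equiv (Fin d) ℝ).continuous

lemma exists_mem_closure_element (K : ∀ l, OpenKnotVector ps (m l)) {η : Space d}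
    (hη : η ∈ cube d) : ∃ j : Fin d → ℕ, (∀ l, j l < m l + ps) ∧ η ∈ closure (element K j) := by
  choose j hj hlt hmem using fun l => (K l).exists_span (hη l)
  refine ⟨j, hj, ?_⟩
  rw [element_eq_preimage]
  have := (EuclideanSpace.equiv (Fin d) ℝ).toHomeomorph.preimage_closure
    (univ.pi fun l => Ioo ((K l).knot (j l)) ((K l).knot (j l + 1)))
  change _ = closure (EuclideanSpace.equiv (Fin d) ℝ ⁻¹' _) at this
  rw [← this, closure_pi_set]
  intro l _
  change η l ∈ closure (Ioo _ _)
  rw [closure_Ioo (hlt l).ne]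
  exact hmem l

lemma element_subset_cube {j : Fin d → ℕ} (hj : ∀ l, j l < m l + ps) : element K j ⊆ cube d := by
  intro η hη l
  have h0 : (K l).knot 0 = 0 := (K l).first 0 (by omega)
  have h1 : (K l).knot (m l + ps) = 1 := (K l).last _ (by omega) le_rfl
  have hjl := hj l
  exact ⟨h0 ▸ ((K l).mono 0 (j l) (by omega) (by omega)).trans (hη l).1.le,
    h1 ▸ (hη l).2.le.trans ((K l).mono (j l + 1) _ hjl le_rfl)⟩

lemma invParam_apply (hinj : InjOn F (cube d)) {η : Space d} (hη : η ∈ cube d) :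
    invParam F (F η) = η :=
  hinj.leftInvOn_invFunOn hη

/-- A linear endomorphism of a finite-dimensional space that is bounded below is invertible. -/
lemma exists_equiv_of_bound {E : Type*} [NormedAddCommGroup E] [NormedSpace ℝ E]
    [FiniteDimensional ℝ E] {L : E →L[ℝ] E} (h : Function.Injective L) :
    ∃ e : E ≃L[ℝ] E, (e : E →L[ℝ] E) = L :=
  ⟨(LinearEquiv.ofInjectiveEndo (L : E →ₗ[ℝ] E) h).toContinuousLinearEquiv, by ext v; rfl⟩

lemma injective_of_bound {E : Type*} [NormedAddCommGroup E] [NormedSpace ℝ E]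
    {L : E →L[ℝ] E} {C : ℝ} (h : ∀ v, ‖v‖ ≤ C * ‖L v‖) : Function.Injective L := by
  rw [injective_iff_map_eq_zero]
  intro v hv
  have := h v
  rw [hv, norm_zero, mul_zero] at this
  exact norm_eq_zero.1 (le_antisymm this (norm_nonneg _))

lemma map_nhds_eq_of_injective (hP : IsC11 P) {η : Space d}
    (h : Function.Injective (fderiv ℝ P η)) : map P (𝓝 η) = 𝓝 (P η) := by
  obtain ⟨e, he⟩ := exists_equiv_of_bound h
  have hs : HasStrictFDerivAt P (e : Space d →L[ℝ] Space d) η := by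
    rw [he]; exact hP.contDiff.contDiffAt.hasStrictFDerivAt (by norm_num)
  exact hs.map_nhds_eq_of_equiv

lemma isOpen_image_of_injective (hP : IsC11 P) {U : Set (Space d)} (hU : IsOpen U)
    (h : ∀ η ∈ U, Function.Injective (fderiv ℝ P η)) : IsOpen (P '' U) := by
  rw [isOpen_iff_mem_nhds]
  rintro _ ⟨η, hη, rfl⟩
  rw [← map_nhds_eq_of_injective hP (h η hη)]
  exact image_mem_map (hU.mem_nhds hη)

/-- Differentiating `F⁻¹ ∘ P = id` on the element shows that the derivative of `F⁻¹` is a left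
inverse of that of `P`; its bound becomes a lower bound for the derivative of `P`. -/
lemma exists_bound_fderiv_element (hF : IsSplinePatch K F) (hP : IsC11 P)
    (hE : EqOn P F (cube d)) {j : Fin d → ℕ} (hj : ∀ l, j l < m l + ps) :
    ∃ C : ℝ, ∀ η ∈ element K j, ∀ v, ‖v‖ ≤ C * ‖fderiv ℝ P η v‖ := by
  have hsub := element_subset_cube (K := K) hj
  have himg : F '' element K j = P '' element K j :=
    image_congr fun η hη => (hE (hsub hη)).symm
  have hchain : ∀ η ∈ element K j, ∀ v,
      fderivWithin ℝ (invParam F) (F '' element K j) (F η) (fderiv ℝ P η v) = v := by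
    intro η hη v
    have h1 : HasFDerivWithinAt (invParam F)
        (fderivWithin ℝ (invParam F) (F '' element K j) (F η)) (F '' element K j) (P η) := by
      rw [hE (hsub hη)]
      exact (((hF.smooth_inv j hj).differentiableOn (by simp)) _
        (mem_image_of_mem F hη)).hasFDerivWithinAt
    have h2 := h1.comp η (hP.1 η).hasFDerivAt.hasFDerivWithinAt
      (fun ζ hζ => himg ▸ mem_image_of_mem P hζ : MapsTo P (element K j) _)
    have h3 : HasFDerivWithinAt (invParam F ∘ P) (ContinuousLinearMap.id ℝ (Space d))
        (element K j) η :=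
      (hasFDerivWithinAt_id η _).congr (fun ζ hζ => by
        rw [Function.comp_apply, hE (hsub hζ), invParam_apply hF.injOn (hsub hζ), id])
        (by rw [Function.comp_apply, hE (hsub hη), invParam_apply hF.injOn (hsub hη), id])
    have h4 := ((isOpen_element K j).uniqueDiffWithinAt hη).eq h2 h3
    exact congrArg (fun L : Space d →L[ℝ] Space d => L v) h4
  -- Openness gives unique differentiability on the image, which is needed to identify the first
  -- iterated derivative with `fderivWithin` in norm.
  have hopen : IsOpen (F '' element K j) := by
    rw [himg]
    refine isOpen_image_of_injective hP (isOpen_element K j) fun η hη v w hvw => ?_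
    rw [← hchain η hη v, ← hchain η hη w, hvw]
  obtain ⟨C, hC⟩ := hF.bounded_inv j hj 1
  refine ⟨C, fun η hη v => ?_⟩
  have hmem := mem_image_of_mem F hη
  have h1 := hC _ hmem
  rw [norm_iteratedFDerivWithin_one _ (hopen.uniqueDiffWithinAt hmem)] at h1
  calc ‖v‖ = _ := (congrArg norm (hchain η hη v)).symm
    _ ≤ _ := ContinuousLinearMap.le_of_opNorm_le _ h1 _

/-- The lower bound is a closed condition on the point, because the derivative of `P` is continuous;
so it passes from an open element to its closure, and these closures cover the cube. -/
lemma exists_bound_fderiv (hF : IsSplinePatch K F) (hP : IsC11 P)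
    (hE : EqOn P F (cube d)) {η : Space d} (hη : η ∈ cube d) :
    ∃ C : ℝ, ∀ v, ‖v‖ ≤ C * ‖fderiv ℝ P η v‖ := by
  obtain ⟨j, hj, hcl⟩ := exists_mem_closure_element K hη
  obtain ⟨C, hC⟩ := exists_bound_fderiv_element hF hP hE hj
  refine ⟨C, ?_⟩
  have hclosed : IsClosed {ζ : Space d | ∀ v, ‖v‖ ≤ C * ‖fderiv ℝ P ζ v‖} := by
    simp only [ofPred_forall]
    refine isClosed_iInter fun v => isClosed_le continuous_const ?_
    exact continuous_const.mul (hP.2.continuous.clm_apply continuous_const).norm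
  exact closure_minimal (fun ζ hζ => hC ζ hζ) hclosed hcl

lemma domain_eq_image (hE : EqOn P F (cube d)) : domain F = P '' interior (cube d) :=
  image_congr fun _ hη => (hE (interior_subset hη)).symm

lemma isOpen_domain (hF : IsSplinePatch K F) (hP : IsC11 P) (hE : EqOn P F (cube d)) :
    IsOpen (domain F) := by
  rw [domain_eq_image hE]
  refine isOpen_image_of_injective hP isOpen_interior fun η hη => ?_
  obtain ⟨C, hC⟩ := exists_bound_fderiv hF hP hE (interior_subset hη)
  exact injective_of_bound hC

lemma domain_subset_image (F : Space d → Space d) : domain F ⊆ F '' cube d :=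
  image_mono interior_subset

lemma isCompact_image_cube (hP : IsC11 P) (hE : EqOn P F (cube d)) : IsCompact (F '' cube d) := by
  rw [← image_congr (fun η hη => hE hη)]
  exact (isCompact_cube d).image hP.1.continuous

lemma volume_domain_lt_top (hP : IsC11 P) (hE : EqOn P F (cube d)) : volume (domain F) < ⊤ :=
  (measure_mono (domain_subset_image F)).trans_lt (isCompact_image_cube hP hE).measure_lt_top

lemma invParam_mem_cube {x : Space d} (hx : x ∈ F '' cube d) : invParam F x ∈ cube d :=
  Function.invFunOn_mem hx

lemma apply_invParam {x : Space d} (hx : x ∈ F '' cube d) : F (invParam F x) = x :=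
  Function.invFunOn_eq hx

/-- The inverse of a continuous injection of a compact set is continuous, since closed subsets have
compact images. -/
lemma continuousOn_invParam (hinj : InjOn F (cube d)) (hP : IsC11 P) (hE : EqOn P F (cube d)) :
    ContinuousOn (invParam F) (F '' cube d) := by
  rw [continuousOn_iff_isClosed]
  intro t ht
  refine ⟨F '' (cube d ∩ t), ?_, ?_⟩
  · rw [← image_congr (fun η hη => hE hη.1)]
    exact (((isCompact_cube d).inter_right ht).image hP.1.continuous).isClosed
  · ext x
    constructor
    · rintro ⟨h1, h2⟩
      exact ⟨⟨_, ⟨invParam_mem_cube h2, h1⟩, apply_invParam h2⟩, h2⟩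
    · rintro ⟨⟨η, hη, rfl⟩, h2⟩
      exact ⟨by rw [mem_preimage, invParam_apply hinj hη.1]; exact hη.2, h2⟩

/-- A strictly differentiable map with derivative bounded below is locally bounded below. -/
lemma exists_nhds_norm_sub_le {E G : Type*} [NormedAddCommGroup E] [NormedSpace ℝ E]
    [NormedAddCommGroup G] [NormedSpace ℝ G] {P : E → G} {L : E →L[ℝ] G} {η : E}
    (hs : HasStrictFDerivAt P L η) {C : ℝ} (hC : ∀ v, ‖v‖ ≤ C * ‖L v‖) :
    ∃ D : ℝ≥0, ∃ U ∈ 𝓝 η, ∀ a ∈ U, ∀ b ∈ U, ‖a - b‖ ≤ D * ‖P a - P b‖ := by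
  obtain ⟨D, hDpos, hCD⟩ : ∃ D : ℝ≥0, (0 : ℝ) < D ∧ C ≤ D :=
    ⟨‖C‖₊ + 1, by positivity, by
      push_cast; rw [Real.norm_eq_abs]; linarith [le_abs_self C]⟩
  -- With this tolerance the linearization error, multiplied by `D`, is at most half of `‖a - b‖`
  -- and can be absorbed.
  have hlo := hs.isLittleO.def (c := (2 * (D : ℝ))⁻¹) (by positivity)
  rw [nhds_prod_eq] at hlo
  obtain ⟨U, hU, hsub⟩ := mem_prod_self_iff.1 hlo
  refine ⟨2 * D, U, hU, fun a ha b hb => ?_⟩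
  have h1 : ‖P a - P b - L (a - b)‖ ≤ (2 * (D : ℝ))⁻¹ * ‖a - b‖ := hsub (mk_mem_prod ha hb)
  have h2 : ‖a - b‖ ≤ D * ‖L (a - b)‖ :=
    (hC _).trans (mul_le_mul_of_nonneg_right hCD (norm_nonneg _))
  have h3 : ‖L (a - b)‖ ≤ ‖P a - P b‖ + (2 * (D : ℝ))⁻¹ * ‖a - b‖ := by
    have := norm_sub_le (P a - P b) (P a - P b - L (a - b))
    rw [sub_sub_cancel] at this
    linarith
  have h4 : (D : ℝ) * ((2 * (D : ℝ))⁻¹ * ‖a - b‖) = ‖a - b‖ / 2 := by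
    field_simp
  have h5 := mul_le_mul_of_nonneg_left h3 hDpos.le
  rw [mul_add, h4] at h5
  push_cast
  linarith

/-- The inverse of the parametrization is Lipschitz. -/
lemma exists_lipschitzOnWith_invParam (hF : IsSplinePatch K F) (hP : IsC11 P)
    (hE : EqOn P F (cube d)) : ∃ C : ℝ≥0, LipschitzOnWith C (invParam F) (F '' cube d) := by
  -- Compactness makes the local estimates global; the image of the cube need not be convex.
  refine LocallyLipschitzOn.exists_lipschitzOnWith_of_compact (isCompact_image_cube hP hE) ?_
  intro x hx
  obtain ⟨C, hC⟩ := exists_bound_fderiv hF hP hE (invParam_mem_cube hx)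
  obtain ⟨D, U, hU, hUP⟩ := exists_nhds_norm_sub_le
    (hP.contDiff.contDiffAt.hasStrictFDerivAt (by norm_num)) hC
  have hpre : invParam F ⁻¹' U ∈ 𝓝[F '' cube d] x :=
    continuousOn_invParam hF.injOn hP hE x hx hU
  refine ⟨D, _, inter_mem hpre self_mem_nhdsWithin, LipschitzOnWith.of_dist_le_mul ?_⟩
  rintro y ⟨hy, hyc⟩ z ⟨hz, hzc⟩
  have h1 := hUP _ hy _ hz
  rwa [hE (invParam_mem_cube hyc), hE (invParam_mem_cube hzc), apply_invParam hyc,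
    apply_invParam hzc, ← dist_eq_norm, ← dist_eq_norm] at h1

/-- Functions on `Ω` that are restrictions of Lipschitz functions and whose partial derivatives
`G k` on `Ω` are restrictions of Lipschitz functions. -/
structure IsLipschitzC11On (Ω : Set (Space d)) (V : Space d → ℝ) (G : Fin d → Space d → ℝ) :
    Prop where
  lipschitz : ∃ C : ℝ≥0, LipschitzWith C V
  lipschitz_deriv : ∀ k, ∃ C : ℝ≥0, LipschitzWith C (G k)
  hasFDerivAt : ∀ x ∈ Ω, HasFDerivAt V (∑ k, G k x • (EuclideanSpace.proj k : Space d →L[ℝ] ℝ)) x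

lemma clm_eq_sum_proj (L : Space d →L[ℝ] ℝ) :
    L = ∑ k, L (EuclideanSpace.single k 1) • (EuclideanSpace.proj k : Space d →L[ℝ] ℝ) := by
  refine ContinuousLinearMap.coe_injective
    ((EuclideanSpace.basisFun (Fin d) ℝ).toBasis.ext fun i => ?_)
  simp

lemma hasFDerivAt_invParam (hF : IsSplinePatch K F) (hP : IsC11 P)
    (hE : EqOn P F (cube d)) {x : Space d} (hx : x ∈ domain F) :
    HasFDerivAt (invParam F) ((fderiv ℝ P (invParam F x)).inverse) x := by
  have hxc := domain_subset_image F hx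
  obtain ⟨C, hC⟩ := exists_bound_fderiv hF hP hE (invParam_mem_cube hxc)
  obtain ⟨e, he⟩ := exists_equiv_of_bound (injective_of_bound hC)
  rw [← he, ContinuousLinearMap.inverse_equiv]
  have hnhds : domain F ∈ 𝓝 x := (isOpen_domain hF hP hE).mem_nhds hx
  refine HasFDerivAt.of_local_left_inverse (f := P) ?_ ?_ ?_
  · exact (continuousOn_invParam hF.injOn hP hE).continuousAt
      (mem_of_superset hnhds (domain_subset_image F))
  · rw [he]; exact (hP.1 _).hasFDerivAt
  · filter_upwards [hnhds] with y hy
    have hyc := domain_subset_image F hy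
    rw [hE (invParam_mem_cube hyc), apply_invParam hyc]

lemma contDiffAt_comp_inverse {E W : Type*} [NormedAddCommGroup E] [NormedSpace ℝ E]
    [CompleteSpace E] [NormedAddCommGroup W] [NormedSpace ℝ W] (A : E →L[ℝ] W) (e : E ≃L[ℝ] E) :
    ContDiffAt ℝ 1 (fun q : (E →L[ℝ] W) × (E →L[ℝ] E) => q.1.comp q.2.inverse)
      (A, (e : E →L[ℝ] E)) := by
  have h0 : ContDiffAt ℝ 1 (ContinuousLinearMap.inverse : (E →L[ℝ] E) → (E →L[ℝ] E))
    (A, (e : E →L[ℝ] E)).2 := contDiffAt_map_inverse e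
  have h1 := ContDiffAt.comp (A, (e : E →L[ℝ] E)) h0 contDiffAt_snd
  exact ContDiffAt.clm_comp contDiffAt_fst h1

/-- This is the physical gradient of the push-forward in parametric coordinates. Inversion is `C¹`
near an invertible map, so its composition with the locally Lipschitz derivatives of `S` and `P` is
locally Lipschitz, up to and including the boundary of the compact cube. -/
lemma exists_lipschitzOnWith_gradient (hF : IsSplinePatch K F) (hP : IsC11 P)
    (hE : EqOn P F (cube d)) {S : Space d → ℝ} (hS : IsC11 S) :
    ∃ C : ℝ≥0, LipschitzOnWith C
      (fun η => (fderiv ℝ S η).comp (fderiv ℝ P η).inverse) (cube d) := by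
  refine LocallyLipschitzOn.exists_lipschitzOnWith_of_compact (isCompact_cube d) ?_
  intro η hη
  obtain ⟨C, hC⟩ := exists_bound_fderiv hF hP hE hη
  obtain ⟨e, he⟩ := exists_equiv_of_bound (injective_of_bound hC)
  have hΘd := contDiffAt_comp_inverse (fderiv ℝ S η) e
  rw [he] at hΘd
  obtain ⟨A, t, ht, hA⟩ := hΘd.exists_lipschitzOnWith
  have hpair : LocallyLipschitz fun η => (fderiv ℝ S η, fderiv ℝ P η) := hS.2.prodMk hP.2
  obtain ⟨B, u, hu, hB⟩ := hpair η
  have hpre : (fun η => (fderiv ℝ S η, fderiv ℝ P η)) ⁻¹' t ∈ 𝓝 η :=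
    hpair.continuous.continuousAt ht
  have h := hA.comp (hB.mono (inter_subset_left (t :=
    (fun η => (fderiv ℝ S η, fderiv ℝ P η)) ⁻¹' t))) fun ζ hζ => hζ.2
  exact ⟨A * B, _, mem_nhdsWithin_of_mem_nhds (inter_mem hu hpre), h⟩

/-- Push-forwards of `C^{1,1}` functions under the parametrization. -/
lemma exists_isLipschitzC11On (hF : IsSplinePatch K F) (hP : IsC11 P)
    (hE : EqOn P F (cube d)) {S : Space d → ℝ} (hS : IsC11 S) :
    ∃ V G, IsLipschitzC11On (domain F) V G ∧ EqOn V (S ∘ invParam F) (domain F) := by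
  obtain ⟨C, hC⟩ := exists_lipschitzOnWith_invParam hF hP hE
  obtain ⟨A, hA⟩ := exists_lipschitzOnWith_gradient hF hP hE hS
  have hmaps : MapsTo (invParam F) (F '' cube d) (cube d) := fun x hx => invParam_mem_cube hx
  obtain ⟨B, hB⟩ := LocallyLipschitzOn.exists_lipschitzOnWith_of_compact (isCompact_cube d)
    (hS.contDiff.locallyLipschitz.locallyLipschitzOn (s := cube d))
  -- Extending the push-forward and its partial derivatives to all of space makes integration by
  -- parts for globally Lipschitz functions available.
  obtain ⟨V, hV, hVe⟩ := (hB.comp hC hmaps).extend_real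
  have hG : ∀ k, ∃ C' : ℝ≥0, LipschitzOnWith C' (fun x => ((fderiv ℝ S (invParam F x)).comp
      (fderiv ℝ P (invParam F x)).inverse) (EuclideanSpace.single k (1 : ℝ))) (F '' cube d) := by
    intro k
    have h1 := hA.comp hC hmaps
    exact ⟨_, (ContinuousLinearMap.apply ℝ ℝ
      (EuclideanSpace.single k (1 : ℝ) : Space d)).lipschitz.comp_lipschitzOnWith h1⟩
  choose C' hC' using hG
  choose G hG hGe using fun k => (hC' k).extend_real
  refine ⟨V, G, ⟨⟨_, hV⟩, fun k => ⟨_, hG k⟩, fun x hx => ?_⟩,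
    fun x hx => (hVe (domain_subset_image F hx)).symm⟩
  have hxc := domain_subset_image F hx
  have h1 := ((hS.1 (invParam F x)).hasFDerivAt).comp x (hasFDerivAt_invParam hF hP hE hx)
  have h2 : V =ᶠ[𝓝 x] S ∘ invParam F := by
    filter_upwards [(isOpen_domain hF hP hE).mem_nhds hx] with y hy
    exact (hVe (domain_subset_image F hy)).symm
  have h3 := h1.congr_of_eventuallyEq h2
  rw [clm_eq_sum_proj ((fderiv ℝ S (invParam F x)).comp _)] at h3
  have h4 : ∀ k, ((fderiv ℝ S (invParam F x)).comp (fderiv ℝ P (invParam F x)).inverse)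
      (EuclideanSpace.single k (1 : ℝ)) = G k x := fun k => hGe k hxc
  simp only [h4] at h3
  exact h3

end Geometry


/-! ### The weak Laplacian of `C^{1,1}` functions -/

section WeakLaplacian

variable {d : ℕ} {Ω : Set (Space d)}

/-- Directional derivatives of a Lipschitz function are also its weak derivatives; the compact
support of `φ` removes boundary terms. -/
lemma integral_mul_fderiv_of_lipschitz {E : Type*} [NormedAddCommGroup E] [NormedSpace ℝ E]
    [FiniteDimensional ℝ E] [MeasurableSpace E] [BorelSpace E] {μ : Measure E}
    [μ.IsAddHaarMeasure] {U : Set E} {f φ : E → ℝ} {C : ℝ≥0} (hf : LipschitzWith C f)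
    (hφ : IsTest U φ) (e : E) :
    ∫ x, f x * fderiv ℝ φ x e ∂μ = - ∫ x, lineDeriv ℝ f x e * φ x ∂μ := by
  obtain ⟨D, hD⟩ := ContDiff.lipschitzWith_of_hasCompactSupport hφ.2.1
    (contDiff_infty.1 hφ.1 1) (by norm_num)
  rw [hf.integral_lineDeriv_mul_eq hD hφ.2.1 e, ← integral_neg]
  refine integral_congr_ae (Eventually.of_forall fun x => ?_)
  simp only
  rw [(hφ.differentiable x).lineDeriv_eq_fderiv, map_neg]
  ring

/-- The Laplacian of a function whose partial derivatives are the Lipschitz functions `G k`. -/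
def divLineDeriv (G : Fin d → Space d → ℝ) (x : Space d) : ℝ :=
  ∑ k, lineDeriv ℝ (G k) x (EuclideanSpace.single k 1)

lemma IsLipschitzC11On.lineDeriv_eq {V : Space d → ℝ} {G : Fin d → Space d → ℝ}
    (h : IsLipschitzC11On Ω V G) {x : Space d} (hx : x ∈ Ω) (k : Fin d) :
    lineDeriv ℝ V x (EuclideanSpace.single k 1) = G k x := by
  rw [(h.hasFDerivAt x hx).differentiableAt.lineDeriv_eq_fderiv, (h.hasFDerivAt x hx).fderiv]
  simp

lemma integrable_mul_of_isTest {E : Type*} [NormedAddCommGroup E] [NormedSpace ℝ E] [MeasurableSpace E]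
    [OpensMeasurableSpace E] [SecondCountableTopology E] {μ : Measure E}
    [IsFiniteMeasureOnCompacts μ] {U : Set E} {f φ : E → ℝ}
    (hf : LocallyIntegrable f μ) (hφ : IsTest U φ) : Integrable (fun x => f x * φ x) μ := by
  have := hf.integrable_smul_left_of_hasCompactSupport hφ.continuous hφ.2.1
  exact this.congr (Eventually.of_forall fun x => by simp [mul_comm])

/-- Two integrations by parts in each direction, the first on `V` and the second on `G k`. In
between, the derivative of `V` is known to be `G k` only on `Ω`, which suffices because the
derivatives of `φ` vanish outside. -/
lemma IsLipschitzC11On.hasWeakLaplacian {V : Space d → ℝ} {G : Fin d → Space d → ℝ}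
    (h : IsLipschitzC11On Ω V G) : HasWeakLaplacian Ω V (divLineDeriv G) := by
  intro φ hφ
  obtain ⟨C, hC⟩ := h.lipschitz
  have hG := h.lipschitz_deriv
  choose D hD using hG
  rw [setIntegral_eq_integral_of_forall_compl_eq_zero fun x hx => by
      rw [hφ.laplacian.apply_eq_zero hx, mul_zero],
    setIntegral_eq_integral_of_forall_compl_eq_zero fun x hx => by
      rw [hφ.apply_eq_zero hx, mul_zero]]
  have e : ∀ k : Fin d, EuclideanSpace.basisFun (Fin d) ℝ k = EuclideanSpace.single k (1 : ℝ) :=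
    fun k => by simp
  simp only [laplacian_eq_sum_fderiv (contDiff_infty.1 hφ.1 2), Finset.mul_sum, e, divLineDeriv,
    Finset.sum_mul]
  rw [integral_finsetSum _ fun k _ => integrable_mul_of_isTest (hC.continuous.locallyIntegrable)
      ((hφ.fderiv_apply _).fderiv_apply _),
    integral_finsetSum _ fun k _ => integrable_mul_of_isTest
      ((hD k).locallyIntegrable_lineDeriv _) hφ]
  refine Finset.sum_congr rfl fun k _ => ?_
  rw [integral_mul_fderiv_of_lipschitz hC (hφ.fderiv_apply _), ← neg_neg (∫ x, lineDeriv ℝ (G k) x _ * φ x),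
    ← integral_mul_fderiv_of_lipschitz (hD k) hφ]
  congr 1
  refine integral_congr_ae (Eventually.of_forall fun x => ?_)
  by_cases hx : x ∈ Ω
  · simp only [h.lineDeriv_eq hx k]
  · simp only [(hφ.fderiv_apply _).apply_eq_zero hx, mul_zero]

lemma exists_bound_divLineDeriv {G : Fin d → Space d → ℝ}
    (hG : ∀ k, ∃ C : ℝ≥0, LipschitzWith C (G k)) : ∃ C : ℝ, ∀ x, ‖divLineDeriv G x‖ ≤ C := by
  choose D hD using hG
  refine ⟨∑ k, D k * ‖(EuclideanSpace.single k 1 : Space d)‖, fun x => ?_⟩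
  exact (norm_sum_le _ _).trans (Finset.sum_le_sum fun k _ => norm_lineDeriv_le_of_lipschitz ℝ (hD k))

lemma measurable_divLineDeriv {G : Fin d → Space d → ℝ}
    (hG : ∀ k, ∃ C : ℝ≥0, LipschitzWith C (G k)) : Measurable (divLineDeriv G) := by
  choose D hD using hG
  exact Finset.measurable_sum _ fun k _ => measurable_lineDeriv (hD k).continuous

end WeakLaplacian

/-! ### A criterion for membership in `H_0^1` -/

section H01

variable {d : ℕ} {Ω : Set (Space d)}

/-- Dominated convergence with a constant bound, integrable because the measure is finite. -/
lemma tendsto_eLpNorm_two_zero_of_bounded {α H : Type*} [MeasurableSpace α] {μ : Measure α}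
    [IsFiniteMeasure μ] [NormedAddCommGroup H] {f : ℕ → α → H} {C : ℝ≥0}
    (hf : ∀ n, AEStronglyMeasurable (f n) μ) (hC : ∀ n, ∀ᵐ x ∂μ, ‖f n x‖ ≤ C)
    (h0 : ∀ᵐ x ∂μ, Tendsto (fun n => f n x) atTop (𝓝 0)) :
    Tendsto (fun n => eLpNorm (f n) 2 μ) atTop (𝓝 0) := by
  have hlin : Tendsto (fun n => ∫⁻ x, ‖f n x‖ₑ ^ (2 : ℝ) ∂μ) atTop (𝓝 (∫⁻ _, 0 ∂μ)) := by
    refine tendsto_lintegral_of_dominated_convergence' (fun _ => (C : ℝ≥0∞) ^ (2 : ℝ))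
      (fun n => (hf n).enorm.pow_const _) (fun n => ?_) ?_ ?_
    · filter_upwards [hC n] with x hx
      refine ENNReal.rpow_le_rpow ?_ (by norm_num)
      rw [enorm_eq_nnnorm]
      exact_mod_cast hx
    · rw [lintegral_const]
      exact ENNReal.mul_ne_top (ENNReal.rpow_ne_top_of_nonneg (by norm_num) ENNReal.coe_ne_top)
        (measure_ne_top _ _)
    · filter_upwards [h0] with x hx
      have h1 : Tendsto (fun n => ‖f n x‖ₑ) atTop (𝓝 0) := by
        have h3 := (continuous_enorm.tendsto (0 : H)).comp hx
        rw [enorm_zero] at h3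
        exact h3
      have h2 := (ENNReal.continuous_rpow_const (y := 2)).tendsto (0 : ℝ≥0∞)
      rw [ENNReal.zero_rpow_of_pos (by norm_num)] at h2
      exact h2.comp h1
  rw [lintegral_zero] at hlin
  have e : ∀ n, eLpNorm (f n) 2 μ = (∫⁻ x, ‖f n x‖ₑ ^ (2 : ℝ) ∂μ) ^ (1 / (2 : ℝ)) := fun n => by
    rw [eLpNorm_eq_lintegral_rpow_enorm_toReal (by norm_num) (by norm_num)]
    simp
  simp only [e]
  have h2 := (ENNReal.continuous_rpow_const (y := 1 / (2 : ℝ))).tendsto (0 : ℝ≥0∞)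
  rw [ENNReal.zero_rpow_of_pos (by norm_num)] at h2
  exact h2.comp hlin

open scoped Convolution in
/-- Mollification: compactly supported `C^1` functions are uniform `C^1` limits of test functions. -/
lemma exists_isTest_approx (hΩ : IsOpen Ω) {ψ : Space d → ℝ} (hψ : ContDiff ℝ 1 ψ)
    (hc : HasCompactSupport ψ) (hs : tsupport ψ ⊆ Ω) {ε : ℝ} (hε : 0 < ε) :
    ∃ φ, IsTest Ω φ ∧ ∀ x, ‖ψ x - φ x‖ ≤ ε ∧ ‖fderiv ℝ ψ x - fderiv ℝ φ x‖ ≤ ε := by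
  obtain ⟨δ₀, hδ₀, hthick⟩ := hc.isCompact.exists_cthickening_subset_open hΩ hs
  have hu1 := hc.uniformContinuous_of_continuous hψ.continuous
  have hfc : Continuous (fderiv ℝ ψ) := hψ.continuous_fderiv (by norm_num)
  have hu2 := (hc.fderiv ℝ).uniformContinuous_of_continuous hfc
  obtain ⟨δ₁, hδ₁, h1⟩ := Metric.uniformContinuous_iff.1 hu1 ε hε
  obtain ⟨δ₂, hδ₂, h2⟩ := Metric.uniformContinuous_iff.1 hu2 ε hε
  -- The first radius keeps the mollified support inside `Ω`; the other two come from uniform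
  -- continuity of `ψ` and of its derivative.
  set δ := min δ₀ (min δ₁ δ₂) with hδdef
  have hδ : 0 < δ := by positivity
  let B : ContDiffBump (0 : Space d) := ⟨δ / 2, δ, by positivity, by linarith⟩
  have hBout : B.rOut = δ := rfl
  set φ : Space d → ℝ := B.normed volume ⋆[ContinuousLinearMap.lsmul ℝ ℝ, volume] ψ with hφ
  have hBint : LocallyIntegrable (B.normed volume) volume :=
    B.continuous_normed.locallyIntegrable
  have hφd : ∀ x, fderiv ℝ φ x
      = (B.normed volume ⋆[ContinuousLinearMap.lsmul ℝ ℝ, volume] fderiv ℝ ψ) x := fun x => by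
    rw [(hc.hasFDerivAt_convolution_right (ContinuousLinearMap.lsmul ℝ ℝ) hBint hψ x).fderiv]
    rfl
  have hsm : ContDiff ℝ ∞ φ :=
    B.hasCompactSupport_normed.contDiff_convolution_left _ B.contDiff_normed
      hψ.continuous.locallyIntegrable
  have hsupp : tsupport φ ⊆ Metric.cthickening δ (tsupport ψ) := by
    refine closure_minimal ?_ Metric.isClosed_cthickening
    intro x hx
    have hx' := support_convolution_subset_swap (ContinuousLinearMap.lsmul ℝ ℝ) hx
    obtain ⟨y, hy, z, hz, rfl⟩ := hx'
    rw [B.support_normed_eq, hBout, mem_ball_zero_iff] at hz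
    refine Metric.mem_cthickening_of_dist_le _ y _ _ (subset_closure hy) ?_
    rw [dist_eq_norm]; simpa using hz.le
  refine ⟨φ, ⟨hsm, ?_, hsupp.trans ((Metric.cthickening_mono (min_le_left _ _) _).trans hthick)⟩,
    fun x => ⟨?_, ?_⟩⟩
  · exact (hc.isCompact.cthickening).of_isClosed_subset (isClosed_tsupport φ) hsupp
  · rw [← dist_eq_norm, dist_comm]
    refine B.dist_normed_convolution_le hψ.continuous.aestronglyMeasurable fun y hy => ?_
    exact (h1 ((Metric.mem_ball.1 hy).trans_le
      ((min_le_right _ _).trans (min_le_left _ _)))).le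
  · rw [← dist_eq_norm, dist_comm, hφd]
    refine B.dist_normed_convolution_le hfc.aestronglyMeasurable fun y hy => ?_
    exact (h2 ((Metric.mem_ball.1 hy).trans_le
      ((min_le_right _ _).trans (min_le_right _ _)))).le

/-- A smooth function vanishing near the origin, with bounded derivative, close to the identity. -/
lemma exists_truncation : ∃ (θ : ℝ → ℝ) (M : ℝ), ContDiff ℝ 1 θ ∧ (∀ s, |s| ≤ 1 → θ s = 0) ∧
    (∀ s, 2 ≤ |s| → θ s = s ∧ deriv θ s = 1) ∧ (∀ s, |θ s - s| ≤ 2) ∧ ∀ s, |deriv θ s| ≤ M := by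
  let b : ContDiffBump (0 : ℝ) := ⟨1, 2, by norm_num, by norm_num⟩
  have hb : ContDiff ℝ 1 b := b.contDiff
  -- The truncation is `θ(s) = s - s b(s)`, with a bump `b` equal to `1` on `[-1,1]` and `0` outside
  -- `(-2,2)`.
  have hd : ∀ s, HasDerivAt (fun s => s - s * b s) (1 - (b s + s * deriv b s)) s := fun s => by
    have := (hasDerivAt_id s).sub ((hasDerivAt_id s).mul (hb.differentiable (by norm_num) s).hasDerivAt)
    simpa using! this
  have hb0 : ∀ s, 2 ≤ |s| → b s = 0 := fun s hs => b.zero_of_le_dist (by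
    rw [Real.dist_eq, sub_zero]; exact hs)
  have hsupp : tsupport b = Metric.closedBall (0 : ℝ) 2 := b.tsupport_eq
  have hcont : Continuous (fun s => b s + s * deriv b s) :=
    hb.continuous.add (continuous_id.mul (hb.continuous_deriv (by norm_num)))
  -- At `|s| = 2` the bump is not locally zero; the identity there is the limit of the one for `|s|
  -- > 2`.
  have hz : ∀ s, 2 ≤ |s| → b s + s * deriv b s = 0 := by
    have hcl : closure {s : ℝ | 2 < |s|} ⊆ {s | b s + s * deriv b s = 0} := by
      refine closure_minimal (fun s hs => ?_) (isClosed_eq hcont continuous_const)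
      have h1 : b s = 0 := hb0 s (le_of_lt hs)
      have h2 : deriv b s = 0 := by
        have : (b : ℝ → ℝ) =ᶠ[𝓝 s] fun _ => 0 := by
          filter_upwards [(isOpen_lt continuous_const continuous_abs).mem_nhds hs] with r hr
          exact hb0 r (le_of_lt hr)
        rw [this.deriv_eq, deriv_const]
      change b s + s * deriv b s = 0
      rw [h1, h2]; ring
    intro s hs
    refine hcl ?_
    rw [Metric.mem_closure_iff]
    intro ε hε
    rcases le_total 0 s with h | h
    · refine ⟨s + ε / 2, ?_, ?_⟩
      · rw [abs_of_nonneg h] at hs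
        change 2 < |s + ε / 2|
        rw [abs_of_nonneg (by linarith)]; linarith
      · rw [Real.dist_eq, abs_lt]; constructor <;> linarith
    · refine ⟨s - ε / 2, ?_, ?_⟩
      · rw [abs_of_nonpos h] at hs
        change 2 < |s - ε / 2|
        rw [abs_of_nonpos (by linarith)]; linarith
      · rw [Real.dist_eq, abs_lt]; constructor <;> linarith
  obtain ⟨M, hM⟩ := (isCompact_Icc (a := (-2 : ℝ)) (b := 2)).exists_bound_of_continuousOn
    hcont.continuousOn
  have hM' : ∀ s, |b s + s * deriv b s| ≤ |M| := fun s => by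
    by_cases hs : 2 ≤ |s|
    · rw [hz s hs, abs_zero]; exact abs_nonneg _
    · rw [not_le, abs_lt] at hs
      exact (hM s ⟨hs.1.le, hs.2.le⟩).trans (le_abs_self M)
  refine ⟨fun s => s - s * b s, 1 + |M|, contDiff_id.sub (contDiff_id.mul hb), ?_, ?_, ?_, ?_⟩
  · intro s hs
    simp only
    rw [b.one_of_mem_closedBall (by rw [Metric.mem_closedBall, Real.dist_eq, sub_zero]; exact hs)]
    ring
  · intro s hs
    rw [(hd s).deriv, hz s hs]
    simp only
    rw [hb0 s hs]
    constructor <;> ring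
  · intro s
    simp only
    rw [sub_sub_cancel_left, abs_neg, abs_mul]
    by_cases hs : 2 ≤ |s|
    · rw [hb0 s hs]; simp
    · rw [abs_of_nonneg (b.nonneg (x := s))]
      calc |s| * b s ≤ 2 * 1 := mul_le_mul (not_le.1 hs).le b.le_one b.nonneg (by norm_num)
        _ = 2 := by norm_num
  · intro s
    rw [(hd s).deriv]
    calc |1 - (b s + s * deriv b s)| ≤ |1| + |b s + s * deriv b s| := abs_sub _ _
      _ ≤ 1 + |M| := by rw [abs_one]; linarith [hM' s]

/-- A bounded-gradient `C^1` function on `Ω` all of whose superlevel sets `{|V| ≥ ε}` are compact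
subsets of `Ω` belongs to `H_0^1(Ω)`. -/
lemma memH01_of_isCompact_superlevel (hΩ : IsOpen Ω) (hfin : volume Ω < ⊤) {V : Space d → ℝ}
    (hV : ContDiffOn ℝ 1 V Ω) (hVL : MemLp V 2 (volume.restrict Ω)) {C : ℝ}
    (hC : ∀ x ∈ Ω, ‖fderiv ℝ V x‖ ≤ C)
    (hK : ∀ ε > 0, IsCompact {x | x ∈ Ω ∧ ε ≤ |V x|}) : MemH01 Ω V := by
  classical
  have : Fact (volume Ω < ⊤) := ⟨hfin⟩
  obtain ⟨θ, M, hθ, hθ0, hθ1, hθ2, hθM⟩ := exists_truncation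
  have hVd : ∀ x ∈ Ω, HasFDerivAt V (fderiv ℝ V x) x := fun x hx =>
    ((hV.differentiableOn (by norm_num)) x hx |>.differentiableAt (hΩ.mem_nhds hx)).hasFDerivAt
  set ε : ℕ → ℝ := fun n => 1 / ((n : ℝ) + 1) with hεdef
  have hε : ∀ n, 0 < ε n := fun n => Nat.one_div_pos_of_nat
  have hε0 : Tendsto ε atTop (𝓝 0) := tendsto_one_div_add_atTop_nhds_zero_nat
  -- Rescaled truncation: `ψ n` vanishes where `|V| < ε n`, so its support lies in a compact
  -- superlevel set, while it differs from `V` by at most `2 ε n` on `Ω`.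
  set ψ : ℕ → Space d → ℝ := fun n x => if x ∈ Ω then ε n * θ (V x / ε n) else 0 with hψdef
  have hψΩ : ∀ n, ∀ x ∈ Ω, ψ n x = ε n * θ (V x / ε n) := fun n x hx => if_pos hx
  have hψ0 : ∀ n x, x ∉ {x | x ∈ Ω ∧ ε n ≤ |V x|} → ψ n x = 0 := by
    intro n x hx
    by_cases hxΩ : x ∈ Ω
    · rw [hψΩ n x hxΩ, hθ0, mul_zero]
      have : |V x| < ε n := by
        by_contra h; exact hx ⟨hxΩ, not_lt.1 h⟩
      rw [abs_div, abs_of_pos (hε n), div_le_one (hε n)]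
      exact this.le
    · exact if_neg hxΩ
  have hψs : ∀ n, tsupport (ψ n) ⊆ {x | x ∈ Ω ∧ ε n ≤ |V x|} := fun n =>
    closure_minimal (fun x hx => by_contra fun h => hx (hψ0 n x h)) (hK _ (hε n)).isClosed
  have hψc : ∀ n, HasCompactSupport (ψ n) := fun n =>
    (hK _ (hε n)).of_isClosed_subset (isClosed_tsupport _) (hψs n)
  have hψd : ∀ n, ContDiff ℝ 1 (ψ n) := by
    intro n
    rw [contDiff_iff_contDiffAt]
    intro x
    by_cases hx : x ∈ {x | x ∈ Ω ∧ ε n ≤ |V x|}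
    · have h1 : ContDiffAt ℝ 1 (fun x => ε n * θ (V x / ε n)) x :=
        contDiffAt_const.mul (hθ.contDiffAt.comp x
          ((hV.contDiffAt (hΩ.mem_nhds hx.1)).div_const _))
      refine h1.congr_of_eventuallyEq ?_
      filter_upwards [hΩ.mem_nhds hx.1] with y hy using hψΩ n y hy
    · have h1 : ContDiffAt ℝ 1 (fun _ : Space d => (0 : ℝ)) x := contDiffAt_const
      refine h1.congr_of_eventuallyEq ?_
      filter_upwards [(hK _ (hε n)).isClosed.isOpen_compl.mem_nhds hx] with y hy
      exact hψ0 n y hy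
  have hψf : ∀ n, ∀ x ∈ Ω, fderiv ℝ (ψ n) x = deriv θ (V x / ε n) • fderiv ℝ V x := by
    intro n x hx
    have h1 : ψ n =ᶠ[𝓝 x] fun x => ε n * θ (V x / ε n) := by
      filter_upwards [hΩ.mem_nhds hx] with y hy using hψΩ n y hy
    rw [h1.fderiv_eq]
    have h2 : HasDerivAt (fun y => ε n * θ (y / ε n)) (deriv θ (V x / ε n)) (V x) := by
      have h3 := ((hθ.differentiable (by norm_num) (V x / ε n)).hasDerivAt.comp (V x)
        ((hasDerivAt_id (V x)).div_const (ε n))).const_mul (ε n)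
      rw [mul_comm (deriv θ _), ← mul_assoc, mul_one_div_cancel (hε n).ne', one_mul] at h3
      exact h3
    exact (h2.comp_hasFDerivAt x (hVd x hx)).fderiv
  choose φ hφ hφψ using fun n => exists_isTest_approx hΩ (hψd n) (hψc n)
    ((hψs n).trans fun x hx => hx.1) (hε n)
  have hgrad : ∀ (f h : Space d → ℝ) x, ‖gradient f x - gradient h x‖ = ‖fderiv ℝ f x - fderiv ℝ h x‖ :=
    fun f h x => by
      rw [gradient, gradient, ← map_sub, LinearIsometryEquiv.norm_map]
  -- The gradients of all `ψ n` vanish where `V = 0`, so their pointwise limit is set to zero there.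
  -- This avoids proving that `∇V = 0` almost everywhere on the zero set.
  set g : Space d → Space d := fun x => if V x = 0 then 0 else gradient V x with hg
  have hVm : AEMeasurable V (volume.restrict Ω) := hVL.1.aemeasurable
  have hgradm : AEStronglyMeasurable (gradient V) (volume.restrict Ω) := by
    have hc : ContinuousOn (fderiv ℝ V) Ω := hV.continuousOn_fderiv_of_isOpen hΩ (by norm_num)
    exact ((InnerProductSpace.toDual ℝ (Space d)).symm.continuous.comp_continuousOn
      hc).aestronglyMeasurable hΩ.measurableSet
  have hgm : AEStronglyMeasurable g (volume.restrict Ω) := by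
    have h0 : NullMeasurableSet {x | V x = 0} (volume.restrict Ω) :=
      hVm.nullMeasurableSet_preimage (measurableSet_singleton 0)
    have : g = {x | V x = 0}ᶜ.indicator (gradient V) := by
      funext x
      by_cases h : V x = 0
      · rw [indicator_of_notMem (by simpa using h)]; simp [hg, h]
      · rw [indicator_of_mem (by simpa using h)]; simp [hg, h]
    rw [this]
    exact hgradm.indicator₀ h0.compl
  have hgradC : ∀ x ∈ Ω, ‖gradient V x‖ ≤ C := fun x hx => by
    rw [gradient, LinearIsometryEquiv.norm_map]; exact hC x hx
  have hgC : ∀ x ∈ Ω, ‖g x‖ ≤ |C| := fun x hx => by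
    by_cases h : V x = 0
    · simp [hg, h]
    · simp only [hg, if_neg h]; exact (hgradC x hx).trans (le_abs_self C)
  refine ⟨hVL, g, φ, ?_, hφ, ?_, ?_⟩
  · exact MemLp.of_bound hgm |C| ((ae_restrict_iff' hΩ.measurableSet).2 (Eventually.of_forall hgC))
  · have hb : ∀ n, ∀ x ∈ Ω, ‖(V - φ n) x‖ ≤ 3 * ε n := by
      intro n x hx
      have h1 : ‖V x - ψ n x‖ ≤ 2 * ε n := by
        rw [hψΩ n x hx, norm_sub_rev, Real.norm_eq_abs]
        have e1 : ε n * θ (V x / ε n) - V x = ε n * (θ (V x / ε n) - V x / ε n) := by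
          field_simp [(hε n).ne']
        rw [e1, abs_mul, abs_of_pos (hε n), mul_comm 2]
        exact mul_le_mul_of_nonneg_left (hθ2 _) (hε n).le
      calc ‖(V - φ n) x‖ = ‖(V x - ψ n x) + (ψ n x - φ n x)‖ := by simp
        _ ≤ 2 * ε n + ε n := (norm_add_le _ _).trans (add_le_add h1 (hφψ n x).1)
        _ = 3 * ε n := by ring
    refine tendsto_eLpNorm_two_zero_of_bounded (C := 3)
      (fun n => hVL.1.sub ((hφ n).memLp 2).1) (fun n => ?_) ?_
    · filter_upwards [ae_restrict_mem hΩ.measurableSet] with x hx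
      refine (hb n x hx).trans ?_
      have : ε n ≤ 1 := by
        rw [hεdef]; simp only; rw [div_le_one (by positivity)]; linarith [(Nat.cast_nonneg n : (0 : ℝ) ≤ n)]
      push_cast; linarith
    · filter_upwards [ae_restrict_mem hΩ.measurableSet] with x hx
      exact squeeze_zero_norm (fun n => hb n x hx) (by simpa using hε0.const_mul 3)
  · have hb : ∀ n, ∀ x ∈ Ω, ‖(g - gradient (φ n)) x‖ ≤ ‖g x - gradient (ψ n) x‖ + ε n := by
      intro n x hx
      calc ‖(g - gradient (φ n)) x‖
          = ‖(g x - gradient (ψ n) x) + (gradient (ψ n) x - gradient (φ n) x)‖ := by simp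
        _ ≤ _ := (norm_add_le _ _).trans (add_le_add le_rfl (by
          rw [hgrad]; exact (hφψ n x).2))
    have hε1 : ∀ n, ε n ≤ 1 := fun n => by
      rw [hεdef]; simp only; rw [div_le_one (by positivity)]
      linarith [(Nat.cast_nonneg n : (0 : ℝ) ≤ n)]
    have hψg : ∀ n, ∀ x ∈ Ω, gradient (ψ n) x = deriv θ (V x / ε n) • gradient V x := by
      intro n x hx
      rw [gradient, hψf n x hx, gradient]
      simp
    refine tendsto_eLpNorm_two_zero_of_bounded (C := ‖|C| + M * C + 1‖₊)
      (fun n => hgm.sub ((hφ n).memLp_gradient 2).1) (fun n => ?_) ?_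
    · filter_upwards [ae_restrict_mem hΩ.measurableSet] with x hx
      refine (hb n x hx).trans (le_trans ?_ (le_abs_self _))
      have h1 : ‖gradient (ψ n) x‖ ≤ M * C := by
        rw [hψg n x hx, norm_smul]
        exact mul_le_mul (hθM _) (hgradC x hx) (norm_nonneg _) ((abs_nonneg _).trans (hθM 0))
      have h2 := norm_sub_le (g x) (gradient (ψ n) x)
      linarith [hgC x hx, hε1 n]
    · filter_upwards [ae_restrict_mem hΩ.measurableSet] with x hx
      refine squeeze_zero_norm' (a := ε) ?_ hε0
      have h1 : ∀ᶠ n in atTop, g x = gradient (ψ n) x := by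
        by_cases h : V x = 0
        · refine Eventually.of_forall fun n => ?_
          have : deriv θ 0 = 0 := by
            have : θ =ᶠ[𝓝 0] fun _ => 0 := by
              filter_upwards [Metric.ball_mem_nhds (0 : ℝ) one_pos] with s hs
              rw [Metric.mem_ball, Real.dist_eq, sub_zero] at hs
              exact hθ0 s hs.le
            rw [this.deriv_eq, deriv_const]
          rw [hψg n x hx, h, zero_div, this, zero_smul]
          simp [hg, h]
        · have hpos : 0 < |V x| := abs_pos.2 h
          filter_upwards [hε0.eventually (gt_mem_nhds (show (0 : ℝ) < |V x| / 2 by positivity))]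
            with n hn
          have h2 : 2 ≤ |V x / ε n| := by
            rw [abs_div, abs_of_pos (hε n), le_div_iff₀ (hε n)]; linarith
          rw [hψg n x hx, (hθ1 _ h2).2, one_smul]
          simp [hg, h]
      filter_upwards [h1] with n hn
      have := hb n x hx
      rwa [← hn, sub_self, norm_zero, zero_add] at this

end H01


/-! ### Sums of tensor products in the energy space -/

section TensorSum

variable {d : ℕ} {Ω : Set (Space d)} {T : ℝ} {ι : Type*}

lemma memLp_two_mul_prod {α β : Type*} [MeasurableSpace α] [MeasurableSpace β] {μ : Measure α}
    {ν : Measure β} [SFinite μ] [SFinite ν] {a : α → ℝ} {b : β → ℝ} (ha : MemLp a 2 μ)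
    (hb : MemLp b 2 ν) : MemLp (fun q : α × β => a q.1 * b q.2) 2 (μ.prod ν) := by
  refine (memLp_two_iff_integrable_sq (ha.1.comp_fst.mul hb.1.comp_snd)).2 ?_
  exact (ha.integrable_sq.mul_prod hb.integrable_sq).congr
    (Eventually.of_forall fun q => (mul_pow _ _ 2).symm)

lemma HasWeakLaplacian.sum (s : Finset ι) {u z : ι → Space d → ℝ} (c : ι → ℝ)
    (h : ∀ i ∈ s, HasWeakLaplacian Ω (u i) (z i))
    (hu : ∀ i ∈ s, MemLp (u i) 2 (volume.restrict Ω))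
    (hz : ∀ i ∈ s, MemLp (z i) 2 (volume.restrict Ω)) :
    HasWeakLaplacian Ω (fun x => ∑ i ∈ s, u i x * c i) (fun x => ∑ i ∈ s, z i x * c i) := by
  intro φ hφ
  simp only [Finset.sum_mul]
  rw [integral_finsetSum _ fun i hi => integrable_mul_of_memLp_two ((hu i hi).mul_const _)
      (hφ.laplacian.memLp 2),
    integral_finsetSum _ fun i hi => integrable_mul_of_memLp_two ((hz i hi).mul_const _)
      (hφ.memLp 2)]
  refine Finset.sum_congr rfl fun i hi => ?_
  simp only [mul_right_comm _ (c i)]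
  rw [integral_mul_const, integral_mul_const, h i hi φ hφ]

lemma LipschitzWith.memLp_two {γ : ℝ → ℝ} {C : ℝ≥0} (h : LipschitzWith C γ) :
    MemLp γ 2 (volume.restrict (Ioo 0 T)) := by
  obtain ⟨B, hB⟩ := isCompact_Icc.exists_bound_of_continuousOn
    (h.continuous.continuousOn (s := Icc 0 T))
  refine MemLp.of_bound h.continuous.aestronglyMeasurable B ?_
  filter_upwards [ae_restrict_mem measurableSet_Ioo] with t ht using hB t (Ioo_subset_Icc_self ht)

lemma LipschitzWith.memLp_two_deriv {γ : ℝ → ℝ} {C : ℝ≥0} (h : LipschitzWith C γ) :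
    MemLp (deriv γ) 2 (volume.restrict (Ioo 0 T)) :=
  MemLp.of_bound (measurable_deriv γ).aestronglyMeasurable C
    (Eventually.of_forall fun _ => norm_deriv_le_of_lipschitz h)

lemma hasWeakDeriv_sum_of_lipschitz (hT : 0 < T) (s : Finset ι) {γ : ι → ℝ → ℝ} (c : ι → ℝ)
    (h : ∀ i ∈ s, ∃ C : ℝ≥0, LipschitzWith C (γ i)) :
    HasWeakDeriv T (fun t => ∑ i ∈ s, c i * γ i t) (fun t => ∑ i ∈ s, c i * deriv (γ i) t) := by
  intro φ hφ
  simp only [Finset.sum_mul]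
  have hγ : ∀ i ∈ s, MemLp (γ i) 2 (volume.restrict (Ioo 0 T)) := fun i hi => by
    obtain ⟨C, hC⟩ := h i hi
    exact LipschitzWith.memLp_two hC
  have hγ' : ∀ i ∈ s, MemLp (deriv (γ i)) 2 (volume.restrict (Ioo 0 T)) := fun i hi => by
    obtain ⟨C, hC⟩ := h i hi
    exact LipschitzWith.memLp_two_deriv hC
  rw [integral_finsetSum _ fun i hi => integrable_mul_of_memLp_two ((hγ i hi).const_mul _)
      (hφ.deriv.memLp 2),
    integral_finsetSum _ fun i hi => integrable_mul_of_memLp_two ((hγ' i hi).const_mul _)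
      (hφ.memLp 2), ← Finset.sum_neg_distrib]
  refine Finset.sum_congr rfl fun i hi => ?_
  obtain ⟨C, hC⟩ := h i hi
  exact (hasWeakDeriv_of_absolutelyContinuous hT
    (hC.lipschitzOnWith.absolutelyContinuousOnInterval) ae_eq_rfl).const_mul (c i) φ hφ

/-- A finite sum of tensor products of functions with weak Laplacian and Lipschitz functions of
time belongs to the energy space if its boundary and initial values vanish. -/
lemma exists_mem_V0_of_tensor_sum (hΩ : MeasurableSet Ω) (hT : 0 < T) [Fintype ι]
    {V Z : ι → Space d → ℝ} {γ : ι → ℝ → ℝ}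
    (hV : ∀ i, MemLp (V i) 2 (volume.restrict Ω)) (hZ : ∀ i, MemLp (Z i) 2 (volume.restrict Ω))
    (hVZ : ∀ i, HasWeakLaplacian Ω (V i) (Z i)) (hγ : ∀ i, ∃ C : ℝ≥0, LipschitzWith C (γ i))
    (hH : ∀ t ∈ Ioo 0 T, MemH01 Ω fun x => ∑ i, V i x * γ i t)
    (h0 : ∀ x ∈ Ω, ∑ i, V i x * γ i 0 = 0) :
    ∃ v ∈ V0 Ω T, v =ᵐ[cylMeasure Ω T] fun q => ∑ i, V i q.1 * γ i q.2 := by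
  choose C hC using hγ
  have key : ∀ {a : ι → Space d → ℝ} {b : ι → ℝ → ℝ},
      (∀ i, MemLp (a i) 2 (volume.restrict Ω)) →
      (∀ i, MemLp (b i) 2 (volume.restrict (Ioo 0 T))) →
      MemLp (fun q : Space d × ℝ => ∑ i, a i q.1 * b i q.2) 2 (cylMeasure Ω T) := by
    intro a b ha hb
    rw [cylMeasure_eq_prod]
    exact memLp_finsetSum _ fun i _ => memLp_two_mul_prod (ha i) (hb i)
  have hv := key hV fun i => LipschitzWith.memLp_two (hC i)
  have hg := key hV fun i => LipschitzWith.memLp_two_deriv (hC i)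
  have hz := key hZ fun i => LipschitzWith.memLp_two (hC i)
  refine ⟨hv.toLp _, ⟨⟨hz.toLp _, ?_⟩, ⟨hg.toLp _, ?_⟩, ?_⟩, hv.coeFn_toLp⟩
  · filter_upwards [ae_ae_of_ae_cyl' hv.coeFn_toLp, ae_ae_of_ae_cyl' hz.coeFn_toLp,
      ae_restrict_mem measurableSet_Ioo] with t h1 h2 ht
    -- The Laplacian is computed term by term, but the boundary condition is available only for the
    -- whole sum: the single factors `V i` need not vanish on the boundary.
    refine ⟨(hH t ht).congr (h1.mono fun _ h => h.symm), ?_⟩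
    exact (HasWeakLaplacian.sum Finset.univ (fun i => γ i t) (fun i _ => hVZ i) (fun i _ => hV i)
      fun i _ => hZ i).congr (h1.mono fun _ h => h.symm) (h2.mono fun _ h => h.symm)
  · filter_upwards [ae_ae_of_ae_cyl hv.coeFn_toLp, ae_ae_of_ae_cyl hg.coeFn_toLp] with x h1 h2
    exact (hasWeakDeriv_sum_of_lipschitz hT Finset.univ (fun i => V i x)
      fun i _ => ⟨C i, hC i⟩).congr (h1.mono fun _ h => h.symm) (h2.mono fun _ h => h.symm)
  · filter_upwards [ae_ae_of_ae_cyl hv.coeFn_toLp, ae_restrict_mem hΩ] with x h1 hx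
    refine ⟨fun t => ∑ i, V i x * γ i t, ?_, h0 x hx, h1⟩
    exact (continuous_finsetSum _ fun i _ =>
      continuous_const.mul (hC i).continuous).continuousOn

end TensorSum

/-! ### Conformity of the isogeometric space -/

section Conformity

variable {d ps pt mt : ℕ} {m : Fin d → ℕ} {K : ∀ l, OpenKnotVector ps (m l)}
  {Kt : OpenKnotVector pt mt} {F P : Space d → Space d} {T : ℝ}

lemma memLp_two_domain_of_continuous (hP : IsC11 P) (hE : EqOn P F (cube d))
    (hΩ : IsOpen (domain F)) {V : Space d → ℝ} (hV : Continuous V) :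
    MemLp V 2 (volume.restrict (domain F)) := by
  have : Fact (volume (domain F) < ⊤) := ⟨volume_domain_lt_top hP hE⟩
  obtain ⟨B, hB⟩ := (isCompact_image_cube hP hE).exists_bound_of_continuousOn hV.continuousOn
  refine MemLp.of_bound hV.aestronglyMeasurable B ?_
  filter_upwards [ae_restrict_mem hΩ.measurableSet] with x hx using hB x (domain_subset_image F hx)

lemma IsLipschitzC11On.contDiffOn {Ω : Set (Space d)} {V : Space d → ℝ} {G : Fin d → Space d → ℝ}
    (h : IsLipschitzC11On Ω V G) (hΩ : IsOpen Ω) : ContDiffOn ℝ 1 V Ω := by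
  rw [show (1 : WithTop ℕ∞) = 0 + 1 from (zero_add 1).symm, contDiffOn_succ_iff_fderiv_of_isOpen hΩ]
  refine ⟨fun x hx => (h.hasFDerivAt x hx).differentiableAt.differentiableWithinAt, by simp, ?_⟩
  rw [contDiffOn_zero]
  refine ContinuousOn.congr (f := fun x => ∑ k, G k x • (EuclideanSpace.proj k : Space d →L[ℝ] ℝ))
    (Continuous.continuousOn ?_) fun x hx => (h.hasFDerivAt x hx).fderiv
  refine continuous_finsetSum _ fun k _ => ?_
  obtain ⟨C, hC⟩ := h.lipschitz_deriv k
  exact hC.continuous.smul continuous_const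

/-- The push-forward of a `C^{1,1}` function that vanishes on the boundary of the cube. -/
lemma IsLipschitzC11On.memH01 (hF : IsSplinePatch K F) (hP : IsC11 P) (hE : EqOn P F (cube d))
    {S V : Space d → ℝ} {G : Fin d → Space d → ℝ} (hS : Continuous S)
    (h0 : ∀ η ∈ frontier (cube d), S η = 0) (h : IsLipschitzC11On (domain F) V G)
    (hV : EqOn V (S ∘ invParam F) (domain F)) : MemH01 (domain F) V := by
  have hΩ := isOpen_domain hF hP hE
  obtain ⟨C, hC⟩ := h.lipschitz
  refine memH01_of_isCompact_superlevel hΩ (volume_domain_lt_top hP hE) (h.contDiffOn hΩ)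
    (memLp_two_domain_of_continuous hP hE hΩ hC.continuous)
    (fun x _ => norm_fderiv_le_of_lipschitz ℝ hC) fun ε hε => ?_
  -- Since `S` vanishes on the frontier, `{|S| ≥ ε}` within the cube stays in the interior; the
  -- superlevel set is therefore the continuous image of a compact set.
  have hset : {x | x ∈ domain F ∧ ε ≤ |V x|} = P '' (cube d ∩ {η | ε ≤ |S η|}) := by
    ext x
    constructor
    · rintro ⟨hx, hxV⟩
      have hxc := domain_subset_image F hx
      refine ⟨invParam F x, ⟨invParam_mem_cube hxc, ?_⟩, ?_⟩
      · rw [hV hx] at hxV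
        exact hxV
      · rw [hE (invParam_mem_cube hxc), apply_invParam hxc]
    · rintro ⟨η, ⟨hη, hηS⟩, rfl⟩
      have hint : η ∈ interior (cube d) := by
        by_contra hn
        have : S η = 0 := h0 η ⟨subset_closure hη, hn⟩
        rw [mem_ofPred_eq, this, abs_zero] at hηS
        exact absurd hηS (not_le.2 hε)
      have hmem : P η ∈ domain F := by
        rw [hE hη]
        exact mem_image_of_mem F hint
      refine ⟨hmem, ?_⟩
      rw [hV hmem, Function.comp_apply, hE hη, invParam_apply hF.injOn hη]
      exact hηS
  rw [hset]
  exact ((isCompact_cube d).inter_right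
    (isClosed_le continuous_const hS.abs)).image hP.1.continuous

lemma exists_tensor_representation {w : Space d × ℝ → ℝ} (hw : w ∈ spaceTimeSplines K Kt) :
    ∃ s : ((∀ l, Fin (m l)) × Fin mt) → Space d → ℝ, (∀ i, s i ∈ spaceSplines K) ∧
      ∀ η τ, w (η, τ) = ∑ i, s i η * bspline Kt.knot pt i.2 τ := by
  obtain ⟨c, rfl⟩ := (Submodule.mem_span_range_iff_exists_fun ℝ).1 hw
  refine ⟨fun i => c i • fun η => ∏ l, bspline (K l).knot ps (i.1 l) (η l),
    fun i => Submodule.smul_mem _ _ (Submodule.subset_span ⟨i.1, rfl⟩), fun η τ => ?_⟩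
  simp [Finset.sum_apply, mul_assoc]

lemma exists_lipschitz_extension_bspline (hC0 : ∀ s ∈ splineSpace Kt, ContinuousOn s (Icc 0 1))
    (i : Fin mt) : ∃ (β : ℝ → ℝ) (C : ℝ≥0), LipschitzWith C β ∧
      EqOn β (bspline Kt.knot pt i) (Icc 0 1) := by
  obtain ⟨C, hC⟩ := exists_lipschitzOnWith_of_piecewise_polynomial Kt
    (hC0 _ (Submodule.subset_span ⟨i, rfl⟩))
    fun j hj => bspline_eqOn_polynomial Kt hj pt i (by have := i.2; omega)
  obtain ⟨β, hβ, hE⟩ := hC.extend_real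
  exact ⟨β, C, hβ, hE.symm⟩

/-- The push-forwards of the discrete functions belong to the energy space. -/
lemma exists_mem_V0_of_paramSpace (hC1 : ∀ s ∈ spaceSplines K, ContDiffOn ℝ 1 s (cube d))
    (hC0 : ∀ s ∈ splineSpace Kt, ContinuousOn s (Icc 0 1)) (hF : IsSplinePatch K F) (hT : 0 < T)
    {w : Space d × ℝ → ℝ} (hw : w ∈ paramSpace K Kt) :
    ∃ v ∈ V0 (domain F) T, v =ᵐ[cylMeasure (domain F) T] pushForward F T w := by
  obtain ⟨hws, hw1, hw0⟩ := hw
  obtain ⟨P, hP, hE⟩ := exists_isC11_extension_patch hC1 hF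
  have hΩ := isOpen_domain hF hP hE
  have : Fact (volume (domain F) < ⊤) := ⟨volume_domain_lt_top hP hE⟩
  obtain ⟨s, hs, hrep⟩ := exists_tensor_representation hws
  choose S hS hSs using fun i => exists_isC11_extension hC1 hF (hs i)
  choose V G hVG hVS using fun i => exists_isLipschitzC11On hF hP hE (hS i)
  choose β C hβ hβb using fun i : Fin mt => exists_lipschitz_extension_bspline hC0 i
  have hVc : ∀ i, Continuous (V i) := fun i => by
    obtain ⟨D, hD⟩ := (hVG i).lipschitz
    exact hD.continuous
  -- The left endpoint is included because the initial condition is evaluated at `t = 0`.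
  have hcube : ∀ t ∈ Ico 0 T, t / T ∈ Icc (0 : ℝ) 1 := fun t ht =>
    ⟨div_nonneg ht.1 hT.le, (div_le_one hT).2 ht.2.le⟩
  have hSw : ∀ t ∈ Ico 0 T, ∀ η ∈ cube d, ∑ i, S i η * β i.2 (t / T) = w (η, t / T) := by
    intro t ht η hη
    rw [hrep]
    exact Finset.sum_congr rfl fun i _ => by rw [hSs i hη, hβb i.2 (hcube t ht)]
  have hVw : ∀ t ∈ Ico 0 T, ∀ x ∈ domain F,
      ∑ i, V i x * β i.2 (t / T) = w (invParam F x, t / T) := by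
    intro t ht x hx
    rw [← hSw t ht _ (invParam_mem_cube (domain_subset_image F hx))]
    exact Finset.sum_congr rfl fun i _ => by rw [hVS i hx, Function.comp_apply]
  obtain ⟨v, hv, hve⟩ := exists_mem_V0_of_tensor_sum (V := V) (Z := fun i => divLineDeriv (G i))
    (γ := fun i t => β i.2 (t / T)) hΩ.measurableSet hT
    (fun i => memLp_two_domain_of_continuous hP hE hΩ (hVc i))
    (fun i => by
      obtain ⟨B, hB⟩ := exists_bound_divLineDeriv (hVG i).lipschitz_deriv
      exact MemLp.of_bound (measurable_divLineDeriv (hVG i).lipschitz_deriv).aestronglyMeasurable B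
        (Eventually.of_forall hB))
    (fun i => (hVG i).hasWeakLaplacian)
    (fun i => ⟨C i.2 * ‖T⁻¹‖₊, by
      have h1 : LipschitzWith ‖T⁻¹‖₊ fun t : ℝ => t / T := by
        simp only [div_eq_mul_inv, mul_comm _ T⁻¹]
        exact lipschitzWith_smul T⁻¹
      exact (hβ i.2).comp h1⟩)
    (fun t ht => by
      have htc := Ioo_subset_Ico_self ht
      -- At a fixed time the whole sum is a single function with locally Lipschitz derivative, and
      -- it vanishes on the frontier of the cube; the criterion for `H_0^1` is applied to it.
      have hSt : IsC11 fun η => ∑ i, S i η • β i.2 (t / T) :=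
        IsC11.sum _ fun i _ => (hS i).smul (IsC11.const _)
      obtain ⟨V', G', hVG', hVS'⟩ := exists_isLipschitzC11On hF hP hE hSt
      refine (hVG'.memH01 hF hP hE hSt.1.continuous (fun η hη => ?_) hVS').congr ?_
      · have hηc : η ∈ cube d := (isCompact_cube d).isClosed.frontier_subset hη
        exact (hSw t htc η hηc).trans (hw1 η hη _ (hcube t htc))
      · filter_upwards [ae_restrict_mem hΩ.measurableSet] with x hx
        rw [hVS' hx, hVw t htc x hx]
        exact hSw t htc _ (invParam_mem_cube (domain_subset_image F hx)))
    (fun x hx => by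
      rw [hVw 0 ⟨le_rfl, hT⟩ x hx, zero_div]
      exact hw0 _ (invParam_mem_cube (domain_subset_image F hx)))
  refine ⟨v, hv, hve.trans ?_⟩
  filter_upwards [ae_restrict_mem (hΩ.measurableSet.prod measurableSet_Ioo)] with q hq
  exact hVw q.2 (Ioo_subset_Ico_self hq.2) q.1 hq.1

variable (K Kt) in
/-- The discrete parametric space as a subspace. -/
def paramSubmodule : Submodule ℝ (Space d × ℝ → ℝ) where
  carrier := paramSpace K Kt
  add_mem' := fun ⟨h1, h2, h3⟩ ⟨k1, k2, k3⟩ => ⟨add_mem h1 k1,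
    fun η hη τ hτ => by rw [Pi.add_apply, h2 η hη τ hτ, k2 η hη τ hτ, add_zero],
    fun η hη => by rw [Pi.add_apply, h3 η hη, k3 η hη, add_zero]⟩
  zero_mem' := ⟨zero_mem _, fun _ _ _ _ => rfl, fun _ _ => rfl⟩
  smul_mem' := fun c _ ⟨h1, h2, h3⟩ => ⟨Submodule.smul_mem _ c h1,
    fun η hη τ hτ => by rw [Pi.smul_apply, h2 η hη τ hτ, smul_zero],
    fun η hη => by rw [Pi.smul_apply, h3 η hη, smul_zero]⟩

instance : FiniteDimensional ℝ (paramSubmodule K Kt) := by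
  have : FiniteDimensional ℝ (spaceTimeSplines K Kt) :=
    FiniteDimensional.span_of_finite ℝ (finite_range _)
  have hle : paramSubmodule K Kt ≤ spaceTimeSplines K Kt := fun _ h => h.1
  exact Submodule.finiteDimensional_of_le hle

/-- The isogeometric space is a finite-dimensional subspace of the energy space. -/
lemma exists_submodule_eq_Vh0 (hV : ∀ w ∈ paramSpace K Kt, ∃ v ∈ V0 (domain F) T,
      v =ᵐ[cylMeasure (domain F) T] pushForward F T w) :
    ∃ V : Submodule ℝ (L2Cyl (domain F) T), (V : Set (L2Cyl (domain F) T)) = Vh0 K Kt F T ∧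
      V ≤ energySpace (domain F) T ∧ FiniteDimensional ℝ V := by
  choose L hL hLw using fun w : paramSubmodule K Kt => hV w w.2
  -- The chosen classes depend linearly on `w` because each is determined almost everywhere by its
  -- push-forward. The isogeometric space is then the range of a linear map on a finite-dimensional
  -- space.
  let Λ : paramSubmodule K Kt →ₗ[ℝ] L2Cyl (domain F) T :=
    { toFun := L
      map_add' := fun w w' => Lp.ext (by
        filter_upwards [hLw (w + w'), hLw w, hLw w', Lp.coeFn_add (L w) (L w')] with q h1 h2 h3 h4
        rw [h1, h4, Pi.add_apply, h2, h3]
        rfl)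
      map_smul' := fun c w => Lp.ext (by
        filter_upwards [hLw (c • w), hLw w, Lp.coeFn_smul c (L w)] with q h1 h2 h3
        rw [h1, RingHom.id_apply, h3, Pi.smul_apply, h2]
        rfl) }
  refine ⟨LinearMap.range Λ, ?_, ?_, inferInstance⟩
  · ext v
    constructor
    · rintro ⟨w, rfl⟩
      exact ⟨w, w.2, hLw w⟩
    · rintro ⟨w, hw, hv⟩
      exact ⟨⟨w, hw⟩, Lp.ext ((hLw ⟨w, hw⟩).trans hv.symm)⟩
  · rintro _ ⟨w, rfl⟩
    exact hL w

end Conformity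

end SpaceTimeLS

end

theorem mainTheorem3 {d : ℕ} (hd : 0 < d)
    {ps pt mt : ℕ} {m : Fin d → ℕ}
    (K : ∀ l, OpenKnotVector ps (m l)) (Kt : OpenKnotVector pt mt)
    (hps : 2 ≤ ps) (hC1 : ∀ s ∈ spaceSplines K, ContDiffOn ℝ 1 s (cube d))
    (hpt : 1 ≤ pt) (hC0 : ∀ s ∈ splineSpace Kt, ContinuousOn s (Icc 0 1))
    (F : Space d → Space d) (hF : IsSplinePatch K F)
    (T : ℝ) (hT : 0 < T) (f : L2Cyl (domain F) T) :
    -- conformity: every push-forward is (the class of) an element of `V_0`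
    (∀ w ∈ paramSpace K Kt, ∃ v ∈ V0 (domain F) T,
      v =ᵐ[cylMeasure (domain F) T] pushForward F T w) ∧
    -- equivalence of the two discrete problems
    (∀ uh : L2Cyl (domain F) T,
      IsMinimizer (Vh0 K Kt F T) f uh ↔ IsVariationalSolution (Vh0 K Kt F T) f uh) ∧
    -- existence and uniqueness
    (∃! uh : L2Cyl (domain F) T, IsMinimizer (Vh0 K Kt F T) f uh) ∧
    -- quasi-optimality
    (∀ u uh : L2Cyl (domain F) T,
      IsMinimizer (V0 (domain F) T) f u → IsMinimizer (Vh0 K Kt F T) f uh →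
      V0norm (u - uh) ≤ Real.sqrt 2 * ⨅ vh : Vh0 K Kt F T, V0norm (u - (vh : L2Cyl (domain F) T))) := by
  have hconf : ∀ w ∈ paramSpace K Kt, ∃ v ∈ V0 (domain F) T,
      v =ᵐ[cylMeasure (domain F) T] pushForward F T w :=
    fun w hw => exists_mem_V0_of_paramSpace hC1 hC0 hF hT hw
  obtain ⟨P, hP, hE⟩ := exists_isC11_extension_patch hC1 hF
  have hΩ := isOpen_domain hF hP hE
  obtain ⟨V, hVeq, hV, hfin⟩ := exists_submodule_eq_Vh0 hconf
  rw [← hVeq]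
  exact ⟨hconf, fun uh => isMinimizer_iff_isVariationalSolution hΩ hV f uh,
    existsUnique_isMinimizer hΩ hT hV f, fun u uh hu huh => V0norm_sub_le_iInf hΩ hT hV hu huh⟩
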